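/- **Conventions.** Let $P$ be a finite graded bounded poset with rank function $\operatorname{rk}$, least element $\hat 0$ and greatest element $\hat 1$; write $s\lessdot t$ if $t$ covers $s$. For $s<t$ the reduced characteristic polynomial is $\overline\chi_{s,t}(x)=\frac{1}{x-1}\sum_{s\le w\le t}\mu(s,w)\,x^{\operatorname{rk}t-\operatorname{rk}w}$, where $\mu$ is the Möbius function. Define $\underline{\mathrm H}_{\hat 1,\hat 1}(x)=1$ and $\underline{\mathrm H}_{s,\hat 1}(x)=\sum_{t>s}\overline\chi_{s,t}(x)\,\underline{\mathrm H}_{t,\hat 1}(x)$ for $s\neq\hat 1$. The *Chow polynomial* of $P$ is $\underline{\mathrm H}_P=\underline{\mathrm H}_{\hat 0,\hat 1}$ and the *augmented Chow polynomial* is $\mathrm H_P(x)=\sum_{s\in P}x^{\operatorname{rk}s}\,\underline{\mathrm H}_{s,\hat 1}(x)$. The order complex $\Delta(P)$ is the simplicial complex of chains of $P$. The $h$-polynomial of a simplicial complex $\Delta$ of dimension $d-1$ with $f_i$ simplices of cardinality $i$ is $h(\Delta;y)=\sum_{i=0}^d f_i\,y^i(1-y)^{d-i}$. $P^*$ denotes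 the dual poset. If $P$ has rank $r$ and $S\subseteq\{1,\dots,r-1\}$, the *rank-selected* poset $P_S$ is the induced subposet on $\{x\in P:\operatorname{rk}x\in S\cup\{0,r\}\}$. An edge labeling $\lambda$ of $P$, i.e. a map from the covering relations of $P$ to a totally ordered set, is an *EL-labeling* if for all $s\le t$ there is a unique maximal chain of $[s,t]$ whose labels increase weakly, and this chain is lexicographically minimal among all maximal chains of $[s,t]$. For $s\in P$ let $\lambda_1<\dots<\lambda_\ell$ be the distinct labels of the covering relations above $s$. The *width* $\omega_s(i)$ is the number of covers $t$ of $s$ with $\lambda(s,t)=\lambda_i$ (and $0$ for $i>\ell$). For $s\lessdot t$, $\mathrm{Ind}(s,t)$ is the $i$ with $\lambda(s,t)=\lambda_i$, and $\mathrm{des}_s(t)$ is the number of distinct labels of covering relations above $t$ that are smaller than $\lambda(s,t)$. The poset $P$ is *UMEL-shellable* if it has an EL-labeling such that * for all $s,s'$ of the same rank, $\omega_s=\omega_{s'}$; * for all $s,s'$ of the same rank and all $s\lessdot t$, $s'\lessdot t'$ with $\mathrm{Ind}(s,t)=\mathrm{Ind}(s',t')$, $\mathrm{des}_s(t)=\mathrm{des}_{s'}(t')$;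 * for each rank $k$, the number $\mathrm{des}_k(i)$, which is the common value of $\mathrm{des}_s(t)$ over all $s\lessdot t$ with $\operatorname{rk}s=k$ and $\mathrm{Ind}(s,t)=i$, is weakly increasing in $i$. The roots of two nonzero real-rooted polynomials $f,g$ *interlace* if, for $(f,g)$ or for $(g,f)$ in place of $(f,g)$, $\deg g\in\{\deg f,\deg f+1\}$ and the roots $\alpha_1\ge\alpha_2\ge\cdots$ of $f$ and $\beta_1\ge\beta_2\ge\cdots$ of $g$, with multiplicity, satisfy $\beta_1\ge\alpha_1\ge\beta_2\ge\alpha_2\ge\cdots$. **Theorem.** Let $P$ be a UMEL-shellable finite graded bounded poset of rank $r$, let $S\subseteq\{1,\dots,r-1\}$, and let $P_S$ be the rank-selected subposet. Then: 1. the Chow polynomials $\underline{\mathrm H}_{P_S}(x)$ and $\underline{\mathrm H}_{P_S^*}(x)$ have only real nonpositive roots; 2. the augmented Chow polynomial $\mathrm H_{P_S}(x)$ has only real nonpositive roots; 3. the roots of $\underline{\mathrm H}_{P_S}(x)$ and $\mathrm H_{P_S}(x)$ interlace; 4. the $h$-polynomial of the order complex $\Delta(P_S)$ has only real nonpositive roots.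 -/

import Mathlib

open Polynomial

universe u v

/-! ### Finite graded bounded posets -/

section Rank

variable {P : Type u} [PartialOrder P]

/-- The rank of `x`: the maximal length of a chain `x₀ < x₁ < ⋯ < x_k = x`. -/
noncomputable def posetRank (x : P) : ℕ := (Order.height x).toNat

/-- A finite poset with a least element is graded if every covering relation raises the rank
by one (equivalently, for each `x` all maximal chains from the least element to `x` have the
same length, namely the rank of `x`). -/
def IsGradedPoset (P : Type u) [PartialOrder P] : Prop :=
  ∀ s t : P, s ⋖ t → posetRank t = posetRank s + 1

end Rank

/-! ### Rank selection -/

/-- The rank-selected subposet `P_S`, with the order induced from `P`. -/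
def RankSelected (P : Type u) [PartialOrder P] [BoundedOrder P] (S : Finset ℕ) : Type u :=
  {x : P // posetRank x ∈ S ∨ posetRank x = 0 ∨ posetRank x = posetRank (⊤ : P)}

instance RankSelected.instPartialOrder (P : Type u) [PartialOrder P] [BoundedOrder P]
    (S : Finset ℕ) : PartialOrder (RankSelected P S) :=
  Subtype.partialOrder _

instance RankSelected.instBoundedOrder (P : Type u) [PartialOrder P] [BoundedOrder P]
    (S : Finset ℕ) : BoundedOrder (RankSelected P S) where
  top := ⟨⊤, Or.inr (Or.inr rfl)⟩
  le_top x := (le_top : x.1 ≤ ⊤)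
  bot := ⟨⊥, Or.inr (Or.inl (by simp [posetRank]))⟩
  bot_le x := (bot_le : ⊥ ≤ x.1)

open Classical in
noncomputable instance RankSelected.instFintype (P : Type u) [PartialOrder P] [BoundedOrder P]
    [Fintype P] (S : Finset ℕ) : Fintype (RankSelected P S) :=
  Subtype.fintype _

/-! ### Chow polynomials -/

section Chow

variable {P : Type u} [PartialOrder P] [Fintype P]

open Classical in
/-- The Möbius function `μ(s, t)` of a finite poset. -/
noncomputable def mobiusFun (s t : P) : ℤ :=
  letI : LocallyFiniteOrder P := Fintype.toLocallyFiniteOrder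
  IncidenceAlgebra.mu ℤ s t

open Classical in
/-- The characteristic polynomial of the interval `[s, t]`:
`∑_{s ≤ w ≤ t} μ(s, w) x^(rk t - rk w)`. -/
noncomputable def intervalCharPoly (s t : P) : ℝ[X] :=
  ∑ w : P with s ≤ w ∧ w ≤ t, C (mobiusFun s w : ℝ) * X ^ (posetRank t - posetRank w)

/-- The reduced characteristic polynomial of `[s, t]` for `s < t`: the (exact) quotient of the
characteristic polynomial by `x - 1`. -/
noncomputable def reducedCharPoly (s t : P) : ℝ[X] :=
  intervalCharPoly s t /ₘ (X - C 1)

open Classical in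
/-- The Chow polynomial of the upper interval `[s, ⊤]`, by the recursion
`H_{s,⊤} = ∑_{s < t} χ̄_{s,t} H_{t,⊤}` for `s ≠ ⊤` and `H_{⊤,⊤} = 1`. -/
noncomputable def chowUpper [OrderTop P] (s : P) : ℝ[X] :=
  if s = ⊤ then 1
  else ∑ t : {t : P // s < t}, reducedCharPoly s t.1 * chowUpper t.1
termination_by wellFounded_gt.wrap s
decreasing_by exact t.2

end Chow

/-- The Chow polynomial of a finite graded bounded poset. -/
noncomputable def chowPoly (P : Type u) [PartialOrder P] [BoundedOrder P] [Fintype P] : ℝ[X] :=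
  chowUpper (⊥ : P)

/-- The augmented Chow polynomial of a finite graded bounded poset. -/
noncomputable def augChowPoly (P : Type u) [PartialOrder P] [BoundedOrder P] [Fintype P] :
    ℝ[X] :=
  ∑ s : P, X ^ posetRank s * chowUpper s

/-! ### Order complex and `h`-polynomial -/

/-- The order complex of a poset: its faces are the nonempty finite chains. -/
def orderComplex (P : Type u) [PartialOrder P] : AbstractSimplicialComplex P where
  faces := {c | c.Nonempty ∧ IsChain (· ≤ ·) (c : Set P)}
  isRelLowerSet_faces := fun _ hc =>
    ⟨hc.1, fun _ hb hne => ⟨hne, hc.2.mono (Finset.coe_subset.mpr hb)⟩⟩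
  singleton_mem x := ⟨Finset.singleton_nonempty x, by simp⟩

section HPoly

variable {ι : Type u} [Fintype ι]

open Classical in
/-- The number of simplices of cardinality `i`; the empty simplex is counted. -/
noncomputable def faceNumber (Δ : AbstractSimplicialComplex ι) (i : ℕ) : ℕ :=
  Finset.card {c : Finset ι | (c = ∅ ∨ c ∈ Δ) ∧ c.card = i}

open Classical in
/-- `dim Δ + 1`, the maximal cardinality of a simplex. -/
noncomputable def maxFaceCard (Δ : AbstractSimplicialComplex ι) : ℕ :=
  Finset.sup {c : Finset ι | c ∈ Δ} Finset.card

/-- The `h`-polynomial of a simplicial complex of dimension `d - 1`: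
`h(y) = (1 - y)^d f(y / (1 - y)) = ∑_{i ≤ d} f_i y^i (1 - y)^(d - i)`. -/
noncomputable def hPoly (Δ : AbstractSimplicialComplex ι) : ℝ[X] :=
  ∑ i ∈ Finset.range (maxFaceCard Δ + 1),
    C (faceNumber Δ i : ℝ) * X ^ i * (1 - X) ^ (maxFaceCard Δ - i)

end HPoly

/-! ### Edge labelings -/

/-- `c` is a saturated chain `s = u₀ ⋖ u₁ ⋖ ⋯ ⋖ u_k = t`. -/
def IsSaturatedChain {P : Type u} [PartialOrder P] (s t : P) (c : List P) : Prop :=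
  c.head? = some s ∧ c.getLast? = some t ∧ c.IsChain (· ⋖ ·)

/-- The list of labels `lam u₀ u₁, lam u₁ u₂, …` of a chain `u₀, u₁, u₂, …`. -/
def chainLabels {P : Type u} {L : Type v} (lam : P → P → L) (c : List P) : List L :=
  List.zipWith lam c c.tail

section Labeling

variable {P : Type u} [PartialOrder P] {L : Type v} [LinearOrder L]

/-- An edge labeling is a function `lam` of which only the values `lam s t` with `s ⋖ t` matter.
It is edge-lexicographical (EL) if every interval `[s, t]` has a unique maximal chain with weakly
increasing labels, and that chain is lexicographically minimal among the maximal chains of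
`[s, t]`. -/
def IsELLabeling (lam : P → P → L) : Prop :=
  ∀ s t : P, s ≤ t → ∃ c : List P,
    (IsSaturatedChain s t c ∧ (chainLabels lam c).IsChain (· ≤ ·)) ∧
    (∀ c' : List P, IsSaturatedChain s t c' → (chainLabels lam c').IsChain (· ≤ ·) → c' = c) ∧
    (∀ c' : List P, IsSaturatedChain s t c' → chainLabels lam c ≤ chainLabels lam c')

variable [Fintype P]

open Classical in
/-- The set of labels of the covering relations above `s`. -/
noncomputable def labelsAbove (lam : P → P → L) (s : P) : Finset L :=
  Finset.image (lam s) {t : P | s ⋖ t}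

/-- The index of the label of `s ⋖ t`: the `i` such that `lam s t` is the `i`-th smallest label
above `s` (counting from `1`). -/
noncomputable def labelIndex (lam : P → P → L) (s t : P) : ℕ :=
  Finset.card {a ∈ labelsAbove lam s | a ≤ lam s t}

open Classical in
/-- The width above `s` at `i`: the number of covers of `s` labeled by the `i`-th label
above `s`. -/
noncomputable def labelWidth (lam : P → P → L) (s : P) (i : ℕ) : ℕ :=
  Finset.card {t : P | s ⋖ t ∧ labelIndex lam s t = i}

/-- The descent count of `s ⋖ t`: the number of labels above `t` smaller than `lam s t`. -/
noncomputable def descentCount (lam : P → P → L) (s t : P) : ℕ :=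
  Finset.card {a ∈ labelsAbove lam t | a < lam s t}

/-- Rank-uniformity of a labeled poset: uniform widths and uniform descents. -/
def IsRankUniformLabeling (lam : P → P → L) : Prop :=
  (∀ s s' : P, posetRank s = posetRank s' →
    ∀ i : ℕ, 1 ≤ i → labelWidth lam s i = labelWidth lam s' i) ∧
  (∀ s s' t t' : P, posetRank s = posetRank s' → s ⋖ t → s' ⋖ t' →
    labelIndex lam s t = labelIndex lam s' t' → descentCount lam s t = descentCount lam s' t')

/-- Monotonicity of a rank-uniform labeled poset: at each rank the descent count is a weakly
increasing function of the label index. -/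
def IsMonotonicLabeling (lam : P → P → L) : Prop :=
  ∀ s s' t t' : P, posetRank s = posetRank s' → s ⋖ t → s' ⋖ t' →
    labelIndex lam s t ≤ labelIndex lam s' t' → descentCount lam s t ≤ descentCount lam s' t'

end Labeling

/-- A finite graded bounded poset is UMEL-shellable if it has an EL-labeling, with labels in some
totally ordered set, that is rank-uniform and monotonic. -/
def UMELShellable (P : Type u) [PartialOrder P] [BoundedOrder P] [Fintype P] : Prop :=
  IsGradedPoset P ∧
    ∃ (L : Type v) (_ : LinearOrder L) (lam : P → P → L),
      IsELLabeling lam ∧ IsRankUniformLabeling lam ∧ IsMonotonicLabeling lam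

/-! ### Roots of polynomials -/

/-- All complex roots of the polynomial are real and nonpositive (this fails for the zero
polynomial). -/
def HasOnlyNonposRealRoots (f : ℝ[X]) : Prop :=
  ∀ z : ℂ, aeval z f = 0 → ∃ x : ℝ, x ≤ 0 ∧ z = (x : ℂ)

/-- `f ≼ g` for nonzero polynomials: `f` and `g` are real-rooted of degrees `n` and
`m ∈ {n, n + 1}`, with roots `α₀ ≥ α₁ ≥ ⋯` and `β₀ ≥ β₁ ≥ ⋯` (counted with multiplicity) such
that `β₀ ≥ α₀ ≥ β₁ ≥ α₁ ≥ ⋯`. -/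
def Interlaces (f g : ℝ[X]) : Prop :=
  f ≠ 0 ∧ g ≠ 0 ∧ ∃ (n m : ℕ) (α β : ℕ → ℝ), (m = n ∨ m = n + 1) ∧
    f = C f.leadingCoeff * ∏ i ∈ Finset.range n, (X - C (α i)) ∧
    g = C g.leadingCoeff * ∏ i ∈ Finset.range m, (X - C (β i)) ∧
    (∀ i, i < n → α i ≤ β i) ∧
    (∀ i, i + 1 < m → β (i + 1) ≤ α i)

/-- The roots of `f` and `g` interlace. -/
def RootsInterlace (f g : ℝ[X]) : Prop :=
  Interlaces f g ∨ Interlaces g f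

/-!
In an EL-labeled poset every interval has exactly one rising chain, so a sum over the elements above
`s` is a sum over rising chains, split according to their first edges. Rank-uniformity makes it
depend on the rank of `s` only and turns it into a recursion over ranks and label indices. Möbius
inversion characterizes the Chow polynomials by a triangular system of such sums. It is solved by
pairs of families `lower`, `upper` indexed by labels, which are reversals of each other; each
selected rank contributes `X` times the quotient by `X - 1` of the difference of their totals.

Replace `f ≼ g` by the condition that `g z` lies in the cone spanned by `f z` and `z * f z` for all
`z` in the upper half plane, which is additive in each argument. As descent counts increase with the
label index, all steps of the recursion preserve interlacing in this sense of the families and of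
their reversals. For the quotient of `X * V - W` by `X - 1`, where `G ≼ V` and `G ≼ W`, this is seen
from partial fractions: `V / G` and `W / G` are nonnegative combinations of `1`, `x` and
`x / (x - θ)`, hence so is the quotient divided by `G`, up to a constant, and its limit at `0` shows
that this constant is nonnegative as well. The `h`-polynomial obeys a simpler recursion over the
same data.
-/

/-! ### Interlacing in the upper half plane -/

section Sector

open ComplexConjugate

/-- The complex number `b` lies in the cone spanned by `a` and `z * a`, for `z` in the upper half
plane. Comparing arguments only through imaginary parts makes the relation additive in `a` and in
`b`, at the price of being vacuous when `a = 0` or `b = 0`. -/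
def InSector (z a b : ℂ) : Prop :=
  0 ≤ (b * conj a).im ∧ 0 ≤ (z * a * conj b).im

theorem im_mul_mul_conj_mul (w a b : ℂ) :
    ((w * a) * conj (w * b)).im = Complex.normSq w * (a * conj b).im := by
  rw [map_mul, mul_mul_mul_comm, Complex.mul_conj, Complex.im_ofReal_mul]

namespace InSector

variable {z w a b c d : ℂ}

theorem zero_left (z b : ℂ) : InSector z 0 b := by simp [InSector]

theorem zero_right (z a : ℂ) : InSector z a 0 := by simp [InSector]

theorem self (hz : 0 ≤ z.im) (a : ℂ) : InSector z a a := by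
  simp only [InSector, mul_assoc, Complex.mul_conj, Complex.ofReal_im, Complex.im_mul_ofReal]
  exact ⟨le_rfl, mul_nonneg hz (Complex.normSq_nonneg a)⟩

theorem add_left (ha : InSector z a c) (hb : InSector z b c) : InSector z (a + b) c := by
  simp only [InSector, map_add, mul_add, add_mul, Complex.add_im]
  exact ⟨add_nonneg ha.1 hb.1, add_nonneg ha.2 hb.2⟩

theorem add_right (hb : InSector z a b) (hc : InSector z a c) : InSector z a (b + c) := by
  simp only [InSector, map_add, mul_add, add_mul, Complex.add_im]
  exact ⟨add_nonneg hb.1 hc.1, add_nonneg hb.2 hc.2⟩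

theorem ofReal_mul_left {r : ℝ} (hr : 0 ≤ r) (h : InSector z a b) : InSector z (r * a) b := by
  simp only [InSector, map_mul, Complex.conj_ofReal, mul_left_comm _ (r : ℂ), mul_assoc,
    Complex.im_ofReal_mul]
  exact ⟨mul_nonneg hr h.1, mul_nonneg hr (by simpa only [mul_assoc] using h.2)⟩

theorem ofReal_mul_right {r : ℝ} (hr : 0 ≤ r) (h : InSector z a b) : InSector z a (r * b) := by
  simp only [InSector, map_mul, Complex.conj_ofReal, mul_left_comm _ (r : ℂ), mul_assoc,
    Complex.im_ofReal_mul]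
  exact ⟨mul_nonneg hr h.1, mul_nonneg hr (by simpa only [mul_assoc] using h.2)⟩

theorem rotate (h : InSector z a b) : InSector z b (z * a) := by
  refine ⟨h.2, ?_⟩
  rw [im_mul_mul_conj_mul]
  exact mul_nonneg (Complex.normSq_nonneg z) h.1

theorem mul_left_iff (hw : w ≠ 0) : InSector z (w * a) (w * b) ↔ InSector z a b := by
  have hpos := Complex.normSq_pos.2 hw
  simp only [InSector, mul_left_comm z w, im_mul_mul_conj_mul, mul_nonneg_iff_of_pos_left hpos]

theorem conj_symm {r : ℝ} (hr : 0 ≤ r) (h : InSector w a b) :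
    InSector (r * w) (conj b) (conj a) := by
  simp only [InSector, mul_assoc, Complex.im_ofReal_mul, Complex.conj_conj]
  exact ⟨by simpa only [mul_comm] using h.1,
    mul_nonneg hr (by simpa only [mul_assoc, mul_comm, mul_left_comm] using h.2)⟩

theorem exists_eq (hz : 0 < z.im) (ha : a ≠ 0) (h : InSector z a b) :
    ∃ s t : ℝ, 0 ≤ s ∧ 0 ≤ t ∧ b = a * (s + t * z) := by
  obtain ⟨w, rfl⟩ : ∃ w, b = a * w := ⟨b / a, (mul_div_cancel₀ b ha).symm⟩
  obtain ⟨hw₁, hw₂⟩ : InSector z 1 w := by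
    rw [← mul_left_iff ha, mul_one]
    exact h
  simp only [map_one, mul_one, Complex.mul_im, Complex.conj_re, Complex.conj_im] at hw₁ hw₂
  refine ⟨w.re - w.im / z.im * z.re, w.im / z.im, ?_, div_nonneg hw₁ hz.le, ?_⟩
  · rw [div_mul_eq_mul_div, sub_nonneg, div_le_iff₀ hz]
    linarith
  · congr 1
    apply Complex.ext
    · simp
    · simp [hz.ne']

theorem im_cone_mul_conj (z : ℂ) (s t s' t' : ℝ) :
    ((s' + t' * z) * conj ((s : ℂ) + t * z)).im = z.im * (s * t' - s' * t) := by
  simp [Complex.mul_im]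
  ring

theorem cone_of_mul_le_mul (hz : 0 ≤ z.im) {s t s' t' : ℝ} (hs : 0 ≤ s) (ht : 0 ≤ t)
    (hs' : 0 ≤ s') (ht' : 0 ≤ t') (h : s' * t ≤ s * t') :
    InSector z (s + t * z) (s' + t' * z) := by
  refine ⟨?_, ?_⟩
  · rw [im_cone_mul_conj]
    exact mul_nonneg hz (sub_nonneg.2 h)
  · have key : (z * (s + t * z) * conj ((s' : ℂ) + t' * z)).im
        = z.im * (s * s' + 2 * (z.re * (t * s')) + t * t' * (z.re ^ 2 + z.im ^ 2)) := by
      simp [Complex.mul_im, Complex.mul_re]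
      ring
    rw [key]
    refine mul_nonneg hz ?_
    -- The quadratic form dominates `p + 2 r + q` with `r ^ 2 ≤ p * q`.
    have hsq : (z.re * (t * s')) ^ 2 ≤ s * s' * (t * t' * (z.re ^ 2 + z.im ^ 2)) := by
      have h₁ : (t * s') * (s' * t) ≤ (t * s') * (s * t') :=
        mul_le_mul_of_nonneg_left h (mul_nonneg ht hs')
      have h₂ : 0 ≤ s * s' * (t * t') := by positivity
      nlinarith [mul_le_mul_of_nonneg_left h₁ (sq_nonneg z.re), mul_nonneg h₂ (sq_nonneg z.im)]
    have hp : 0 ≤ s * s' := mul_nonneg hs hs'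
    have hq : 0 ≤ t * t' * (z.re ^ 2 + z.im ^ 2) := by positivity
    have hr := (abs_le_of_sq_le_sq' (a := 2 * (z.re * (t * s')))
      (by linarith [four_mul_le_sq_add (s * s') (t * t' * (z.re ^ 2 + z.im ^ 2))])
      (add_nonneg hp hq)).1
    linarith

/-- Arguments taken modulo rotation carry no transitive order; the common reference `a` fixes one,
and then only the slopes of `b` and `d` in the basis `a, z * a` have to be compared. -/
theorem trans_of_reference (hz : 0 < z.im) (ha : a ≠ 0) (hc : c ≠ 0) (hab : InSector z a b)
    (hac : InSector z a c) (had : InSector z a d) (hbc : InSector z b c) (hcd : InSector z c d) :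
    InSector z b d := by
  obtain ⟨s₁, t₁, hs₁, ht₁, rfl⟩ := hab.exists_eq hz ha
  obtain ⟨s₂, t₂, hs₂, ht₂, rfl⟩ := hac.exists_eq hz ha
  obtain ⟨s₃, t₃, hs₃, ht₃, rfl⟩ := had.exists_eq hz ha
  rw [mul_left_iff ha] at hbc hcd ⊢
  refine cone_of_mul_le_mul hz.le hs₁ ht₁ hs₃ ht₃ ?_
  have h₁₂ : s₂ * t₁ ≤ s₁ * t₂ := by
    have := hbc.1
    rwa [im_cone_mul_conj, mul_nonneg_iff_of_pos_left hz, sub_nonneg] at this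
  have h₂₃ : s₃ * t₂ ≤ s₂ * t₃ := by
    have := hcd.1
    rwa [im_cone_mul_conj, mul_nonneg_iff_of_pos_left hz, sub_nonneg] at this
  rcases hs₂.lt_or_eq with hs | rfl
  · refine le_of_mul_le_mul_left ?_ hs
    nlinarith [mul_le_mul_of_nonneg_left h₁₂ hs₃, mul_le_mul_of_nonneg_left h₂₃ hs₁]
  · have ht : 0 < t₂ := ht₂.lt_of_ne (by rintro rfl; simp at hc)
    refine le_of_mul_le_mul_left ?_ ht
    nlinarith [mul_le_mul_of_nonneg_left h₁₂ ht₃, mul_le_mul_of_nonneg_left h₂₃ ht₁]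

end InSector

end Sector

/-- The relation `f ≼ g` in the upper half plane: for every `z` there, `g z` lies in the cone
spanned by `f z` and `z * f z`. Unlike interlacing of roots, it is visibly additive in each
argument. -/
def Prec (f g : ℝ[X]) : Prop :=
  ∀ z : ℂ, 0 < z.im → InSector z (aeval z f) (aeval z g)

namespace Prec

variable {f g h : ℝ[X]}

theorem refl (f : ℝ[X]) : Prec f f := fun _ hz => InSector.self hz.le _

theorem zero_left (f : ℝ[X]) : Prec 0 f := fun z _ => by
  rw [map_zero]
  exact InSector.zero_left z _

theorem zero_right (f : ℝ[X]) : Prec f 0 := fun z _ => by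
  rw [map_zero]
  exact InSector.zero_right z _

theorem add_left (hf : Prec f h) (hg : Prec g h) : Prec (f + g) h := fun z hz => by
  rw [map_add]
  exact (hf z hz).add_left (hg z hz)

theorem add_right (hg : Prec f g) (hh : Prec f h) : Prec f (g + h) := fun z hz => by
  rw [map_add]
  exact (hg z hz).add_right (hh z hz)

theorem C_mul_left {c : ℝ} (hc : 0 ≤ c) (hfg : Prec f g) : Prec (C c * f) g := fun z hz => by
  rw [map_mul, aeval_C]
  exact (hfg z hz).ofReal_mul_left hc

theorem C_mul_right {c : ℝ} (hc : 0 ≤ c) (hfg : Prec f g) : Prec f (C c * g) := fun z hz => by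
  rw [map_mul, aeval_C]
  exact (hfg z hz).ofReal_mul_right hc

theorem sum_left {ι : Type*} {s : Finset ι} {F : ι → ℝ[X]} (hF : ∀ i ∈ s, Prec (F i) g) :
    Prec (∑ i ∈ s, F i) g :=
  Finset.sum_induction F (Prec · g) (fun _ _ => add_left) (zero_left g) hF

theorem sum_right {ι : Type*} {s : Finset ι} {F : ι → ℝ[X]} (hF : ∀ i ∈ s, Prec g (F i)) :
    Prec g (∑ i ∈ s, F i) :=
  Finset.sum_induction F (Prec g ·) (fun _ _ => add_right) (zero_right g) hF

theorem X_mul (hfg : Prec f g) : Prec g (X * f) := fun z hz => by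
  rw [map_mul, aeval_X]
  exact (hfg z hz).rotate

theorem mul_left (q : ℝ[X]) (hfg : Prec f g) : Prec (q * f) (q * g) := fun z hz => by
  rw [map_mul, map_mul]
  rcases eq_or_ne (aeval z q) 0 with hq | hq
  · rw [hq, zero_mul, zero_mul]
    exact InSector.zero_left z 0
  · exact (InSector.mul_left_iff hq).2 (hfg z hz)

theorem of_mul_left {q : ℝ[X]} (hq : ∀ z : ℂ, 0 < z.im → aeval z q ≠ 0)
    (h : Prec (q * f) (q * g)) : Prec f g := fun z hz => by
  have := h z hz
  rwa [map_mul, map_mul, InSector.mul_left_iff (hq z hz)] at this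

theorem one_X_sub_C {θ : ℝ} (hθ : θ ≤ 0) : Prec 1 (X - C θ) := by
  rw [sub_eq_add_neg, ← C_neg, ← mul_one X, ← mul_one (C (-θ))]
  exact (refl 1).X_mul.add_right ((refl 1).C_mul_right (neg_nonneg.2 hθ))

theorem linear_mul {θ : ℝ} (hθ : θ ≤ 0) (q : ℝ[X]) : Prec q ((X - C θ) * q) := by
  have := (one_X_sub_C hθ).mul_left q
  rwa [mul_one, mul_comm] at this

theorem X_sub_C_X_sub_C {η θ : ℝ} (hηθ : η ≤ θ) (hθ : θ ≤ 0) : Prec (X - C η) (X - C θ) :=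
  fun z hz => by
    have := InSector.cone_of_mul_le_mul hz.le (s := -η) (s' := -θ) (neg_nonneg.2 (hηθ.trans hθ))
      zero_le_one (neg_nonneg.2 hθ) zero_le_one (by simpa using hηθ)
    simpa [neg_add_eq_sub] using this

theorem of_linear_mul {θ : ℝ} (h : Prec ((X - C θ) * f) ((X - C θ) * g)) : Prec f g := by
  refine of_mul_left (fun z hz h0 => hz.ne' ?_) h
  rw [map_sub, aeval_X, aeval_C, Complex.coe_algebraMap, sub_eq_zero] at h0
  rw [h0, Complex.ofReal_im]

theorem of_X_mul (h : Prec (X * f) (X * g)) : Prec f g :=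
  of_linear_mul (θ := 0) (by rwa [C_0, sub_zero])

theorem of_prec_X_mul (h : Prec g (X * f)) : Prec f g := of_X_mul h.X_mul

theorem trans_of_reference {a b c d : ℝ[X]} (ha : ∀ z : ℂ, 0 < z.im → aeval z a ≠ 0)
    (hc : ∀ z : ℂ, 0 < z.im → aeval z c ≠ 0) (hab : Prec a b) (hac : Prec a c) (had : Prec a d)
    (hbc : Prec b c) (hcd : Prec c d) : Prec b d := fun z hz =>
  (hab z hz).trans_of_reference hz (ha z hz) (hc z hz) (hac z hz) (had z hz) (hbc z hz) (hcd z hz)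

end Prec

/-! ### Polynomials with nonpositive roots -/

theorem aeval_ofReal_complex (f : ℝ[X]) (x : ℝ) :
    aeval (x : ℂ) f = ((f.eval x : ℝ) : ℂ) := by
  simpa using aeval_algebraMap_apply ℂ x f

/-- Real polynomials with only real nonpositive roots, normalized to be positive on the positive
half line. -/
def NonposRooted (f : ℝ[X]) : Prop :=
  HasOnlyNonposRealRoots f ∧ ∀ x : ℝ, 0 < x → 0 < f.eval x

/-- Nonnegativity on the positive half line. This is what is left of `NonposRooted` in the sign
conditions of sums and quotients, where roots are not under control. -/
def NonnegOnPos (f : ℝ[X]) : Prop :=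
  ∀ x : ℝ, 0 < x → 0 ≤ f.eval x

section NonposRooted

variable {f q : ℝ[X]} {θ : ℝ}

theorem HasOnlyNonposRealRoots.splits (hf : HasOnlyNonposRealRoots f) : f.Splits := by
  induction hn : f.natDegree generalizing f with
  | zero => exact Splits.of_natDegree_eq_zero hn
  | succ n ih =>
    have hd : (f.map (algebraMap ℝ ℂ)).degree ≠ 0 := by
      rw [degree_map]
      exact degree_ne_of_natDegree_ne (n := 0) (by omega)
    obtain ⟨z, hz⟩ := IsAlgClosed.exists_root _ hd
    rw [IsRoot, eval_map_algebraMap] at hz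
    obtain ⟨x, -, rfl⟩ := hf z hz
    have hx : f.IsRoot x := by
      rw [aeval_ofReal_complex] at hz
      exact_mod_cast hz
    obtain ⟨q, rfl⟩ := dvd_iff_isRoot.2 hx
    have hq : q ≠ 0 := by
      rintro rfl
      simp at hn
    refine (Splits.X_sub_C x).mul (ih (fun z hz => hf z (by simp [hz])) ?_)
    rw [natDegree_mul (X_sub_C_ne_zero x) hq, natDegree_X_sub_C] at hn
    omega

namespace NonposRooted

theorem ne_zero (hf : NonposRooted f) : f ≠ 0 := by
  rintro rfl
  simpa using hf.2 1 one_pos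

theorem nonnegOnPos (hf : NonposRooted f) : NonnegOnPos f :=
  fun x hx => (hf.2 x hx).le

theorem aeval_ne_zero (hf : NonposRooted f) {z : ℂ} (hz : 0 < z.im) : aeval z f ≠ 0 := by
  intro h
  obtain ⟨x, -, rfl⟩ := hf.1 z h
  simp at hz

theorem root_nonpos (hf : NonposRooted f) {x : ℝ} (hx : f.eval x = 0) : x ≤ 0 :=
  not_lt.1 fun h => (hf.2 x h).ne' hx

theorem of_linear_mul (h : NonposRooted ((X - C θ) * q)) : NonposRooted q := by
  have hθ : θ ≤ 0 := h.root_nonpos (x := θ) (by simp)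
  refine ⟨fun z hz => h.1 z (by simp [hz]), fun x hx => ?_⟩
  have := h.2 x hx
  simp only [eval_mul, eval_sub, eval_X, eval_C] at this
  exact pos_of_mul_pos_right this (by linarith)

theorem one : NonposRooted 1 := ⟨fun z hz => by simp at hz, fun x _ => by simp⟩

theorem X_mul (h : NonposRooted f) : NonposRooted (X * f) := by
  refine ⟨fun z hz => ?_, fun x hx => by simpa using mul_pos hx (h.2 x hx)⟩
  rw [map_mul, aeval_X, mul_eq_zero] at hz
  rcases hz with rfl | hz
  · exact ⟨0, le_rfl, by simp⟩
  · exact h.1 z hz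

end NonposRooted

open Filter Topology in
theorem NonnegOnPos.eval_zero_nonneg (hf : NonnegOnPos f) : 0 ≤ f.eval 0 := by
  have h : Tendsto (fun x => f.eval x) (𝓝[>] 0) (𝓝 (f.eval 0)) :=
    (f.continuous.tendsto 0).mono_left nhdsWithin_le_nhds
  exact ge_of_tendsto h (eventually_nhdsWithin_of_forall fun x hx => hf x hx)

end NonposRooted

/-! ### Reversal -/

/-- The polynomial `g` is `x ^ n * f (1 / x)`. Unlike `Polynomial.reverse`, this depends on a
formal degree `n`, and it is therefore additive. -/
def IsReversal (n : ℕ) (f g : ℝ[X]) : Prop :=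
  ∀ z : ℂ, z ≠ 0 → aeval z g = z ^ n * aeval z⁻¹ f

namespace IsReversal

open ComplexConjugate

variable {n : ℕ} {f f' g g' : ℝ[X]}

theorem add (hf : IsReversal n f f') (hg : IsReversal n g g') :
    IsReversal n (f + g) (f' + g') := fun z hz => by
  rw [map_add, map_add, hf z hz, hg z hz, mul_add]

theorem C_mul (c : ℝ) (hf : IsReversal n f f') : IsReversal n (C c * f) (C c * f') :=
  fun z hz => by rw [map_mul, map_mul, hf z hz, aeval_C, aeval_C, mul_left_comm]

theorem sum {ι : Type*} {s : Finset ι} {F F' : ι → ℝ[X]}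
    (h : ∀ i ∈ s, IsReversal n (F i) (F' i)) :
    IsReversal n (∑ i ∈ s, F i) (∑ i ∈ s, F' i) := fun z hz => by
  simp only [map_sum, Finset.mul_sum]
  exact Finset.sum_congr rfl fun i hi => h i hi z hz

theorem X_pow_mul_right (k : ℕ) (h : IsReversal n f f') : IsReversal (n + k) f (X ^ k * f') :=
  fun z hz => by rw [map_mul, map_pow, aeval_X, h z hz, ← mul_assoc, ← pow_add, add_comm]

theorem X_mul_right (h : IsReversal n f f') : IsReversal (n + 1) f (X * f') := by
  simpa only [pow_one] using h.X_pow_mul_right 1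

theorem reverse (f : ℝ[X]) : IsReversal f.natDegree f f.reverse := fun z hz => by
  let _ : Invertible z⁻¹ := invertibleOfNonzero (inv_ne_zero hz)
  have := eval₂_reverse_mul_pow (algebraMap ℝ ℂ) z⁻¹ f
  rw [invOf_eq_inv, inv_inv] at this
  rw [aeval_def, aeval_def, ← this, mul_left_comm, ← mul_pow, mul_inv_cancel₀ hz, one_pow, mul_one]

theorem symm (h : IsReversal n f g) : IsReversal n g f := fun z hz => by
  rw [h z⁻¹ (inv_ne_zero hz), inv_inv, ← mul_assoc, ← mul_pow, mul_inv_cancel₀ hz, one_pow,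
    one_mul]

theorem eval_eq (h : IsReversal n f g) {x : ℝ} (hx : x ≠ 0) :
    g.eval x = x ^ n * f.eval x⁻¹ := by
  have := h x (by exact_mod_cast hx)
  rw [← Complex.ofReal_inv, aeval_ofReal_complex, aeval_ofReal_complex] at this
  exact_mod_cast this

theorem eval_one (h : IsReversal n f g) : g.eval 1 = f.eval 1 := by
  simpa using h.eval_eq one_ne_zero

theorem nonnegOnPos (h : IsReversal n f g) (hf : NonnegOnPos f) : NonnegOnPos g := fun x hx => by
  rw [h.eval_eq hx.ne']
  exact mul_nonneg (pow_nonneg hx.le _) (hf _ (inv_pos.2 hx))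

theorem eq_zero (h : IsReversal n 0 g) : g = 0 := by
  refine eq_zero_of_infinite_isRoot g ((Set.Ioi_infinite (0 : ℝ)).mono fun x hx => ?_)
  rw [Set.mem_ofPred_eq, IsRoot, h.eval_eq (ne_of_gt hx), eval_zero, mul_zero]

/-- The map `z ↦ 1 / conj z` preserves the upper half plane, and conjugation reverses the angular
order of values. -/
theorem prec (hf : IsReversal n f f') (hg : IsReversal n g g') (h : Prec f g) : Prec g' f' := by
  intro z hz
  have hz₀ : z ≠ 0 := by
    rintro rfl
    simp at hz
  have hw : 0 < (conj z)⁻¹.im := by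
    rw [Complex.inv_im, Complex.normSq_conj, Complex.conj_im, neg_neg]
    exact div_pos hz (Complex.normSq_pos.2 hz₀)
  have hzw : (Complex.normSq z : ℂ) * (conj z)⁻¹ = z := by
    rw [← Complex.mul_conj, mul_inv_cancel_right₀ ((_root_.map_ne_zero _).2 hz₀)]
  have aeval_inv (p : ℝ[X]) : aeval z⁻¹ p = conj (aeval (conj z)⁻¹ p) := by
    rw [← aeval_conj, map_inv₀, Complex.conj_conj]
  rw [hf z hz₀, hg z hz₀, InSector.mul_left_iff (pow_ne_zero n hz₀), aeval_inv, aeval_inv]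
  simpa only [hzw] using (h _ hw).conj_symm (Complex.normSq_nonneg z)

end IsReversal

theorem NonnegOnPos.leadingCoeff_nonneg {f : ℝ[X]} (hf : NonnegOnPos f) :
    0 ≤ f.leadingCoeff := by
  have := ((IsReversal.reverse f).nonnegOnPos hf).eval_zero_nonneg
  rwa [← coeff_zero_eq_eval_zero, coeff_zero_reverse] at this

/-! ### Signs of imaginary parts near a real point -/

section Local

open ComplexConjugate

variable {θ c : ℝ} {m : ℕ} {A : ℂ → ℂ}

open Filter Topology in
theorem im_pow_mul_nonneg_of_im_nonneg (hA : ContinuousAt A θ) (hc : A θ = c)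
    (h : ∀ z : ℂ, 0 < z.im → 0 ≤ ((z - θ) ^ m * A z).im) {e : ℂ} (he : 0 < e.im) :
    0 ≤ (e ^ m).im * c := by
  have hlim : Tendsto (fun ε : ℝ => (e ^ m * A (θ + ε * e)).im) (𝓝[>] 0)
      (𝓝 ((e ^ m).im * c)) := by
    have hpath : Tendsto (fun ε : ℝ => (θ : ℂ) + ε * e) (𝓝[>] 0) (𝓝 θ) := by
      have : Continuous fun ε : ℝ => (θ : ℂ) + ε * e := by fun_prop
      simpa using (this.tendsto 0).mono_left nhdsWithin_le_nhds
    rw [← Complex.im_mul_ofReal, ← hc]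
    exact (Complex.continuous_im.tendsto _).comp ((hA.tendsto.comp hpath).const_mul _)
  refine ge_of_tendsto hlim (eventually_nhdsWithin_of_forall fun ε (hε : 0 < ε) => ?_)
  have := h (θ + ε * e) (by simpa using mul_pos hε he)
  rw [add_sub_cancel_left, mul_pow, mul_assoc, ← Complex.ofReal_pow, Complex.im_ofReal_mul] at this
  exact nonneg_of_mul_nonneg_right this (pow_pos hε m)

theorem exists_pow_eq_exp (hm : m ≠ 0) {t : ℝ} (ht₀ : 0 < t) (ht : t < m * Real.pi) :
    ∃ e : ℂ, 0 < e.im ∧ e ^ m = Complex.exp (t * Complex.I) := by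
  have hm' : (0 : ℝ) < m := by exact_mod_cast hm.bot_lt
  refine ⟨Complex.exp ((t / m : ℝ) * Complex.I), ?_, ?_⟩
  · rw [Complex.exp_ofReal_mul_I_im]
    exact Real.sin_pos_of_pos_of_lt_pi (div_pos ht₀ hm') ((div_lt_iff₀' hm').2 ht)
  · rw [← Complex.exp_nat_mul, ← mul_assoc, Complex.ofReal_div, Complex.ofReal_natCast,
      mul_div_cancel₀ _ (by exact_mod_cast hm)]

theorem nonneg_of_im_pow_mul_nonneg (hm : 1 ≤ m) (hA : ContinuousAt A θ) (hc : A θ = c)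
    (h : ∀ z : ℂ, 0 < z.im → 0 ≤ ((z - θ) ^ m * A z).im) : 0 ≤ c := by
  have hm' : (1 : ℝ) ≤ m := by exact_mod_cast hm
  obtain ⟨e, he, hem⟩ := exists_pow_eq_exp (by omega) Real.pi_div_two_pos
    (show Real.pi / 2 < m * Real.pi by nlinarith [Real.pi_pos])
  have := im_pow_mul_nonneg_of_im_nonneg hA hc h he
  rwa [hem, Complex.exp_ofReal_mul_I_im, Real.sin_pi_div_two, one_mul] at this

theorem nonpos_of_im_pow_mul_nonneg (hm : 2 ≤ m) (hA : ContinuousAt A θ) (hc : A θ = c)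
    (h : ∀ z : ℂ, 0 < z.im → 0 ≤ ((z - θ) ^ m * A z).im) : c ≤ 0 := by
  have hm' : (2 : ℝ) ≤ m := by exact_mod_cast hm
  obtain ⟨e, he, hem⟩ := exists_pow_eq_exp (t := Real.pi / 2 + Real.pi) (m := m) (by omega)
    (by positivity) (by nlinarith [Real.pi_pos])
  have := im_pow_mul_nonneg_of_im_nonneg hA hc h he
  rw [hem, Complex.exp_ofReal_mul_I_im, Real.sin_add_pi, Real.sin_pi_div_two] at this
  linarith

theorem continuous_aeval_mul_conj (p q : ℝ[X]) :
    Continuous fun z : ℂ => aeval z p * conj (aeval z q) :=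
  p.continuous_aeval.mul (Complex.continuous_conj.comp q.continuous_aeval)

theorem aeval_mul_conj_ofReal (p q : ℝ[X]) (x : ℝ) :
    aeval (x : ℂ) p * conj (aeval (x : ℂ) q) = ((p.eval x * q.eval x : ℝ) : ℂ) := by
  rw [aeval_ofReal_complex, aeval_ofReal_complex, Complex.conj_ofReal, Complex.ofReal_mul]

theorem Prec.natDegree_le {f g : ℝ[X]} (h : Prec f g) (hf : NonnegOnPos f) (hg : NonnegOnPos g)
    (hg₀ : g ≠ 0) : f.natDegree ≤ g.natDegree := by
  by_contra! hlt
  have hf₀ : f ≠ 0 := by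
    rintro rfl
    simp at hlt
  obtain ⟨k, hk⟩ := Nat.exists_eq_add_of_lt hlt
  have hrev := (IsReversal.reverse g).X_pow_mul_right (k + 1)
  rw [← add_assoc, ← hk] at hrev
  have hprec := (IsReversal.reverse f).prec hrev h
  have hle : g.leadingCoeff * f.leadingCoeff ≤ 0 := by
    rw [← coeff_zero_reverse, ← coeff_zero_reverse, coeff_zero_eq_eval_zero,
      coeff_zero_eq_eval_zero]
    refine nonpos_of_im_pow_mul_nonneg (m := k + 2) (by omega)
      (continuous_aeval_mul_conj g.reverse f.reverse).continuousAt
      (aeval_mul_conj_ofReal _ _ 0) fun z hz => ?_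
    have := (hprec z hz).2
    rw [map_mul, map_pow, aeval_X, ← mul_assoc, ← pow_succ', mul_assoc] at this
    simpa using this
  exact hle.not_gt (mul_pos (hg.leadingCoeff_nonneg.lt_of_ne (leadingCoeff_ne_zero.2 hg₀).symm)
    (hf.leadingCoeff_nonneg.lt_of_ne (leadingCoeff_ne_zero.2 hf₀).symm))

end Local

/-! ### Partial fractions -/

theorem eq_C_mul_add_sum_divByMonic {K : Type*} [Field K] [DecidableEq K] {f g : K[X]}
    (hg₀ : g ≠ 0) (hg : g.Splits) (hroots : g.roots.Nodup) (hdeg : f.natDegree ≤ g.natDegree) :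
    f = C (f.coeff g.natDegree / g.leadingCoeff) * g + ∑ θ ∈ g.roots.toFinset,
      C (f.eval θ / (g /ₘ (X - C θ)).eval θ) * (g /ₘ (X - C θ)) := by
  have hcard : g.roots.toFinset.card = g.natDegree := by
    rw [Multiset.toFinset_card_of_nodup hroots, ← hg.natDegree_eq_card_roots]
  have hfactor {θ : K} (hθ : θ ∈ g.roots.toFinset) : (X - C θ) * (g /ₘ (X - C θ)) = g :=
    mul_divByMonic_eq_iff_isRoot.2 (isRoot_of_mem_roots (Multiset.mem_toFinset.1 hθ))
  have hsimple {θ : K} (hθ : θ ∈ g.roots.toFinset) : (g /ₘ (X - C θ)).eval θ ≠ 0 := by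
    intro h0
    have hmem : θ ∈ (g /ₘ (X - C θ)).roots :=
      (mem_roots fun hq => hg₀ (by rw [← hfactor hθ, hq, mul_zero])).2 h0
    rw [← hfactor hθ] at hroots
    rw [roots_mul (by rwa [hfactor hθ]), roots_X_sub_C, Multiset.singleton_add,
      Multiset.nodup_cons] at hroots
    exact hroots.1 hmem
  rw [← sub_eq_iff_eq_add']
  refine eq_of_degrees_lt_of_eval_finset_eq g.roots.toFinset ?_ ?_ fun θ hθ => ?_
  · rw [hcard, degree_lt_iff_coeff_zero]
    intro k hk
    rcases hk.lt_or_eq with hlt | rfl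
    · rw [coeff_sub, coeff_C_mul, coeff_eq_zero_of_natDegree_lt (hdeg.trans_lt hlt),
        coeff_eq_zero_of_natDegree_lt hlt, mul_zero, sub_zero]
    · rw [coeff_sub, coeff_C_mul, coeff_natDegree, div_mul_cancel₀ _ (leadingCoeff_ne_zero.2 hg₀),
        sub_self]
  · refine (degree_sum_le _ _).trans_lt
      ((Finset.sup_lt_iff (WithBot.bot_lt_coe _)).2 fun θ _ => ?_)
    rw [← smul_eq_C_mul, hcard, ← degree_eq_natDegree hg₀]
    refine (degree_smul_le _ _).trans_lt (degree_divByMonic_lt g _ hg₀ ?_)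
    rw [degree_X_sub_C]
    exact zero_lt_one
  · have hgθ : g.eval θ = 0 := isRoot_of_mem_roots (Multiset.mem_toFinset.1 hθ)
    rw [eval_finsetSum, Finset.sum_eq_single_of_mem θ hθ]
    · simp only [eval_sub, eval_mul, eval_C, hgθ, mul_zero, sub_zero,
        div_mul_cancel₀ _ (hsimple hθ)]
    · intro η hη hne
      have heval : (θ - η) * (g /ₘ (X - C η)).eval θ = 0 := by
        rw [← hgθ, ← congrArg (eval θ) (hfactor hη), eval_mul, eval_sub, eval_X, eval_C]
      rw [eval_mul, (mul_eq_zero.1 heval).resolve_left (sub_ne_zero.2 hne.symm), mul_zero]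

/-- The cone generated by `g` and the quotients `g / (x - θ)`. Its members are the numerators of
the partial fractions over `g` with nonnegative coefficients. -/
inductive PoleCone (g : ℝ[X]) : ℝ[X] → Prop
  | base (a : ℝ) (ha : 0 ≤ a) : PoleCone g (C a * g)
  | pole (c θ : ℝ) (q : ℝ[X]) (hc : 0 ≤ c) (hq : g = (X - C θ) * q) : PoleCone g (C c * q)
  | add {f₁ f₂ : ℝ[X]} (h₁ : PoleCone g f₁) (h₂ : PoleCone g f₂) : PoleCone g (f₁ + f₂)

namespace PoleCone

open ComplexConjugate

variable {f g : ℝ[X]}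

theorem zero (g : ℝ[X]) : PoleCone g 0 := by
  simpa only [C_0, zero_mul] using base (g := g) 0 le_rfl

theorem sum {ι : Type*} {s : Finset ι} {F : ι → ℝ[X]} (h : ∀ i ∈ s, PoleCone g (F i)) :
    PoleCone g (∑ i ∈ s, F i) :=
  Finset.sum_induction F (PoleCone g) (fun _ _ => add) (zero g) h

theorem linear_mul (θ : ℝ) (h : PoleCone g f) : PoleCone ((X - C θ) * g) ((X - C θ) * f) := by
  induction h with
  | base a ha =>
    rw [mul_left_comm]
    exact base a ha
  | pole c η q hc hq =>
    rw [mul_left_comm]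
    exact pole c η _ hc (by rw [hq, mul_left_comm])
  | add _ _ h₁ h₂ =>
    rw [mul_add]
    exact add h₁ h₂

theorem eq_zero_or_eval_pos {θ : ℝ} (hg : ∀ x, θ < x → 0 < g.eval x) (h : PoleCone g f) :
    f = 0 ∨ ∀ x, θ < x → 0 < f.eval x := by
  induction h with
  | base a ha =>
    rcases ha.eq_or_lt with rfl | ha
    · simp
    · exact Or.inr fun x hx => by simpa using mul_pos ha (hg x hx)
  | pole c η q hc hq =>
    rcases hc.eq_or_lt with rfl | hc
    · simp
    · have hη : η ≤ θ := not_lt.1 fun hlt => (hg η hlt).ne' (by simp [hq])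
      refine Or.inr fun x hx => ?_
      have := hg x hx
      rw [hq, eval_mul, eval_sub, eval_X, eval_C] at this
      rw [eval_mul, eval_C]
      exact mul_pos hc (pos_of_mul_pos_right this (sub_nonneg.2 (hη.trans hx.le)))
  | add _ _ h₁ h₂ =>
    rcases h₁ with rfl | h₁ <;> rcases h₂ with rfl | h₂
    · simp
    · exact Or.inr (by simpa using h₂)
    · exact Or.inr (by simpa using h₁)
    · exact Or.inr fun x hx => by simpa using add_pos (h₁ x hx) (h₂ x hx)

theorem im_C_mul_mul_conj (a : ℝ) (g : ℝ[X]) (z : ℂ) :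
    (aeval z (C a * g) * conj (aeval z g)).im = 0 := by
  rw [map_mul, aeval_C, mul_assoc, Complex.mul_conj, Complex.coe_algebraMap,
    ← Complex.ofReal_mul, Complex.ofReal_im]

theorem im_mul_conj_linear_mul (θ : ℝ) (q : ℝ[X]) (z : ℂ) :
    (aeval z q * conj (aeval z ((X - C θ) * q))).im = -(Complex.normSq (aeval z q) * z.im) := by
  rw [map_mul, map_mul, mul_left_comm, mul_comm, Complex.mul_conj, Complex.im_ofReal_mul]
  simp

theorem eq_C_mul_or_im_neg (hg : NonposRooted g) (h : PoleCone g f) :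
    (∃ a, f = C a * g) ∨ ∀ z : ℂ, 0 < z.im → (aeval z f * conj (aeval z g)).im < 0 := by
  induction h with
  | base a _ => exact Or.inl ⟨a, rfl⟩
  | pole c θ q hc hq =>
    rcases hc.eq_or_lt with rfl | hc
    · exact Or.inl ⟨0, by simp⟩
    · refine Or.inr fun z hz => ?_
      have hq₀ : aeval z q ≠ 0 := by
        intro h0
        exact hg.aeval_ne_zero hz (by rw [hq, map_mul, h0, mul_zero])
      rw [map_mul, aeval_C, Complex.coe_algebraMap, mul_assoc, Complex.im_ofReal_mul, hq,
        im_mul_conj_linear_mul, mul_neg, neg_lt_zero]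
      exact mul_pos hc (mul_pos (Complex.normSq_pos.2 hq₀) hz)
  | add _ _ h₁ h₂ =>
    simp only [map_add, add_mul, Complex.add_im]
    rcases h₁ with ⟨a, rfl⟩ | h₁ <;> rcases h₂ with ⟨b, rfl⟩ | h₂
    · exact Or.inl ⟨a + b, by rw [C_add, add_mul]⟩
    · exact Or.inr fun z hz => by simpa only [im_C_mul_mul_conj, zero_add] using h₂ z hz
    · exact Or.inr fun z hz => by simpa only [im_C_mul_mul_conj, add_zero] using h₁ z hz
    · exact Or.inr fun z hz => add_neg (h₁ z hz) (h₂ z hz)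

theorem nonposRooted (hg : NonposRooted g) (h : PoleCone g f) (hf : f ≠ 0) : NonposRooted f := by
  have hpos := (h.eq_zero_or_eval_pos hg.2).resolve_left hf
  refine ⟨fun z hz => ?_, hpos⟩
  rcases h.eq_C_mul_or_im_neg hg with ⟨a, rfl⟩ | hneg
  · have ha : a ≠ 0 := by simpa using left_ne_zero_of_mul hf
    exact hg.1 z (by simpa [ha] using hz)
  · rcases lt_trichotomy z.im 0 with him | him | him
    · have := hneg (conj z) (by simpa using him)
      simp [aeval_conj, hz] at this
    · lift z to ℝ using him
      rw [aeval_ofReal_complex, Complex.ofReal_eq_zero] at hz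
      exact ⟨z, not_lt.1 fun hlt => (hpos z hlt).ne' hz, rfl⟩
    · have := hneg z him
      simp [hz] at this

end PoleCone

namespace Prec

variable {f g q : ℝ[X]} {θ : ℝ} {m : ℕ}

theorem eval_mul_eval_nonneg (hm : 1 ≤ m) (h : Prec f ((X - C θ) ^ m * q)) :
    0 ≤ q.eval θ * f.eval θ :=
  nonneg_of_im_pow_mul_nonneg hm (continuous_aeval_mul_conj q f).continuousAt
    (aeval_mul_conj_ofReal q f θ) fun z hz => by simpa [mul_assoc] using (h z hz).1

theorem eval_mul_eval_nonpos (hm : 2 ≤ m) (h : Prec f ((X - C θ) ^ m * q)) :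
    q.eval θ * f.eval θ ≤ 0 :=
  nonpos_of_im_pow_mul_nonneg hm (continuous_aeval_mul_conj q f).continuousAt
    (aeval_mul_conj_ofReal q f θ) fun z hz => by simpa [mul_assoc] using (h z hz).1

theorem rootMultiplicity_le_one (h : Prec f g) (hg₀ : g ≠ 0) (hf : f.eval θ ≠ 0) :
    g.rootMultiplicity θ ≤ 1 := by
  by_contra! hm
  obtain ⟨q, hq, hndvd⟩ := exists_eq_pow_rootMultiplicity_mul_and_not_dvd g hg₀ θ
  have hqθ : q.eval θ ≠ 0 := fun h0 => hndvd (dvd_iff_isRoot.2 h0)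
  rw [hq] at h
  exact mul_ne_zero hqθ hf
    (le_antisymm (h.eval_mul_eval_nonpos hm) (h.eval_mul_eval_nonneg (by omega)))

theorem poleCone_of_no_common_root (h : Prec f g) (hg : NonposRooted g) (hf : NonnegOnPos f)
    (hcop : ∀ θ, g.eval θ = 0 → f.eval θ ≠ 0) : PoleCone g f := by
  classical
  have hroots : g.roots.Nodup := Multiset.nodup_iff_count_le_one.2 fun θ => by
    rw [count_roots]
    by_cases hθ : g.eval θ = 0
    · exact h.rootMultiplicity_le_one hg.ne_zero (hcop θ hθ)
    · rw [rootMultiplicity_eq_zero hθ]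
      exact zero_le_one
  have hdeg := h.natDegree_le hf hg.nonnegOnPos hg.ne_zero
  rw [eq_C_mul_add_sum_divByMonic hg.ne_zero hg.1.splits hroots hdeg]
  refine .add (.base _ (div_nonneg ?_ hg.nonnegOnPos.leadingCoeff_nonneg))
    (.sum fun θ hθ => ?_)
  · rcases hdeg.lt_or_eq with hlt | heq
    · rw [coeff_eq_zero_of_natDegree_lt hlt]
    · rw [← heq]
      exact hf.leadingCoeff_nonneg
  · have hq : (X - C θ) * (g /ₘ (X - C θ)) = g :=
      mul_divByMonic_eq_iff_isRoot.2 (isRoot_of_mem_roots (Multiset.mem_toFinset.1 hθ))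
    refine .pole _ θ _ ?_ hq.symm
    have := eval_mul_eval_nonneg (m := 1) (θ := θ) le_rfl (by rwa [pow_one, hq])
    rcases mul_nonneg_iff.1 this with ⟨hq, hf⟩ | ⟨hq, hf⟩
    · exact div_nonneg hf hq
    · exact div_nonneg_of_nonpos hf hq

theorem poleCone (h : Prec f g) (hg : NonposRooted g) (hf : NonnegOnPos f) : PoleCone g f := by
  induction hn : g.natDegree generalizing f g with
  | zero =>
    refine h.poleCone_of_no_common_root hg hf fun θ hθ => absurd ?_ hg.ne_zero
    rw [eq_C_of_natDegree_eq_zero hn, eval_C] at hθ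
    rw [eq_C_of_natDegree_eq_zero hn, hθ, C_0]
  | succ n ih =>
    by_cases hcop : ∀ θ, g.eval θ = 0 → f.eval θ ≠ 0
    · exact h.poleCone_of_no_common_root hg hf hcop
    · push Not at hcop
      obtain ⟨θ, hgθ, hfθ⟩ := hcop
      have hθ := hg.root_nonpos hgθ
      obtain ⟨g, rfl⟩ := dvd_iff_isRoot.2 hgθ
      obtain ⟨f, rfl⟩ := dvd_iff_isRoot.2 hfθ
      have hg' := hg.of_linear_mul
      refine (ih h.of_linear_mul hg' (fun x hx => ?_) ?_).linear_mul θ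
      · have := hf x hx
        simp only [eval_mul, eval_sub, eval_X, eval_C] at this
        exact nonneg_of_mul_nonneg_right this (by linarith)
      · rw [natDegree_mul (X_sub_C_ne_zero θ) hg'.ne_zero, natDegree_X_sub_C] at hn
        omega

theorem nonposRooted_left (h : Prec f g) (hg : NonposRooted g) (hf : NonnegOnPos f)
    (hf₀ : f ≠ 0) : NonposRooted f :=
  (h.poleCone hg hf).nonposRooted hg hf₀

theorem nonposRooted_right (h : Prec f g) (hf : NonposRooted f) (hg : NonnegOnPos g)
    (hg₀ : g ≠ 0) : NonposRooted g :=
  h.X_mul.nonposRooted_left hf.X_mul hg hg₀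

end Prec

/-! ### Interlacing roots -/

theorem NonposRooted.eval_pos_of_roots_lt {g : ℝ[X]} (hg : NonposRooted g) {x : ℝ}
    (hx : ∀ θ ∈ g.roots, θ < x) : 0 < g.eval x := by
  rw [hg.1.splits.eval_eq_prod_roots]
  refine mul_pos (hg.nonnegOnPos.leadingCoeff_nonneg.lt_of_ne
    (leadingCoeff_ne_zero.2 hg.ne_zero).symm) (Multiset.prod_pos fun y hy => ?_)
  obtain ⟨θ, hθ, rfl⟩ := Multiset.mem_map.1 hy
  exact sub_pos.2 (hx θ hθ)

theorem PoleCone.prec_of_linear_mul {f q : ℝ[X]} {θ : ℝ} (hθ : θ ≤ 0)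
    (hmax : ∀ η, ((X - C θ) * q).eval η = 0 → η ≤ θ) (h : PoleCone ((X - C θ) * q) f) :
    Prec q f := by
  induction h with
  | base a ha => exact (Prec.linear_mul hθ q).C_mul_right ha
  | pole c η p hc hp =>
    have hη : η ≤ θ := hmax η (by simp [hp])
    refine Prec.C_mul_right hc (Prec.of_linear_mul (θ := θ) ?_)
    rw [hp, mul_comm _ p, mul_comm _ p]
    exact (Prec.X_sub_C_X_sub_C hη hθ).mul_left p
  | add _ _ h₁ h₂ => exact h₁.add_right h₂

theorem Interlaces.linear_mul {f q : ℝ[X]} {θ : ℝ} (h : Interlaces q f)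
    (hf : ∀ η, f.eval η = 0 → η ≤ θ) : Interlaces f ((X - C θ) * q) := by
  obtain ⟨hq₀, hf₀, n, m, α, β, hmn, hq, hf', hαβ, hβα⟩ := h
  refine ⟨hf₀, mul_ne_zero (X_sub_C_ne_zero θ) hq₀, m, n + 1, β, fun i => i.casesOn θ α,
    by omega, hf', ?_, fun i hi => ?_, fun i hi => hαβ i (by omega)⟩
  · rw [leadingCoeff_mul, leadingCoeff_X_sub_C, one_mul, Finset.prod_range_succ', mul_comm]
    conv_lhs => rw [hq]
    exact mul_assoc _ _ _
  · cases i with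
    | zero =>
      refine hf (β 0) ?_
      rw [hf', eval_mul, eval_prod, Finset.prod_eq_zero (Finset.mem_range.2 hi) (by simp),
        mul_zero]
    | succ i => exact hβα i hi

theorem interlaces_of_natDegree_eq_zero {f g : ℝ[X]} (hf₀ : f ≠ 0) (hg₀ : g ≠ 0)
    (hf : f.natDegree = 0) (hg : g.natDegree = 0) : Interlaces f g := by
  refine ⟨hf₀, hg₀, 0, 0, 0, 0, Or.inl rfl, ?_, ?_, by simp, by simp⟩
  · rw [Finset.prod_range_zero, mul_one, leadingCoeff, hf, ← eq_C_of_natDegree_eq_zero hf]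
  · rw [Finset.prod_range_zero, mul_one, leadingCoeff, hg, ← eq_C_of_natDegree_eq_zero hg]

/-- Removing the largest root of `g` turns `f ≼ g` into `g / (x - θ) ≼ f`. -/
theorem Prec.interlaces {f g : ℝ[X]} (h : Prec f g) (hf : NonposRooted f) (hg : NonposRooted g) :
    Interlaces f g := by
  classical
  induction hn : f.natDegree + g.natDegree using Nat.strong_induction_on generalizing f g with
  | _ n ih =>
    rcases Nat.eq_zero_or_pos g.natDegree with hg₀ | hg₀
    · have hf₀ := h.natDegree_le hf.nonnegOnPos hg.nonnegOnPos hg.ne_zero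
      exact interlaces_of_natDegree_eq_zero hf.ne_zero hg.ne_zero (by omega) hg₀
    obtain ⟨θ, hθ, hmax⟩ := g.roots.toFinset.exists_max_image id <| by
      rw [Multiset.toFinset_nonempty, ← Multiset.card_pos, ← hg.1.splits.natDegree_eq_card_roots]
      exact hg₀
    simp only [Multiset.mem_toFinset, id] at hθ hmax
    have hgθ : g.eval θ = 0 := isRoot_of_mem_roots hθ
    have hroot {η : ℝ} (hη : g.eval η = 0) : η ≤ θ := hmax η ((mem_roots hg.ne_zero).2 hη)
    have hcone := h.poleCone hg hf.nonnegOnPos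
    have hfpos := (hcone.eq_zero_or_eval_pos fun x hx =>
      hg.eval_pos_of_roots_lt fun η hη => (hmax η hη).trans_lt hx).resolve_left hf.ne_zero
    obtain ⟨q, rfl⟩ := dvd_iff_isRoot.2 hgθ
    have hq := hg.of_linear_mul
    have hqf : Prec q f := hcone.prec_of_linear_mul (hg.root_nonpos hgθ) fun _ => hroot
    rw [natDegree_mul (X_sub_C_ne_zero θ) hq.ne_zero, natDegree_X_sub_C] at hn
    exact (ih _ (by omega) hqf hq hf rfl).linear_mul fun η hη =>
      not_lt.1 fun hlt => (hfpos η hlt).ne' hη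

/-! ### Division by `x - 1` -/

theorem NonnegOnPos.add {f g : ℝ[X]} (hf : NonnegOnPos f) (hg : NonnegOnPos g) :
    NonnegOnPos (f + g) := fun x hx => by simpa using add_nonneg (hf x hx) (hg x hx)

theorem NonnegOnPos.X_mul {f : ℝ[X]} (hf : NonnegOnPos f) : NonnegOnPos (X * f) :=
  fun x hx => by simpa using mul_nonneg hx.le (hf x hx)

namespace PoleCone

variable {f G : ℝ[X]}

theorem X_mul_induction {motive : ℝ[X] → Prop} (hG : NonposRooted G) (X_mul : motive (X * G))
    (self : motive G)
    (quotient : ∀ (θ : ℝ) (p : ℝ[X]), θ < 0 → G = (X - C θ) * p → motive (X * p))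
    (C_mul : ∀ (c : ℝ) (f : ℝ[X]), 0 ≤ c → motive f → motive (C c * f))
    (add : ∀ f g : ℝ[X], motive f → motive g → motive (f + g))
    (h : PoleCone (X * G) f) : motive f := by
  induction h with
  | base a ha => exact C_mul a _ ha X_mul
  | pole c θ q hc hq =>
    refine C_mul c q hc ?_
    have hθ : θ ≤ 0 := hG.X_mul.root_nonpos (by simp [hq])
    rcases hθ.eq_or_lt with rfl | hθ
    · rw [C_0, sub_zero] at hq
      rwa [← mul_left_cancel₀ X_ne_zero hq]
    · have hq₀ : q.eval 0 = 0 := by simpa [hθ.ne] using (congrArg (eval 0) hq).symm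
      obtain ⟨p, rfl⟩ : X ∣ q := X_dvd_iff.2 (by rwa [coeff_zero_eq_eval_zero])
      exact quotient θ p hθ (mul_left_cancel₀ X_ne_zero (by rw [hq, mul_left_comm]))
  | add _ _ h₁ h₂ => exact add _ _ h₁ h₂

/-- The quotient `f / G` is a nonnegative combination of `1`, `x` and `x / (x - θ)` with
`θ < 0`, each of which is increasing. -/
theorem eval_mul_eval_le (hG : NonposRooted G) (h : PoleCone (X * G) f) {x y : ℝ} (hx : 0 < x)
    (hxy : x ≤ y) : f.eval x * G.eval y ≤ f.eval y * G.eval x := by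
  have hy : 0 < y := hx.trans_le hxy
  refine h.X_mul_induction (motive := fun f => f.eval x * G.eval y ≤ f.eval y * G.eval x) hG ?_
    (mul_comm _ _).le (fun θ p hθ hp => ?_) (fun c f hc hf => ?_) fun f g hf hg => ?_
  · simp only [eval_mul, eval_X]
    nlinarith [mul_pos (hG.2 x hx) (hG.2 y hy)]
  · have hpos {t : ℝ} (ht : 0 < t) : 0 < p.eval t := by
      have := hG.2 t ht
      rw [hp, eval_mul, eval_sub, eval_X, eval_C] at this
      exact pos_of_mul_pos_right this (by linarith)
    simp only [hp, eval_mul, eval_X, eval_sub, eval_C]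
    nlinarith [mul_nonneg (mul_pos (hpos hx) (hpos hy)).le
      (mul_nonneg (sub_nonneg.2 hxy) (neg_nonneg.2 hθ.le))]
  · simp only [eval_mul, eval_C, mul_assoc]
    exact mul_le_mul_of_nonneg_left hf hc
  · simp only [eval_add, add_mul]
    exact add_le_add hf hg

end PoleCone

open Filter Topology in
/-- Polynomials dominating `G` that are negligible against `G` at `0`. -/
def SmallOver (G R : ℝ[X]) : Prop :=
  Prec G R ∧ Tendsto (fun x => R.eval x / G.eval x) (𝓝[>] 0) (𝓝 0)

namespace SmallOver

open Filter Topology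

variable {G p R₁ R₂ : ℝ[X]} {θ : ℝ}

theorem zero (G : ℝ[X]) : SmallOver G 0 := ⟨Prec.zero_right G, by simp⟩

theorem add (h₁ : SmallOver G R₁) (h₂ : SmallOver G R₂) : SmallOver G (R₁ + R₂) :=
  ⟨h₁.1.add_right h₂.1, by simpa [add_div] using h₁.2.add h₂.2⟩

theorem C_mul {c : ℝ} (hc : 0 ≤ c) (h : SmallOver G R₁) : SmallOver G (C c * R₁) :=
  ⟨h.1.C_mul_right hc, by simpa [mul_div_assoc] using h.2.const_mul c⟩

theorem X_mul (hG : NonposRooted G) : SmallOver G (X * G) := by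
  refine ⟨(Prec.refl G).X_mul, ?_⟩
  refine (tendsto_nhdsWithin_of_tendsto_nhds tendsto_id).congr'
    (eventually_nhdsWithin_of_forall fun x hx => ?_)
  simp [mul_div_cancel_right₀ _ (hG.2 x hx).ne']

theorem X_mul_quotient (hG : NonposRooted G) (hθ : θ < 0) (hp : G = (X - C θ) * p) :
    SmallOver G (X * p) := by
  refine ⟨by rw [hp]; exact (Prec.linear_mul hθ.le p).X_mul, ?_⟩
  have hlim : Tendsto (fun x : ℝ => x / (x - θ)) (𝓝[>] 0) (𝓝 (0 / (0 - θ))) :=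
    tendsto_nhdsWithin_of_tendsto_nhds
      (tendsto_id.div (tendsto_id.sub_const θ) (by simpa using hθ.ne))
  rw [zero_div] at hlim
  refine hlim.congr' (eventually_nhdsWithin_of_forall fun x hx => ?_)
  have hGx := hG.2 x hx
  rw [hp, eval_mul] at hGx
  simp [hp, mul_div_mul_right _ _ (right_ne_zero_of_mul hGx.ne')]

end SmallOver

/-- Division of `N` by `x - 1` leaves a multiple of `G`, and the quotient is, up to a multiple of
`G`, small over `G`. -/
def QuotientOver (G N : ℝ[X]) : Prop :=
  ∃ (R : ℝ[X]) (b κ : ℝ), SmallOver G R ∧ N = (X - 1) * (R + C b * G) + C κ * G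

namespace QuotientOver

variable {F G N N₁ N₂ h p : ℝ[X]} {θ : ℝ}

theorem add (h₁ : QuotientOver G N₁) (h₂ : QuotientOver G N₂) : QuotientOver G (N₁ + N₂) := by
  obtain ⟨R₁, b₁, κ₁, h₁, rfl⟩ := h₁
  obtain ⟨R₂, b₂, κ₂, h₂, rfl⟩ := h₂
  exact ⟨R₁ + R₂, b₁ + b₂, κ₁ + κ₂, h₁.add h₂, by simp only [C_add]; ring⟩

theorem C_mul {c : ℝ} (hc : 0 ≤ c) (h : QuotientOver G N) : QuotientOver G (C c * N) := by
  obtain ⟨R, b, κ, h, rfl⟩ := h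
  exact ⟨C c * R, c * b, c * κ, h.C_mul hc, by simp only [Polynomial.C_mul]; ring⟩

theorem linear_mul (G : ℝ[X]) (a c : ℝ) : QuotientOver G ((C a * X + C c) * G) :=
  ⟨0, a, a + c, .zero G, by rw [C_add]; ring⟩

theorem X_mul_X_mul (hG : NonposRooted G) : QuotientOver G (X * (X * G)) :=
  ⟨X * G, 1, 1, .X_mul hG, by rw [C_1]; ring⟩

theorem neg_X_mul_quotient (hG : NonposRooted G) (hθ : θ < 0) (hp : G = (X - C θ) * p) :
    QuotientOver G (-(X * p)) := by
  have hinv : C (1 - θ)⁻¹ * (1 - C θ) = (1 : ℝ[X]) := by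
    rw [← C_1, ← C_sub, ← Polynomial.C_mul, inv_mul_cancel₀ (by linarith)]
  refine ⟨C (1 - θ)⁻¹ * (X * p), -(1 - θ)⁻¹, -(1 - θ)⁻¹,
    (SmallOver.X_mul_quotient hG hθ hp).C_mul (inv_nonneg.2 (by linarith)), ?_⟩
  rw [hp, C_neg]
  linear_combination (X * p) * hinv

theorem X_mul_of_prec (hG : NonposRooted G) (hp : Prec G h) (hh : NonnegOnPos h) :
    QuotientOver G (X * h) := by
  refine (hp.X_mul.poleCone hG.X_mul hh).X_mul_induction
    (motive := fun h => QuotientOver G (X * h)) hG (X_mul_X_mul hG) ?_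
    (fun θ p hθ hp => ?_) (fun c f hc hf => ?_) fun f g hf hg => ?_
  · simpa using linear_mul G 1 0
  · convert (linear_mul G 1 0).add
      ((neg_X_mul_quotient hG hθ hp).C_mul (neg_nonneg.2 hθ.le)) using 1
    rw [hp, C_neg, C_1, C_0]
    ring
  · rw [mul_left_comm]
    exact hf.C_mul hc
  · rw [mul_add]
    exact hf.add hg

theorem neg_of_prec (hG : NonposRooted G) (hp : Prec G h) (hh : NonnegOnPos h) :
    QuotientOver G (-h) := by
  refine (hp.X_mul.poleCone hG.X_mul hh).X_mul_induction
    (motive := fun h => QuotientOver G (-h)) hG ?_ ?_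
    (fun _ _ hθ hp => neg_X_mul_quotient hG hθ hp) (fun c f hc hf => ?_) fun f g hf hg => ?_
  · simpa using linear_mul G (-1) 0
  · simpa using linear_mul G 0 (-1)
  · rw [← mul_neg]
    exact hf.C_mul hc
  · rw [neg_add]
    exact hf.add hg

open Filter in
theorem prec (hG : NonposRooted G) (hF : NonnegOnPos F) (h : QuotientOver G ((X - 1) * F)) :
    Prec G F := by
  obtain ⟨R, b, κ, ⟨hR, hlim⟩, hN⟩ := h
  have hκ : κ = 0 := by
    have : 0 = κ * G.eval 1 := by simpa using congrArg (eval 1) hN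
    exact (mul_eq_zero.1 this.symm).resolve_right (hG.2 1 one_pos).ne'
  have hF_eq : F = R + C b * G :=
    mul_left_cancel₀ (by simpa using X_sub_C_ne_zero (1 : ℝ)) (by simpa [hκ] using hN)
  have hb : 0 ≤ b := by
    have hlim' := hlim.add_const b
    rw [zero_add] at hlim'
    refine ge_of_tendsto hlim' (eventually_nhdsWithin_of_forall fun x hx => ?_)
    have hFx := hF x hx
    rw [hF_eq, eval_add, eval_mul, eval_C] at hFx
    rw [div_add' _ _ _ (hG.2 x hx).ne']
    exact div_nonneg hFx (hG.2 x hx).le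
  rw [hF_eq]
  exact hR.add_right ((Prec.refl G).C_mul_right hb)

end QuotientOver

theorem Prec.of_sub_one_mul_eq {F G V W : ℝ[X]} (hG : NonposRooted G) (hGV : Prec G V)
    (hGW : Prec G W) (hV : NonnegOnPos V) (hW : NonnegOnPos W) (hF : NonnegOnPos F)
    (h : (X - 1) * F = X * V - W) : Prec G F := by
  refine QuotientOver.prec hG hF ?_
  rw [h, sub_eq_add_neg]
  exact (QuotientOver.X_mul_of_prec hG hGV hV).add (QuotientOver.neg_of_prec hG hGW hW)

/-- Zero or `NonposRooted`: the condition inherited by the sums of interlacing families. -/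
def NonposRootedOrZero (f : ℝ[X]) : Prop := f = 0 ∨ NonposRooted f

namespace NonposRootedOrZero

variable {f g : ℝ[X]}

theorem zero : NonposRootedOrZero 0 := Or.inl rfl

theorem nonnegOnPos (hf : NonposRootedOrZero f) : NonnegOnPos f := by
  rcases hf with rfl | hf
  · intro x _
    simp
  · exact hf.nonnegOnPos

theorem C_mul (hf : NonposRootedOrZero f) {c : ℝ} (hc : 0 ≤ c) : NonposRootedOrZero (C c * f) := by
  rcases hf with rfl | hf
  · exact Or.inl (mul_zero _)
  · rcases hc.eq_or_lt with rfl | hc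
    · exact Or.inl (by simp)
    · exact Or.inr ⟨fun z hz => hf.1 z (by simpa [hc.ne'] using hz), fun x hx => by
        simpa using mul_pos hc (hf.2 x hx)⟩

theorem X_mul (hf : NonposRootedOrZero f) : NonposRootedOrZero (X * f) :=
  hf.imp (fun h => by rw [h, mul_zero]) NonposRooted.X_mul

theorem of_prec_right (h : Prec f g) (hf : NonposRooted f) (hg : NonnegOnPos g) :
    NonposRootedOrZero g :=
  or_iff_not_imp_left.2 fun h0 => h.nonposRooted_right hf hg h0

theorem add (hf : NonposRootedOrZero f) (hg : NonposRootedOrZero g) (h : Prec f g) :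
    NonposRootedOrZero (f + g) := by
  rcases hf with rfl | hf
  · rwa [zero_add]
  · exact of_prec_right ((Prec.refl f).add_right h) hf (hf.nonnegOnPos.add hg.nonnegOnPos)

theorem sum {ι : Type*} [LinearOrder ι] {s : Finset ι} {g : ι → ℝ[X]}
    (hg : ∀ i ∈ s, NonposRootedOrZero (g i))
    (h : ∀ i ∈ s, ∀ j ∈ s, i ≤ j → Prec (g i) (g j)) : NonposRootedOrZero (∑ i ∈ s, g i) := by
  induction s using Finset.induction_on_max with
  | empty => exact zero
  | insert a s hmax ih =>
    rw [Finset.sum_insert fun ha => (hmax a ha).false, add_comm]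
    rw [Finset.forall_mem_insert] at hg
    refine add (ih hg.2 fun i hi j hj =>
      h i (Finset.mem_insert_of_mem hi) j (Finset.mem_insert_of_mem hj)) hg.1
      (Prec.sum_left fun i hi => ?_)
    exact h i (Finset.mem_insert_of_mem hi) a (Finset.mem_insert_self a s) (hmax i hi).le

end NonposRootedOrZero

namespace IsReversal

variable {n : ℕ} {f f' H : ℝ[X]}

theorem sub_one_mul_eval_sub_nonneg (hr : IsReversal n f f') (h : Prec f f')
    (hf : NonposRootedOrZero f) {x : ℝ} (hx : 0 < x) : 0 ≤ (x - 1) * (f'.eval x - f.eval x) := by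
  rcases hf with rfl | hf
  · simp [hr.eq_zero]
  have hcone := h.X_mul.poleCone hf.X_mul (hr.nonnegOnPos hf.nonnegOnPos)
  have hpos := hf.2 1 one_pos
  rcases le_total x 1 with hle | hle
  · have := hcone.eval_mul_eval_le hf hx hle
    rw [hr.eval_one, mul_comm] at this
    nlinarith [le_of_mul_le_mul_left this hpos]
  · have := hcone.eval_mul_eval_le hf one_pos hle
    rw [hr.eval_one, mul_comm (eval x f')] at this
    nlinarith [le_of_mul_le_mul_left this hpos]

theorem quotient_nonnegOnPos (hr : IsReversal n f f') (h : Prec f f') (hf : NonposRootedOrZero f)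
    (hH : (X - 1) * H = f' - f) : NonnegOnPos H := by
  have hne {x : ℝ} (hx : 0 < x) (hx₁ : x ≠ 1) : 0 ≤ H.eval x := by
    have := hr.sub_one_mul_eval_sub_nonneg h hf hx
    rw [← eval_sub, ← hH, eval_mul, eval_sub, eval_X, Polynomial.eval_one, ← mul_assoc] at this
    exact nonneg_of_mul_nonneg_right this (mul_self_pos.2 (sub_ne_zero.2 hx₁))
  intro x hx
  rcases eq_or_ne x 1 with rfl | hx₁
  · have : NonnegOnPos (H.comp (X + 1)) := fun y hy => by
      simpa using hne (x := y + 1) (by linarith) (by linarith)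
    simpa using this.eval_zero_nonneg
  · exact hne hx hx₁

theorem X_mul_quotient (hr : IsReversal n f f') (hH : (X - 1) * H = f' - f) :
    IsReversal (n + 1) (X * H) (X * H) := by
  intro z hz
  rcases eq_or_ne z 1 with rfl | hz₁
  · simp
  have eval_H (w : ℂ) : (w - 1) * aeval w H = aeval w f' - aeval w f := by
    simpa using congrArg (aeval w) hH
  have hinv : z⁻¹ - 1 = -((z - 1) * z⁻¹) := by
    rw [sub_mul, mul_inv_cancel₀ hz]
    ring
  apply mul_left_cancel₀ (sub_ne_zero.2 hz₁)
  simp only [map_mul, aeval_X]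
  calc (z - 1) * (z * aeval z H) = z * (aeval z f' - aeval z f) := by rw [← eval_H]; ring
    _ = -(z * z ^ n) * (aeval z⁻¹ f' - aeval z⁻¹ f) := by rw [hr z hz, hr.symm z hz]; ring
    _ = -(z * z ^ n) * ((z⁻¹ - 1) * aeval z⁻¹ H) := by rw [eval_H]
    _ = (z - 1) * (z ^ (n + 1) * (z⁻¹ * aeval z⁻¹ H)) := by rw [hinv]; ring

end IsReversal

/-! ### Symmetric interlacing families -/

section FilterSums

variable {ι M : Type*} [LinearOrder ι] [AddCommMonoid M] {s : Finset ι} {d e : ι}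

theorem sum_filter_lt_eq_add (g : ι → M) (hde : d ≤ e) :
    ∑ i ∈ s with d < i, g i = ∑ i ∈ s with d < i ∧ i ≤ e, g i + ∑ i ∈ s with e < i, g i := by
  rw [← Finset.sum_filter_add_sum_filter_not (s.filter (d < ·)) (· ≤ e), Finset.filter_filter,
    Finset.filter_filter]
  congr 2 with i
  simpa using fun _ hei => hde.trans_lt hei

theorem sum_filter_le_eq_add (g : ι → M) (hde : d ≤ e) :
    ∑ i ∈ s with i ≤ e, g i = ∑ i ∈ s with i ≤ d, g i + ∑ i ∈ s with d < i ∧ i ≤ e, g i := by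
  rw [← Finset.sum_filter_add_sum_filter_not (s.filter (· ≤ e)) (· ≤ d), Finset.filter_filter,
    Finset.filter_filter]
  congr 2 with i
  · simpa using fun _ hid => hid.trans hde
  · simp [and_comm]

end FilterSums

/-- `t` consists of the last elements of `s`. -/
def IsFinalSegment {ι : Type*} [LE ι] (t s : Finset ι) : Prop :=
  t ⊆ s ∧ ∀ i ∈ s, i ∉ t → ∀ j ∈ t, i ≤ j

theorem IsFinalSegment.refl {ι : Type*} [LE ι] (s : Finset ι) : IsFinalSegment s s :=
  ⟨subset_rfl, fun _ hi hi' => absurd hi hi'⟩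

theorem IsFinalSegment.empty {ι : Type*} [LE ι] (s : Finset ι) : IsFinalSegment ∅ s :=
  ⟨Finset.empty_subset s, by simp⟩

theorem IsFinalSegment.filter_lt {ι : Type*} [LinearOrder ι] (s : Finset ι) (d : ι) :
    IsFinalSegment {i ∈ s | d < i} s := by
  refine ⟨Finset.filter_subset _ _, fun i hi hid j hj => ?_⟩
  simp only [Finset.mem_filter, hi, true_and, not_lt] at hid hj
  exact hid.trans hj.2.le

/-- The members of `g` indexed by `s` are zero or nonpositive-rooted, and the later ones interlace
the earlier ones. -/
structure InterlacingFamily {ι : Type*} [LE ι] (s : Finset ι) (g : ι → ℝ[X]) : Prop where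
  rooted : ∀ i ∈ s, NonposRootedOrZero (g i)
  prec : ∀ i ∈ s, ∀ j ∈ s, i ≤ j → Prec (g i) (g j)

namespace InterlacingFamily

section Basic

variable {ι : Type*} [LE ι] {s t u : Finset ι} {g : ι → ℝ[X]}

theorem C_mul (h : InterlacingFamily s g) {w : ι → ℝ} (hw : ∀ i, 0 ≤ w i) :
    InterlacingFamily s (fun i => C (w i) * g i) where
  rooted i hi := (h.rooted i hi).C_mul (hw i)
  prec i hi j hj hij := ((h.prec i hi j hj hij).C_mul_left (hw i)).C_mul_right (hw j)

theorem mono (h : InterlacingFamily s g) (ht : t ⊆ s) : InterlacingFamily t g where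
  rooted i hi := h.rooted i (ht hi)
  prec i hi j hj := h.prec i (ht hi) j (ht hj)

theorem comp {κ : Type*} [LE κ] {t : Finset κ} (h : InterlacingFamily s g) {d : κ → ι}
    (hd : ∀ i ∈ t, d i ∈ s) (hmono : ∀ i ∈ t, ∀ j ∈ t, i ≤ j → d i ≤ d j) :
    InterlacingFamily t (fun i => g (d i)) where
  rooted i hi := h.rooted _ (hd i hi)
  prec i hi j hj hij := h.prec _ (hd i hi) _ (hd j hj) (hmono i hi j hj hij)

theorem sum_prec_sum_of_le (h : InterlacingFamily s g) (ht : t ⊆ s) (hu : u ⊆ s)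
    (htu : ∀ i ∈ t, ∀ j ∈ u, i ≤ j) : Prec (∑ i ∈ t, g i) (∑ i ∈ u, g i) :=
  Prec.sum_left fun i hi => Prec.sum_right fun j hj =>
    h.prec i (ht hi) j (hu hj) (htu i hi j hj)

end Basic

variable {ι : Type*} [LinearOrder ι] {s : Finset ι} {g : ι → ℝ[X]}

theorem sum_rooted (h : InterlacingFamily s g) : NonposRootedOrZero (∑ i ∈ s, g i) :=
  .sum h.rooted h.prec

theorem sum_filter_rooted (h : InterlacingFamily s g) (p : ι → Prop) [DecidablePred p] :
    NonposRootedOrZero (∑ i ∈ s with p i, g i) :=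
  (h.mono (Finset.filter_subset p s)).sum_rooted

theorem sum_filter_prec_sum_filter (h : InterlacingFamily s g) {p q : ι → Prop} [DecidablePred p]
    [DecidablePred q] (hpq : ∀ i j, p i → q j → i ≤ j) :
    Prec (∑ i ∈ s with p i, g i) (∑ i ∈ s with q i, g i) :=
  h.sum_prec_sum_of_le (Finset.filter_subset p s) (Finset.filter_subset q s) fun i hi j hj =>
    hpq i j (Finset.mem_filter.1 hi).2 (Finset.mem_filter.1 hj).2

theorem suffix_sums (h : InterlacingFamily s g) (t : Finset ι) :
    InterlacingFamily t (fun d => ∑ i ∈ s with d < i, g i) where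
  rooted d _ := h.sum_filter_rooted _
  prec d _ e _ hde := by
    rw [sum_filter_lt_eq_add g hde]
    exact (h.sum_filter_prec_sum_filter fun i j hi hj => hi.2.trans hj.le).add_left (Prec.refl _)

theorem suffix_sums_add_X_mul_prefix_sums (h : InterlacingFamily s g) (t : Finset ι) :
    InterlacingFamily t (fun d => ∑ i ∈ s with d < i, g i + X * ∑ i ∈ s with i ≤ d, g i) where
  rooted d _ := (h.sum_filter_rooted _).add (h.sum_filter_rooted _).X_mul
    (h.sum_filter_prec_sum_filter fun i j hi hj => hi.trans hj.le).X_mul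
  prec d _ e _ hde := by
    rw [sum_filter_lt_eq_add g hde, sum_filter_le_eq_add g hde]
    set L := ∑ i ∈ s with i ≤ d, g i
    set M := ∑ i ∈ s with d < i ∧ i ≤ e, g i
    set U := ∑ i ∈ s with e < i, g i
    have hLM : Prec L M := h.sum_filter_prec_sum_filter fun i j hi hj => hi.trans hj.1.le
    have hMU : Prec M U := h.sum_filter_prec_sum_filter fun i j hi hj => hi.2.trans hj.le
    have hUL : Prec (U + X * L) (U + X * L + X * M) :=
      (Prec.refl _).add_right (hMU.X_mul.add_left hLM.X_mul.X_mul)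
    have hM : Prec M (U + X * L + X * M) :=
      (hMU.add_right hLM.X_mul).add_right (Prec.refl M).X_mul
    rw [add_assoc M, mul_add, ← add_assoc U]
    exact hM.add_left hUL

end InterlacingFamily

/-- An interlacing family `g` which, together with the family `g'` of its reversals in the opposite
order, is interlacing. -/
structure SymInterlacing {ι : Type*} [LE ι] (n : ℕ) (s : Finset ι) (g g' : ι → ℝ[X]) : Prop
    extends InterlacingFamily s g where
  isReversal : ∀ i ∈ s, IsReversal n (g i) (g' i)
  cross : ∀ i ∈ s, ∀ j ∈ s, Prec (g i) (g' j)

namespace SymInterlacing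

section Basic

variable {ι : Type*} [LE ι] {n : ℕ} {s t u : Finset ι} {g g' : ι → ℝ[X]}

theorem C_mul (h : SymInterlacing n s g g') {w : ι → ℝ} (hw : ∀ i, 0 ≤ w i) :
    SymInterlacing n s (fun i => C (w i) * g i) (fun i => C (w i) * g' i) where
  toInterlacingFamily := h.toInterlacingFamily.C_mul hw
  isReversal i hi := (h.isReversal i hi).C_mul _
  cross i hi j hj := ((h.cross i hi j hj).C_mul_left (hw i)).C_mul_right (hw j)

theorem mono (h : SymInterlacing n s g g') (ht : t ⊆ s) : SymInterlacing n t g g' where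
  toInterlacingFamily := h.toInterlacingFamily.mono ht
  isReversal i hi := h.isReversal i (ht hi)
  cross i hi j hj := h.cross i (ht hi) j (ht hj)

theorem comp {κ : Type*} [LE κ] {t : Finset κ} (h : SymInterlacing n s g g') {d : κ → ι}
    (hd : ∀ i ∈ t, d i ∈ s) (hmono : ∀ i ∈ t, ∀ j ∈ t, i ≤ j → d i ≤ d j) :
    SymInterlacing n t (fun i => g (d i)) (fun i => g' (d i)) where
  toInterlacingFamily := h.toInterlacingFamily.comp hd hmono
  isReversal i hi := h.isReversal _ (hd i hi)
  cross i hi j hj := h.cross _ (hd i hi) _ (hd j hj)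

theorem sum_isReversal (h : SymInterlacing n s g g') :
    IsReversal n (∑ i ∈ s, g i) (∑ i ∈ s, g' i) :=
  .sum h.isReversal

theorem sum_prec_sum_of_subset (h : SymInterlacing n s g g') (ht : t ⊆ s) (hu : u ⊆ s) :
    Prec (∑ i ∈ t, g i) (∑ i ∈ u, g' i) :=
  Prec.sum_left fun i hi => Prec.sum_right fun j hj => h.cross i (ht hi) j (hu hj)

end Basic

variable {ι : Type*} [LinearOrder ι] {n : ℕ} {s t u : Finset ι} {g g' : ι → ℝ[X]}

theorem suffix_sums (h : SymInterlacing n s g g') (t : Finset ι) :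
    SymInterlacing n t (fun d => ∑ i ∈ s with d < i, g i) (fun d => ∑ i ∈ s with d < i, g' i) where
  toInterlacingFamily := h.toInterlacingFamily.suffix_sums t
  isReversal _ _ := (h.mono (Finset.filter_subset _ _)).sum_isReversal
  cross _ _ _ _ := h.sum_prec_sum_of_subset (Finset.filter_subset _ _) (Finset.filter_subset _ _)

theorem eq_of_sum_eq (h : SymInterlacing n s g g') (hsum : ∑ i ∈ s, g' i = ∑ i ∈ s, g i) :
    ∀ i ∈ s, g' i = g i := fun i hi => by
  refine eq_of_infinite_eval_eq _ _ ((Set.Ioi_infinite (1 : ℝ)).mono fun x (hx : 1 < x) => ?_)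
  have hle : ∀ j ∈ s, (g j).eval x ≤ (g' j).eval x := fun j hj => sub_nonneg.1 <|
    nonneg_of_mul_nonneg_right ((h.isReversal j hj).sub_one_mul_eval_sub_nonneg (h.cross j hj j hj)
      (h.rooted j hj) (zero_lt_one.trans hx)) (sub_pos.2 hx)
  refine ((Finset.sum_eq_sum_iff_of_le hle).1 ?_ i hi).symm
  rw [← eval_finsetSum, ← eval_finsetSum, hsum]

section Quotient

variable {H : ℝ[X]} (h : SymInterlacing n s g g')
  (hH : (X - 1) * H = ∑ i ∈ s, g' i - ∑ i ∈ s, g i)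

include h hH

theorem quotient_nonnegOnPos : NonnegOnPos H :=
  h.sum_isReversal.quotient_nonnegOnPos (h.sum_prec_sum_of_subset subset_rfl subset_rfl)
    h.sum_rooted hH

theorem quotient_add_sum_nonnegOnPos (ht : t ⊆ s) : NonnegOnPos (X * H + ∑ i ∈ t, g i) :=
  (h.quotient_nonnegOnPos hH).X_mul.add (h.mono ht).sum_rooted.nonnegOnPos

theorem quotient_add_sum_isReversal (ht : t ⊆ s) :
    IsReversal (n + 1) (X * H + ∑ i ∈ t, g i) (X * H + X * ∑ i ∈ t, g' i) :=
  (h.sum_isReversal.X_mul_quotient hH).add (h.mono ht).sum_isReversal.X_mul_right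

theorem sum_sdiff_prec_quotient_add_sum (ht : IsFinalSegment t s) (hu : IsFinalSegment u s)
    (htu : t ⊆ u) : Prec (∑ i ∈ u \ t, g i) (X * H + ∑ i ∈ t, g i) := by
  have hsub : u \ t ⊆ s := Finset.sdiff_subset.trans hu.1
  rcases (h.mono hsub).sum_rooted with h0 | hG
  · rw [h0]
    exact Prec.zero_left _
  have hlower : Prec (∑ i ∈ s \ u, g i) (∑ i ∈ u \ t, g i) := by
    refine h.sum_prec_sum_of_le Finset.sdiff_subset hsub fun i hi j hj => ?_
    rw [Finset.mem_sdiff] at hi hj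
    exact hu.2 i hi.1 hi.2 j hj.1
  have hupper : Prec (∑ i ∈ u \ t, g i) (∑ i ∈ t, g i) := by
    refine h.sum_prec_sum_of_le hsub ht.1 fun i hi => ?_
    exact ht.2 i (hsub hi) (Finset.mem_sdiff.1 hi).2
  have hnonneg {t : Finset ι} (ht : t ⊆ s) : NonnegOnPos (∑ i ∈ t, g i) :=
    (h.mono ht).sum_rooted.nonnegOnPos
  refine Prec.of_sub_one_mul_eq hG (h.sum_prec_sum_of_subset hsub subset_rfl)
    ((hlower.X_mul.add_right (Prec.refl _).X_mul).add_right hupper)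
    (h.sum_isReversal.nonnegOnPos (hnonneg subset_rfl))
    (((hnonneg Finset.sdiff_subset).X_mul.add (hnonneg hsub).X_mul).add (hnonneg ht.1))
    (h.quotient_add_sum_nonnegOnPos hH ht.1) ?_
  rw [← Finset.sum_sdiff hu.1 (f := g), ← Finset.sum_sdiff htu (f := g)] at hH
  linear_combination X * hH

theorem quotient_add_sum_prec (ht : IsFinalSegment t s) (hu : IsFinalSegment u s)
    (htu : t ⊆ u) : Prec (X * H + ∑ i ∈ u, g i) (X * H + ∑ i ∈ t, g i) := by
  rw [← Finset.sum_sdiff htu, add_left_comm]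
  exact (h.sum_sdiff_prec_quotient_add_sum hH ht hu htu).add_left (Prec.refl _)

theorem sum_prec_quotient : Prec (∑ i ∈ s, g i) (X * H) := by
  simpa using h.sum_sdiff_prec_quotient_add_sum hH (.empty s) (.refl s) (Finset.empty_subset s)

theorem quotient_add_sum_prec_quotient (ht : IsFinalSegment t s) :
    Prec (X * H + ∑ i ∈ t, g i) (X * H) := by
  simpa using h.quotient_add_sum_prec hH (.empty s) ht (Finset.empty_subset t)

variable (hne : ∑ i ∈ s, g i ≠ 0)

include hne

theorem quotient_add_sum_nonposRooted : NonposRooted (X * H + ∑ i ∈ s, g i) := by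
  have hsum := h.sum_rooted.resolve_left hne
  have hXH := (h.quotient_nonnegOnPos hH).X_mul
  refine Prec.nonposRooted_right ((h.sum_prec_quotient hH).add_right (Prec.refl _)) hsum
    (hXH.add hsum.nonnegOnPos) fun h0 => ?_
  have := congrArg (eval 1) h0
  rw [eval_add, eval_zero] at this
  linarith [hXH 1 one_pos, hsum.2 1 one_pos]

theorem quotient_add_sum_rooted (ht : IsFinalSegment t s) :
    NonposRootedOrZero (X * H + ∑ i ∈ t, g i) :=
  .of_prec_right (h.quotient_add_sum_prec hH ht (.refl s) ht.1)
    (h.quotient_add_sum_nonposRooted hH hne) (h.quotient_add_sum_nonnegOnPos hH ht.1)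

theorem X_mul_quotient_rooted : NonposRootedOrZero (X * H) := by
  simpa using h.quotient_add_sum_rooted hH hne (.empty s)

/-- In the cyclic order of the values at a point of the upper half plane, `X * H + ∑ i ∈ s, g i`
comes first and `X * H` is halfway between the family and its reversals. -/
theorem quotient_add_sum_cross (ht : IsFinalSegment t s) (hu : IsFinalSegment u s) :
    Prec (X * H + ∑ i ∈ t, g i) (X * H + X * ∑ i ∈ u, g' i) := by
  rcases eq_or_ne H 0 with rfl | hH₀
  · have heq := h.eq_of_sum_eq (sub_eq_zero.1 (by rw [← hH, mul_zero]))
    rw [mul_zero, zero_add, zero_add, Finset.sum_congr rfl fun i hi => heq i (hu.1 hi),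
      ← Finset.sum_congr rfl fun i hi => heq i (ht.1 hi)]
    exact (h.sum_prec_sum_of_subset hu.1 ht.1).X_mul
  have hrev := h.quotient_add_sum_isReversal hH hu.1
  have hfirst := h.quotient_add_sum_nonposRooted hH hne
  have hmiddle := (h.X_mul_quotient_rooted hH hne).resolve_left (mul_ne_zero X_ne_zero hH₀)
  have first_prec : Prec (X * H + ∑ i ∈ s, g i) (X * H + X * ∑ i ∈ u, g' i) := by
    have hfirst_rev := h.quotient_add_sum_isReversal hH (subset_refl s)
    rw [show X * H + X * ∑ i ∈ s, g' i = X * (X * H + ∑ i ∈ s, g i) by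
      linear_combination (-X) * hH] at hfirst_rev
    exact (hfirst_rev.prec hrev (h.quotient_add_sum_prec hH hu (.refl s) hu.1)).of_prec_X_mul
  exact Prec.trans_of_reference (fun z hz => hfirst.aeval_ne_zero hz)
    (fun z hz => hmiddle.aeval_ne_zero hz) (h.quotient_add_sum_prec hH ht (.refl s) ht.1)
    (h.quotient_add_sum_prec_quotient hH (.refl s)) first_prec
    (h.quotient_add_sum_prec_quotient hH ht)
    (hrev.prec (h.sum_isReversal.X_mul_quotient hH) (h.quotient_add_sum_prec_quotient hH hu))

theorem quotient_suffix_sums (t : Finset ι) :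
    SymInterlacing (n + 1) t (fun d => X * H + ∑ i ∈ s with d < i, g i)
      (fun d => X * H + X * ∑ i ∈ s with d < i, g' i) where
  isReversal _ _ := h.quotient_add_sum_isReversal hH (Finset.filter_subset _ _)
  rooted d _ := h.quotient_add_sum_rooted hH hne (.filter_lt s d)
  prec d _ e _ hde := h.quotient_add_sum_prec hH (.filter_lt s e) (.filter_lt s d)
    (Finset.monotone_filter_right s fun _ _ => hde.trans_lt)
  cross d _ e _ := h.quotient_add_sum_cross hH hne (.filter_lt s d) (.filter_lt s e)

end Quotient

end SymInterlacing

/-! ### Ranks -/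

section Rank

variable {P : Type u} [PartialOrder P]

theorem height_ne_top_of_finite [Finite P] (x : P) : Order.height x ≠ ⊤ := by
  rw [Ne, Order.height_eq_top_iff]
  intro h
  obtain ⟨p, -, hp⟩ := h (Nat.card P)
  have := Nat.card_le_card_of_injective p p.strictMono.injective
  rw [Nat.card_eq_fintype_card, Fintype.card_fin] at this
  omega

theorem coe_posetRank [Finite P] (x : P) : (posetRank x : ℕ∞) = Order.height x :=
  ENat.natCast_toNat (height_ne_top_of_finite x)

theorem posetRank_strictMono [Finite P] : StrictMono (posetRank : P → ℕ) := fun x y h => by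
  have := Order.height_strictMono h (height_ne_top_of_finite x).lt_top
  rw [← coe_posetRank, ← coe_posetRank] at this
  exact_mod_cast this

theorem posetRank_bot [OrderBot P] : posetRank (⊥ : P) = 0 := by simp [posetRank]

theorem posetRank_le_top [OrderTop P] [Finite P] (x : P) : posetRank x ≤ posetRank (⊤ : P) :=
  posetRank_strictMono.monotone le_top

theorem posetRank_lt_top_iff [OrderTop P] [Finite P] {x : P} :
    posetRank x < posetRank (⊤ : P) ↔ x ≠ ⊤ :=
  ⟨by rintro h rfl; exact h.false, fun h => posetRank_strictMono (lt_top_iff_ne_top.2 h)⟩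

theorem exists_posetRank_eq [BoundedOrder P] [Finite P] (hgr : IsGradedPoset P) {k : ℕ}
    (hk : k ≤ posetRank (⊤ : P)) : ∃ x : P, posetRank x = k := by
  induction k with
  | zero => exact ⟨⊥, posetRank_bot⟩
  | succ k ih =>
    obtain ⟨x, rfl⟩ := ih (by omega)
    obtain ⟨y, hxy, -⟩ := exists_covBy_le_of_lt (lt_top_iff_ne_top.2 (posetRank_lt_top_iff.1 hk))
    exact ⟨y, hgr x y hxy⟩

end Rank

/-! ### Rising chains -/

section Rising

variable {P : Type u} [PartialOrder P]

theorem IsSaturatedChain.le : ∀ {c : List P} {s t : P}, IsSaturatedChain s t c → s ≤ t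
  | [], _, _, h => by simp [IsSaturatedChain] at h
  | [a], s, t, h => by
    obtain ⟨hs, ht, -⟩ := h
    simp only [List.head?_cons, List.getLast?_singleton, Option.some.injEq] at hs ht
    rw [← hs, ← ht]
  | a :: b :: c, s, t, h => by
    obtain ⟨hs, ht, hc⟩ := h
    rw [List.isChain_cons_cons] at hc
    simp only [List.head?_cons, Option.some.injEq] at hs
    rw [← hs]
    exact hc.1.le.trans (IsSaturatedChain.le (c := b :: c) ⟨rfl, by simpa using ht, hc.2⟩)

variable {L : Type v} [LinearOrder L]

/-- There is a saturated chain with weakly increasing labels from `s` to `t` whose first step is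
the cover `s ⋖ u`. For an EL-labeling these relations sort the elements above `s` according to the
first step of the unique such chain. -/
def RisingVia (lam : P → P → L) (s u t : P) : Prop :=
  ∃ c : List P, IsSaturatedChain s t (s :: u :: c) ∧
    (chainLabels lam (s :: u :: c)).IsChain (· ≤ ·)

variable {lam : P → P → L} {s t u v : P}

theorem RisingVia.covBy (h : RisingVia lam s u t) : s ⋖ u := by
  obtain ⟨c, ⟨-, -, hc⟩, -⟩ := h
  exact (List.isChain_cons_cons.1 hc).1

theorem RisingVia.le (h : RisingVia lam s u t) : u ≤ t := by
  obtain ⟨c, ⟨-, ht, hc⟩, -⟩ := h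
  rw [List.isChain_cons_cons] at hc
  exact IsSaturatedChain.le (c := u :: c) ⟨rfl, by simpa using ht, hc.2⟩

theorem RisingVia.lt (h : RisingVia lam s u t) : s < t := h.covBy.lt.trans_le h.le

theorem risingVia_iff : RisingVia lam s u t ↔
    s ⋖ u ∧ (u = t ∨ ∃ v, RisingVia lam u v t ∧ lam s u ≤ lam u v) := by
  constructor
  · intro h
    refine ⟨h.covBy, ?_⟩
    obtain ⟨c, ⟨-, ht, hc⟩, hrise⟩ := h
    rw [List.isChain_cons_cons] at hc
    rcases c with - | ⟨v, c⟩
    · left; simpa using ht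
    · right
      simp only [chainLabels, List.tail_cons, List.zipWith_cons_cons,
        List.isChain_cons_cons] at hrise
      refine ⟨v, ⟨c, ⟨rfl, by simpa using ht, hc.2⟩, ?_⟩, hrise.1⟩
      simpa only [chainLabels, List.tail_cons, List.zipWith_cons_cons] using hrise.2
  · rintro ⟨hsu, rfl | ⟨v, ⟨c, ⟨-, ht, hc⟩, hrise⟩, hle⟩⟩
    · exact ⟨[], ⟨rfl, by simp, by simpa using hsu⟩, by simp [chainLabels]⟩
    · refine ⟨v :: c, ⟨rfl, by simpa using ht, List.isChain_cons_cons.2 ⟨hsu, hc⟩⟩, ?_⟩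
      simp only [chainLabels, List.tail_cons, List.zipWith_cons_cons,
        List.isChain_cons_cons] at hrise ⊢
      exact ⟨hle, hrise⟩

theorem IsELLabeling.existsUnique_risingVia (hlam : IsELLabeling lam) (h : s < t) :
    ∃! u, RisingVia lam s u t := by
  obtain ⟨c, ⟨hc, hrise⟩, huniq, -⟩ := hlam s t h.le
  rcases c with - | ⟨a, - | ⟨u, c⟩⟩
  · simp [IsSaturatedChain] at hc
  · obtain ⟨hs, ht, -⟩ := hc
    simp only [List.head?_cons, List.getLast?_singleton, Option.some.injEq] at hs ht
    exact absurd (hs.symm.trans ht) h.ne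
  · obtain rfl : a = s := by simpa using hc.1
    refine ⟨u, ⟨c, hc, hrise⟩, ?_⟩
    rintro u' ⟨c', hc', hrise'⟩
    have := huniq _ hc' hrise'
    simp only [List.cons.injEq, true_and] at this
    exact this.1

end Rising

/-! ### Label statistics -/

section Statistics

variable {P : Type u} [PartialOrder P] [Fintype P] {L : Type v} [LinearOrder L]
  {lam : P → P → L} {s t u v : P}

theorem mem_labelsAbove (h : s ⋖ t) : lam s t ∈ labelsAbove lam s := by
  classical
  rw [labelsAbove, Finset.mem_image]
  exact ⟨t, by simpa using h, rfl⟩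

theorem labelIndex_pos (h : s ⋖ t) : 0 < labelIndex lam s t :=
  Finset.card_pos.2 ⟨lam s t, Finset.mem_filter.2 ⟨mem_labelsAbove h, le_rfl⟩⟩

theorem labelIndex_le_card : labelIndex lam s t ≤ Fintype.card P := by
  classical
  refine (Finset.card_filter_le _ _).trans ?_
  rw [labelsAbove]
  exact Finset.card_image_le.trans (Finset.card_le_univ _)

theorem le_iff_descentCount_lt (h : u ⋖ v) :
    lam s u ≤ lam u v ↔ descentCount lam s u < labelIndex lam u v := by
  constructor
  · intro hle
    refine Finset.card_lt_card ((Finset.ssubset_iff_of_subset fun a ha => ?_).2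
      ⟨lam u v, Finset.mem_filter.2 ⟨mem_labelsAbove h, le_rfl⟩,
        fun hm => (Finset.mem_filter.1 hm).2.not_ge hle⟩)
    rw [Finset.mem_filter] at ha ⊢
    exact ⟨ha.1, ha.2.le.trans hle⟩
  · intro hlt
    by_contra! hcon
    refine hlt.not_ge (Finset.card_le_card fun a ha => ?_)
    rw [Finset.mem_filter] at ha ⊢
    exact ⟨ha.1, ha.2.trans_lt hcon⟩

theorem labelWidth_ne_zero_iff {i : ℕ} :
    labelWidth lam s i ≠ 0 ↔ ∃ t, s ⋖ t ∧ labelIndex lam s t = i := by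
  classical
  rw [labelWidth, Finset.card_ne_zero]
  simp [Finset.filter_nonempty_iff]

theorem labelWidth_zero : labelWidth lam s 0 = 0 := by
  by_contra h
  obtain ⟨t, hst, hzero⟩ := labelWidth_ne_zero_iff.1 h
  exact (labelIndex_pos hst).ne' hzero

open Classical in
theorem sum_covers_eq_sum_labelWidth {A : Type*} [Semiring A] (p : ℕ → Prop)
    [DecidablePred p] (g : ℕ → A) :
    ∑ v with s ⋖ v ∧ p (labelIndex lam s v), g (labelIndex lam s v) =
      ∑ j ∈ Finset.range (Fintype.card P + 1) with p j, (labelWidth lam s j : A) * g j := by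
  rw [← Finset.sum_fiberwise_of_maps_to (t := (Finset.range (Fintype.card P + 1)).filter p)
    (g := fun v => labelIndex lam s v)]
  · refine Finset.sum_congr rfl fun j hj => ?_
    rw [Finset.sum_congr rfl (g := fun _ => g j) fun v hv => by rw [(Finset.mem_filter.1 hv).2],
      Finset.sum_const, nsmul_eq_mul, labelWidth, Finset.filter_filter]
    congr 3
    ext v
    have hpj := (Finset.mem_filter.1 hj).2
    simp only [Finset.mem_filter, Finset.mem_univ, true_and]
    exact ⟨fun h => ⟨h.1.1, h.2⟩, fun h => ⟨⟨h.1, h.2 ▸ hpj⟩, h.2⟩⟩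
  · intro v hv
    rw [Finset.mem_filter, Finset.mem_range]
    exact ⟨Nat.lt_succ_of_le labelIndex_le_card, (Finset.mem_filter.1 hv).2.2⟩

theorem IsRankUniformLabeling.exists_labelWidth_eq (h : IsRankUniformLabeling lam) :
    ∃ w : ℕ → ℕ → ℕ, (∀ s i, labelWidth lam s i = w (posetRank s) i) ∧
      ∀ k, (∀ s : P, posetRank s ≠ k) → w k = 0 := by
  have hfactor : (labelWidth lam).FactorsThrough (posetRank : P → ℕ) := by
    intro s s' hs
    funext i
    rcases i.eq_zero_or_pos with rfl | hi
    · rw [labelWidth_zero, labelWidth_zero]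
    · exact h.1 s s' hs i hi
  refine ⟨Function.extend posetRank (labelWidth lam) 0, fun s i => ?_, fun k hk => ?_⟩
  · rw [hfactor.extend_apply]
  · exact Function.extend_apply' _ _ _ fun ⟨s, hs⟩ => hk s hs

theorem IsRankUniformLabeling.exists_descentCount_eq (h : IsRankUniformLabeling lam) :
    ∃ d : ℕ → ℕ → ℕ, ∀ s t, s ⋖ t →
      descentCount lam s t = d (posetRank s) (labelIndex lam s t) := by
  let position (e : {e : P × P // e.1 ⋖ e.2}) : ℕ × ℕ :=
    (posetRank e.1.1, labelIndex lam e.1.1 e.1.2)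
  let count (e : {e : P × P // e.1 ⋖ e.2}) : ℕ := descentCount lam e.1.1 e.1.2
  have hfactor : count.FactorsThrough position := fun e e' hee' =>
    h.2 _ _ _ _ (congrArg Prod.fst hee') e.2 e'.2 (congrArg Prod.snd hee')
  exact ⟨fun k i => Function.extend position count 0 (k, i), fun s t hst =>
    (hfactor.extend_apply 0 ⟨(s, t), hst⟩).symm⟩

end Statistics

/-! ### Summation along rising chains -/

section Counting

variable {P : Type u} [PartialOrder P] [Fintype P] {L : Type v} [LinearOrder L] {lam : P → P → L}
  {A : Type*} [AddCommMonoid A] {s t u : P}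

open Classical in
theorem IsELLabeling.sum_risingVia_const (hlam : IsELLabeling lam) (h : s < t) (a : A) :
    ∑ _u with RisingVia lam s _u t, a = a := by
  obtain ⟨u, hu, huniq⟩ := hlam.existsUnique_risingVia h
  have : ({u | RisingVia lam s u t} : Finset P) = {u} :=
    Finset.eq_singleton_iff_unique_mem.2
      ⟨by simpa using hu, fun x hx => huniq x (Finset.mem_filter.1 hx).2⟩
  rw [this, Finset.sum_singleton]

open Classical in
theorem IsELLabeling.sum_gt_eq_sum_risingVia (hlam : IsELLabeling lam) (s : P) (F : P → A) :
    ∑ t with s < t, F t = ∑ u with s ⋖ u, ∑ t with RisingVia lam s u t, F t := by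
  rw [Finset.sum_comm' (t' := {t | s < t}) (s' := fun t => {u | RisingVia lam s u t})]
  · exact Finset.sum_congr rfl fun t ht =>
      (hlam.sum_risingVia_const (Finset.mem_filter.1 ht).2 (F t)).symm
  · intro u t
    simp only [Finset.mem_filter, Finset.mem_univ, true_and]
    exact ⟨fun h => ⟨h.2, h.2.lt⟩, fun h => ⟨h.1.covBy, h.1⟩⟩

theorem IsELLabeling.risingVia_extend_iff (hlam : IsELLabeling lam) (h : s ⋖ u) {v : P}
    (hv : RisingVia lam u v t) :
    RisingVia lam s u t ↔ descentCount lam s u < labelIndex lam u v := by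
  rw [← le_iff_descentCount_lt hv.covBy]
  refine ⟨fun ht => ?_, fun hle => risingVia_iff.2 ⟨h, Or.inr ⟨v, hv, hle⟩⟩⟩
  obtain ⟨-, rfl | ⟨v', hv', hle⟩⟩ := risingVia_iff.1 ht
  · exact absurd hv.lt (lt_irrefl _)
  · rwa [(hlam.existsUnique_risingVia hv.lt).unique hv hv']

open Classical in
theorem IsELLabeling.sum_risingVia_eq (hlam : IsELLabeling lam) (h : s ⋖ u) (F : P → A) :
    ∑ t with RisingVia lam s u t, F t = F u +
      ∑ v with u ⋖ v ∧ descentCount lam s u < labelIndex lam u v,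
        ∑ t with RisingVia lam u v t, F t := by
  have hu : RisingVia lam s u u := risingVia_iff.2 ⟨h, Or.inl rfl⟩
  rw [Finset.sum_comm' (t' := ({t | RisingVia lam s u t} : Finset P).erase u)
      (s' := fun t => {v | RisingVia lam u v t}),
    ← Finset.add_sum_erase _ F (Finset.mem_filter.2 ⟨Finset.mem_univ u, hu⟩)]
  · refine congrArg (F u + ·) (Finset.sum_congr rfl fun t ht => ?_)
    obtain ⟨hne, ht⟩ := Finset.mem_erase.1 ht
    exact (hlam.sum_risingVia_const
      ((Finset.mem_filter.1 ht).2.le.lt_of_ne hne.symm) (F t)).symm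
  · intro v t
    simp only [Finset.mem_erase, Finset.mem_filter, Finset.mem_univ, true_and]
    exact ⟨fun ⟨⟨_, hlt⟩, hv⟩ => ⟨hv, hv.lt.ne', (hlam.risingVia_extend_iff h hv).2 hlt⟩,
      fun ⟨hv, _, ht⟩ => ⟨⟨hv.covBy, (hlam.risingVia_extend_iff h hv).1 ht⟩, hv⟩⟩

end Counting

section RankData

variable {P : Type u} [PartialOrder P] [Fintype P] [BoundedOrder P]

/-- Widths `w k i` and descent counts `d k i`, depending on the rank `k` and on the label index
`i < N` only, that determine all sums over the elements above a given one that are multiplicative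
in the ranks passed on the way: such a sum satisfies the recursion over the edges of rising chains,
in which `E k i` collects the contribution of the elements reached through an edge of index `i`
starting at rank `k`. -/
structure IsRankData (P : Type u) [PartialOrder P] [Fintype P] [BoundedOrder P] (N : ℕ)
    (w d : ℕ → ℕ → ℕ) : Prop where
  mono : ∀ k i j, w k i ≠ 0 → w k j ≠ 0 → i ≤ j → d k i ≤ d k j
  sum_eq : ∀ (c φ : ℕ → ℝ[X]) (E : ℕ → ℕ → ℝ[X]),
    (∀ k, k + 1 = posetRank (⊤ : P) → ∀ i, E k i = φ (k + 1)) →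
    (∀ k, k + 1 < posetRank (⊤ : P) → ∀ i, E k i = φ (k + 1) +
      c (k + 1) * ∑ j ∈ Finset.range N with d k i < j, (w (k + 1) j : ℝ[X]) * E (k + 1) j) →
    ∀ [DecidableLT P] (s : P), s ≠ ⊤ →
      ∑ t with s < t, (∏ l ∈ Finset.Ioo (posetRank s) (posetRank t), c l) * φ (posetRank t) =
        ∑ j ∈ Finset.range N, (w (posetRank s) j : ℝ[X]) * E (posetRank s) j

variable {L : Type v} [LinearOrder L] {lam : P → P → L} {w d : ℕ → ℕ → ℕ}

open Classical in
theorem IsELLabeling.sum_risingVia_eq_of_recursion (hgr : IsGradedPoset P)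
    (hlam : IsELLabeling lam) (hw : ∀ s i, labelWidth lam s i = w (posetRank s) i)
    (hd : ∀ s t, s ⋖ t → descentCount lam s t = d (posetRank s) (labelIndex lam s t))
    {c φ : ℕ → ℝ[X]} {E : ℕ → ℕ → ℝ[X]}
    (hE₀ : ∀ k, k + 1 = posetRank (⊤ : P) → ∀ i, E k i = φ (k + 1))
    (hE : ∀ k, k + 1 < posetRank (⊤ : P) → ∀ i, E k i = φ (k + 1) +
      c (k + 1) * ∑ j ∈ Finset.range (Fintype.card P + 1) with d k i < j,
        (w (k + 1) j : ℝ[X]) * E (k + 1) j) (s u : P) (h : s ⋖ u) :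
    ∑ t with RisingVia lam s u t,
      (∏ l ∈ Finset.Ioo (posetRank s) (posetRank t), c l) * φ (posetRank t) =
        E (posetRank s) (labelIndex lam s u) := by
  induction s using WellFoundedGT.induction generalizing u with
  | ind s ih =>
  have hru := hgr s u h
  have hIoo : Finset.Ioo (posetRank s) (posetRank s + 1) = ∅ :=
    Finset.eq_empty_of_forall_notMem fun l hl => by simp only [Finset.mem_Ioo] at hl; omega
  rw [hlam.sum_risingVia_eq h, hru, hIoo, Finset.prod_empty, one_mul]
  by_cases hu : u = ⊤
  · subst hu
    rw [hE₀ _ hru.symm, add_eq_left]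
    exact Finset.sum_eq_zero fun v hv =>
      absurd (Finset.mem_filter.1 hv).2.1.lt not_top_lt
  rw [hE _ (hru ▸ posetRank_lt_top_iff.2 hu), ← hd s u h, ← hru]
  simp_rw [← hw u]
  rw [← sum_covers_eq_sum_labelWidth (fun j => descentCount lam s u < j) (E (posetRank u)),
    Finset.mul_sum]
  refine congrArg _ (Finset.sum_congr rfl fun v hv => ?_)
  rw [← ih u h.lt v (Finset.mem_filter.1 hv).2.1, Finset.mul_sum]
  refine Finset.sum_congr rfl fun t ht => ?_
  have hut : posetRank u < posetRank t := posetRank_strictMono (Finset.mem_filter.1 ht).2.lt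
  have hIoo_insert : insert (posetRank u) (Finset.Ioo (posetRank u) (posetRank t)) =
      Finset.Ioo (posetRank s) (posetRank t) := by
    ext l
    simp only [Finset.mem_Ioo, Finset.mem_insert]
    omega
  rw [← mul_assoc, ← Finset.prod_insert (by simp), hIoo_insert]

theorem UMELShellable.exists_rankData (hP : UMELShellable.{u, v} P) :
    ∃ N w d, IsRankData P N w d := by
  classical
  obtain ⟨hgr, L, _, lam, hlam, hunif, hmono⟩ := hP
  obtain ⟨w, hw, hw₀⟩ := hunif.exists_labelWidth_eq
  obtain ⟨d, hd⟩ := hunif.exists_descentCount_eq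
  have hedge (k i : ℕ) (hki : w k i ≠ 0) :
      ∃ s t : P, posetRank s = k ∧ s ⋖ t ∧ labelIndex lam s t = i := by
    obtain ⟨s, rfl⟩ : ∃ s : P, posetRank s = k := by
      by_contra! hk
      exact hki (congrFun (hw₀ k hk) i)
    obtain ⟨t, hst, ht⟩ := labelWidth_ne_zero_iff.1 ((hw s i).trans_ne hki)
    exact ⟨s, t, rfl, hst, ht⟩
  refine ⟨Fintype.card P + 1, w, d, fun k i j hi hj hij => ?_, ?_⟩
  · obtain ⟨s, t, rfl, hst, rfl⟩ := hedge k i hi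
    obtain ⟨s', t', hs, hst', rfl⟩ := hedge _ j hj
    rw [← hd s t hst, ← hs, ← hd s' t' hst']
    exact hmono _ _ _ _ hs.symm hst hst' hij
  · intro c φ E hE₀ hE _ s _
    have hcovers := sum_covers_eq_sum_labelWidth (lam := lam) (s := s) (fun _ => True)
      (E (posetRank s))
    simp only [and_true, Finset.filter_true, hw] at hcovers
    rw [← hcovers, ← Finset.sum_congr rfl fun u hu =>
      hlam.sum_risingVia_eq_of_recursion hgr hw hd hE₀ hE s u (Finset.mem_filter.1 hu).2]
    convert hlam.sum_gt_eq_sum_risingVia s fun t =>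
      (∏ l ∈ Finset.Ioo (posetRank s) (posetRank t), c l) * φ (posetRank t)

end RankData

/-! ### Recursions over widths and descent counts -/

/-- Parameters of the recursions below: the rank `top` of a poset, a bound for the label indices,
the widths and descent counts of its edges by rank and label index, and a set of selected ranks. -/
structure RankParams where
  top : ℕ
  bound : ℕ
  width : ℕ → ℕ → ℕ
  desc : ℕ → ℕ → ℕ
  sel : Finset ℕ

namespace RankParams

section Sums

variable (D : RankParams) {A : Type*} [Semiring A]

/-- The sum of `g` over the edges above an element of rank `k` whose label index satisfies `p`,
for `g` depending on the label index only. -/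
def weightedSum (k : ℕ) (p : ℕ → Prop) [DecidablePred p] (g : ℕ → A) : A :=
  ∑ j ∈ Finset.range D.bound with p j, (D.width k j : A) * g j

/-- The weighted sum over all edges above an element of rank `k`. -/
def total (k : ℕ) (g : ℕ → A) : A := D.weightedSum k (fun _ => True) g

/-- The weighted sum over the edges of label index above `m`; for `m` the descent count of an edge
these are the edges that continue it to a rising chain. -/
def suffix (k m : ℕ) (g : ℕ → A) : A := D.weightedSum k (m < ·) g

/-- The label indices that occur at rank `k`. -/
def support (k : ℕ) : Finset ℕ := {i ∈ Finset.range D.bound | D.width k i ≠ 0}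

variable {D} {k : ℕ} {p : ℕ → Prop} [DecidablePred p]

theorem weightedSum_eq_sum_support (g : ℕ → A) :
    D.weightedSum k p g = ∑ j ∈ D.support k with p j, (D.width k j : A) * g j := by
  rw [weightedSum, support, Finset.filter_comm]
  refine (Finset.sum_filter_of_ne (p := (D.width k · ≠ 0)) fun j _ hj hw => hj ?_).symm
  rw [hw, Nat.cast_zero, zero_mul]

theorem total_eq_sum (g : ℕ → A) :
    D.total k g = ∑ j ∈ Finset.range D.bound, (D.width k j : A) * g j := by
  rw [total, weightedSum, Finset.filter_true]

theorem map_weightedSum {B : Type*} [Semiring B] (f : A →+* B) (g : ℕ → A) :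
    f (D.weightedSum k p g) = D.weightedSum k p fun j => f (g j) := by
  simp only [weightedSum, map_sum, map_mul, map_natCast]

theorem weightedSum_le_weightedSum {g g' : ℕ → ℝ} (h : ∀ i ∈ D.support k, g i ≤ g' i) :
    D.weightedSum k p g ≤ D.weightedSum k p g' := by
  rw [weightedSum_eq_sum_support, weightedSum_eq_sum_support]
  exact Finset.sum_le_sum fun j hj =>
    mul_le_mul_of_nonneg_left (h j (Finset.mem_of_mem_filter j hj)) (Nat.cast_nonneg _)

theorem total_eq_sum_support (g : ℕ → ℝ[X]) :
    D.total k g = ∑ j ∈ D.support k, C (D.width k j : ℝ) * g j := by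
  simp only [total, weightedSum_eq_sum_support, Finset.filter_true, C_eq_natCast]

theorem suffix_eq_sum_support (m : ℕ) (g : ℕ → ℝ[X]) :
    D.suffix k m g = ∑ j ∈ D.support k with m < j, C (D.width k j : ℝ) * g j := by
  simp only [suffix, weightedSum_eq_sum_support, C_eq_natCast]

end Sums

section Families

variable (D : RankParams)

/-- For `e = 0` and `e = 1` the recursions for the Chow polynomials of the dual of a rank-selected
poset and for its augmented Chow polynomial, split according to the first edge of a rising chain.
The two components are reversals of each other. Both are `1` or `X ^ e` at the rank below `top` and,
as junk, from there on. -/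
noncomputable def pairs (e k i : ℕ) : ℝ[X] × ℝ[X] :=
  if k + 1 < D.top then
    let lower := fun j => (pairs e (k + 1) j).1
    let upper := fun j => (pairs e (k + 1) j).2
    let quot := (D.total (k + 1) upper - D.total (k + 1) lower) /ₘ (X - C 1)
    if k + 1 ∈ D.sel then
      (X * quot + D.suffix (k + 1) (D.desc k i) lower,
        X * quot + X * D.suffix (k + 1) (D.desc k i) upper)
    else (D.suffix (k + 1) (D.desc k i) lower, D.suffix (k + 1) (D.desc k i) upper)
  else (1, X ^ e)
termination_by D.top - k

/-- The first component of `pairs`. -/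
noncomputable def lower (e k i : ℕ) : ℝ[X] := (D.pairs e k i).1

/-- The second component of `pairs`. -/
noncomputable def upper (e k i : ℕ) : ℝ[X] := (D.pairs e k i).2

/-- The quotient by `X - 1` of the difference of the total upper and lower polynomials. -/
noncomputable def quot (e k : ℕ) : ℝ[X] :=
  (D.total k (D.upper e k) - D.total k (D.lower e k)) /ₘ (X - C 1)

/-- The recursion for the `h`-polynomial of the order complex, split according to the first edge
of a rising chain. -/
noncomputable def hFamily (k i : ℕ) : ℝ[X] :=
  if k + 1 < D.top then
    if k + 1 ∈ D.sel then
      X * D.total (k + 1) (hFamily (k + 1)) + (1 - X) * D.suffix (k + 1) (D.desc k i)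
        (hFamily (k + 1))
    else D.suffix (k + 1) (D.desc k i) (hFamily (k + 1))
  else 1
termination_by D.top - k

/-- The number of rising chains to the top that start with a given edge of label index `i` at
rank `k`. -/
def pathCount (k i : ℕ) : ℕ :=
  if k + 1 < D.top then D.suffix (k + 1) (D.desc k i) (pathCount (k + 1)) else 1
termination_by D.top - k

variable {D} {e k : ℕ}

theorem lower_last (hk : k + 1 = D.top) (i : ℕ) : D.lower e k i = 1 := by
  rw [lower, pairs, if_neg hk.not_lt]

theorem upper_last (hk : k + 1 = D.top) (i : ℕ) : D.upper e k i = X ^ e := by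
  rw [upper, pairs, if_neg hk.not_lt]

theorem hFamily_last (hk : k + 1 = D.top) (i : ℕ) : D.hFamily k i = 1 := by
  rw [hFamily, if_neg hk.not_lt]

theorem pathCount_last (hk : k + 1 = D.top) (i : ℕ) : D.pathCount k i = 1 := by
  rw [pathCount, if_neg hk.not_lt]

theorem lower_eq (hk : k + 1 < D.top) (i : ℕ) : D.lower e k i =
    (if k + 1 ∈ D.sel then X * D.quot e (k + 1) else 0) +
      D.suffix (k + 1) (D.desc k i) (D.lower e (k + 1)) := by
  rw [lower, pairs, if_pos hk]
  split_ifs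
  · rfl
  · exact (zero_add _).symm

theorem upper_eq (hk : k + 1 < D.top) (i : ℕ) : D.upper e k i =
    (if k + 1 ∈ D.sel then X * D.quot e (k + 1) else 0) +
      (if k + 1 ∈ D.sel then X else 1) *
        D.suffix (k + 1) (D.desc k i) (D.upper e (k + 1)) := by
  rw [upper, pairs, if_pos hk]
  split_ifs
  · rfl
  · rw [zero_add, one_mul]
    rfl

theorem hFamily_eq (hk : k + 1 < D.top) (i : ℕ) : D.hFamily k i =
    (if k + 1 ∈ D.sel then X * D.total (k + 1) (D.hFamily (k + 1)) else 0) +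
      (if k + 1 ∈ D.sel then 1 - X else 1) *
        D.suffix (k + 1) (D.desc k i) (D.hFamily (k + 1)) := by
  rw [hFamily, if_pos hk]
  split_ifs
  · rfl
  · rw [zero_add, one_mul]

theorem pathCount_eq (hk : k + 1 < D.top) (i : ℕ) :
    D.pathCount k i = D.suffix (k + 1) (D.desc k i) (D.pathCount (k + 1)) := by
  rw [pathCount, if_pos hk]

theorem sub_one_mul_quot {n : ℕ}
    (h : IsReversal n (D.total k (D.lower e k)) (D.total k (D.upper e k))) :
    (X - 1) * D.quot e k = D.total k (D.upper e k) - D.total k (D.lower e k) := by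
  have hroot : (D.total k (D.upper e k) - D.total k (D.lower e k)).IsRoot 1 := by
    rw [IsRoot, eval_sub, h.eval_one, sub_self]
  have := mul_divByMonic_eq_iff_isRoot.2 hroot
  rwa [C_1] at this

end Families

/-- Conditions on the parameters under which the attached polynomials are real-rooted. -/
structure Admissible (D : RankParams) : Prop where
  mono : ∀ k i j, D.width k i ≠ 0 → D.width k j ≠ 0 → i ≤ j → D.desc k i ≤ D.desc k j
  total_pathCount_pos : ∀ k < D.top, 0 < D.total k (D.pathCount k)

variable {D : RankParams} {e k : ℕ}

theorem Admissible.desc_mono (hD : D.Admissible) : ∀ i ∈ D.support k, ∀ j ∈ D.support k,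
    i ≤ j → D.desc k i ≤ D.desc k j := fun i hi j hj =>
  hD.mono k i j (Finset.mem_filter.1 hi).2 (Finset.mem_filter.1 hj).2

theorem weightedSum_pathCount_le_eval_one {p : ℕ → Prop} [DecidablePred p] {g : ℕ → ℝ[X]}
    (h : ∀ i ∈ D.support k, (D.pathCount k i : ℝ) ≤ (g i).eval 1) :
    ((D.weightedSum k p (D.pathCount k) : ℕ) : ℝ) ≤ (D.weightedSum k p g).eval 1 := by
  rw [← Nat.coe_castRingHom, map_weightedSum, ← coe_evalRingHom, map_weightedSum]
  exact weightedSum_le_weightedSum h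

theorem Admissible.total_ne_zero (hD : D.Admissible) (hk : k < D.top) {g : ℕ → ℝ[X]}
    (h : ∀ i ∈ D.support k, (D.pathCount k i : ℝ) ≤ (g i).eval 1) : D.total k g ≠ 0 := by
  have hpos : 0 < ((D.total k (D.pathCount k) : ℕ) : ℝ) :=
    Nat.cast_pos.2 (hD.total_pathCount_pos k hk)
  have hle : ((D.total k (D.pathCount k) : ℕ) : ℝ) ≤ (D.total k g).eval 1 :=
    weightedSum_pathCount_le_eval_one h
  intro hzero
  rw [hzero, eval_zero] at hle
  exact (hpos.trans_le hle).false

/-- The degree with respect to which the lower and upper polynomials at rank `k` are reversals of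
each other. -/
def symDegree (D : RankParams) (e k : ℕ) : ℕ := e + (D.sel ∩ Finset.Ioo k D.top).card

theorem symDegree_last (hk : k + 1 = D.top) : D.symDegree e k = e := by
  rw [symDegree, ← hk, show Finset.Ioo k (k + 1) = ∅ by ext; simp, Finset.inter_empty,
    Finset.card_empty, add_zero]

theorem symDegree_eq (hk : k + 1 < D.top) :
    D.symDegree e k = D.symDegree e (k + 1) + if k + 1 ∈ D.sel then 1 else 0 := by
  have h : Finset.Ioo k D.top = insert (k + 1) (Finset.Ioo (k + 1) D.top) := by
    ext l; simp only [Finset.mem_Ioo, Finset.mem_insert]; omega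
  rw [symDegree, symDegree, h]
  split_ifs with hs
  · rw [Finset.inter_insert_of_mem hs, Finset.card_insert_of_notMem (by simp)]; rfl
  · rw [Finset.inter_insert_of_notMem hs]; rfl

/-! ### Interlacing of the recursively defined families -/

variable {n : ℕ}

section Weighted

variable (h : SymInterlacing n (D.support k) (D.lower e k) (D.upper e k))

include h

theorem symInterlacing_weighted : SymInterlacing n (D.support k)
    (fun i => C (D.width k i : ℝ) * D.lower e k i)
    (fun i => C (D.width k i : ℝ) * D.upper e k i) :=
  h.C_mul fun _ => Nat.cast_nonneg _

theorem sub_one_mul_quot_eq_sum_sub_sum : (X - 1) * D.quot e k =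
    ∑ i ∈ D.support k, C (D.width k i : ℝ) * D.upper e k i -
      ∑ i ∈ D.support k, C (D.width k i : ℝ) * D.lower e k i := by
  rw [← total_eq_sum_support, ← total_eq_sum_support]
  refine sub_one_mul_quot (n := n) ?_
  rw [total_eq_sum_support, total_eq_sum_support]
  exact (symInterlacing_weighted h).sum_isReversal

theorem quot_nonnegOnPos : NonnegOnPos (D.quot e k) :=
  (symInterlacing_weighted h).quotient_nonnegOnPos (sub_one_mul_quot_eq_sum_sub_sum h)

end Weighted

theorem symInterlacing_last (he : e ≤ 1) (hk : k + 1 = D.top) :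
    SymInterlacing (D.symDegree e k) (D.support k) (D.lower e k) (D.upper e k) := by
  rw [funext (lower_last hk), funext (upper_last hk), symDegree_last hk]
  refine ⟨⟨fun _ _ => Or.inr .one, fun _ _ _ _ _ => Prec.refl 1⟩, fun _ _ z _ => by simp,
    fun _ _ _ _ => ?_⟩
  interval_cases e
  · rw [pow_zero]; exact Prec.refl 1
  · simpa using (Prec.refl 1).X_mul

theorem symInterlacing_of_notMem_sel (hD : D.Admissible) (hk : k + 1 < D.top)
    (hsel : k + 1 ∉ D.sel)
    (h : SymInterlacing n (D.support (k + 1)) (D.lower e (k + 1)) (D.upper e (k + 1))) :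
    SymInterlacing n (D.support k) (D.lower e k) (D.upper e k) := by
  have hlower (i : ℕ) : D.lower e k i = ∑ j ∈ D.support (k + 1) with D.desc k i < j,
      C (D.width (k + 1) j : ℝ) * D.lower e (k + 1) j := by
    rw [lower_eq hk, if_neg hsel, suffix_eq_sum_support, zero_add]
  have hupper (i : ℕ) : D.upper e k i = ∑ j ∈ D.support (k + 1) with D.desc k i < j,
      C (D.width (k + 1) j : ℝ) * D.upper e (k + 1) j := by
    rw [upper_eq hk, if_neg hsel, if_neg hsel, suffix_eq_sum_support, zero_add, one_mul]
  rw [funext hlower, funext hupper]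
  exact ((symInterlacing_weighted h).suffix_sums ((D.support k).image (D.desc k))).comp
    (fun i hi => Finset.mem_image_of_mem _ hi) hD.desc_mono

theorem symInterlacing_of_mem_sel (hD : D.Admissible) (hk : k + 1 < D.top) (hsel : k + 1 ∈ D.sel)
    (h : SymInterlacing n (D.support (k + 1)) (D.lower e (k + 1)) (D.upper e (k + 1)))
    (hne : D.total (k + 1) (D.lower e (k + 1)) ≠ 0) :
    SymInterlacing (n + 1) (D.support k) (D.lower e k) (D.upper e k) := by
  have hlower (i : ℕ) : D.lower e k i = X * D.quot e (k + 1) + ∑ j ∈ D.support (k + 1) with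
      D.desc k i < j, C (D.width (k + 1) j : ℝ) * D.lower e (k + 1) j := by
    rw [lower_eq hk, if_pos hsel, suffix_eq_sum_support]
  have hupper (i : ℕ) : D.upper e k i = X * D.quot e (k + 1) + X * ∑ j ∈ D.support (k + 1) with
      D.desc k i < j, C (D.width (k + 1) j : ℝ) * D.upper e (k + 1) j := by
    rw [upper_eq hk, if_pos hsel, if_pos hsel, suffix_eq_sum_support]
  rw [total_eq_sum_support] at hne
  rw [funext hlower, funext hupper]
  exact ((symInterlacing_weighted h).quotient_suffix_sums (sub_one_mul_quot_eq_sum_sub_sum h) hne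
    ((D.support k).image (D.desc k))).comp (fun i hi => Finset.mem_image_of_mem _ hi) hD.desc_mono

theorem pathCount_le_eval_lower (hk : k + 1 < D.top)
    (h : SymInterlacing n (D.support (k + 1)) (D.lower e (k + 1)) (D.upper e (k + 1)))
    (hle : ∀ i ∈ D.support (k + 1), (D.pathCount (k + 1) i : ℝ) ≤ (D.lower e (k + 1) i).eval 1)
    (i : ℕ) : (D.pathCount k i : ℝ) ≤ (D.lower e k i).eval 1 := by
  rw [pathCount_eq hk, lower_eq hk, eval_add]
  refine (weightedSum_pathCount_le_eval_one (p := (D.desc k i < ·)) hle).trans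
    (le_add_of_nonneg_left ?_)
  split_ifs
  · simpa using quot_nonnegOnPos h 1 one_pos
  · simp

theorem Admissible.symInterlacing_and_pathCount_le (hD : D.Admissible) (he : e ≤ 1)
    (hk : k < D.top) :
    SymInterlacing (D.symDegree e k) (D.support k) (D.lower e k) (D.upper e k) ∧
      ∀ i ∈ D.support k, (D.pathCount k i : ℝ) ≤ (D.lower e k i).eval 1 := by
  obtain ⟨n, hn⟩ := Nat.exists_eq_add_of_lt hk
  induction n generalizing k with
  | zero =>
    refine ⟨symInterlacing_last he hn.symm, fun i _ => ?_⟩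
    rw [pathCount_last hn.symm, lower_last hn.symm, Nat.cast_one, eval_one]
  | succ n ih =>
    have hk' : k + 1 < D.top := by omega
    obtain ⟨hsym, hle⟩ := ih hk' (by omega)
    refine ⟨?_, fun i _ => pathCount_le_eval_lower hk' hsym hle i⟩
    rw [symDegree_eq hk']
    split_ifs with hsel
    · exact symInterlacing_of_mem_sel hD hk' hsel hsym (hD.total_ne_zero hk' hle)
    · exact symInterlacing_of_notMem_sel hD hk' hsel hsym

section Conclusions

variable (hD : D.Admissible) (he : e ≤ 1) (hk : k < D.top)

include hD he hk

theorem Admissible.symInterlacing :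
    SymInterlacing (D.symDegree e k) (D.support k) (D.lower e k) (D.upper e k) :=
  (hD.symInterlacing_and_pathCount_le he hk).1

theorem Admissible.sub_one_mul_quot :
    (X - 1) * D.quot e k = D.total k (D.upper e k) - D.total k (D.lower e k) := by
  rw [total_eq_sum_support, total_eq_sum_support]
  exact sub_one_mul_quot_eq_sum_sub_sum (hD.symInterlacing he hk)

theorem Admissible.sum_lower_ne_zero :
    ∑ i ∈ D.support k, C (D.width k i : ℝ) * D.lower e k i ≠ 0 := by
  rw [← total_eq_sum_support]
  exact hD.total_ne_zero hk (hD.symInterlacing_and_pathCount_le he hk).2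

theorem Admissible.augmented_nonposRooted :
    NonposRooted (X * D.quot e k + D.total k (D.lower e k)) := by
  have h := hD.symInterlacing he hk
  rw [total_eq_sum_support]
  exact (symInterlacing_weighted h).quotient_add_sum_nonposRooted
    (sub_one_mul_quot_eq_sum_sub_sum h) (hD.sum_lower_ne_zero he hk)

theorem Admissible.augmented_prec :
    Prec (X * D.quot e k + D.total k (D.lower e k)) (X * D.quot e k) := by
  have h := hD.symInterlacing he hk
  rw [total_eq_sum_support]
  exact (symInterlacing_weighted h).quotient_add_sum_prec_quotient
    (sub_one_mul_quot_eq_sum_sub_sum h) (.refl _)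

theorem Admissible.quot_nonposRooted (h0 : D.quot e k ≠ 0) : NonposRooted (D.quot e k) := by
  have h := hD.symInterlacing he hk
  have hX : NonposRooted (X * D.quot e k) := ((symInterlacing_weighted h).X_mul_quotient_rooted
    (sub_one_mul_quot_eq_sum_sub_sum h) (hD.sum_lower_ne_zero he hk)).resolve_left
      (mul_ne_zero X_ne_zero h0)
  exact NonposRooted.of_linear_mul (θ := 0) (by simpa using hX)

theorem Admissible.quot_interlaces (h0 : D.quot e k ≠ 0) :
    Interlaces (D.quot e k) (X * D.quot e k + D.total k (D.lower e k)) :=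
  (hD.augmented_prec he hk).of_prec_X_mul.interlaces (hD.quot_nonposRooted he hk h0)
    (hD.augmented_nonposRooted he hk)

end Conclusions

theorem interlacingFamily_hFamily_of_notMem_sel (hD : D.Admissible) (hk : k + 1 < D.top)
    (hsel : k + 1 ∉ D.sel) (h : InterlacingFamily (D.support (k + 1)) (D.hFamily (k + 1))) :
    InterlacingFamily (D.support k) (D.hFamily k) := by
  have heq (i : ℕ) : D.hFamily k i = ∑ j ∈ D.support (k + 1) with D.desc k i < j,
      C (D.width (k + 1) j : ℝ) * D.hFamily (k + 1) j := by
    rw [hFamily_eq hk, if_neg hsel, if_neg hsel, suffix_eq_sum_support, zero_add, one_mul]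
  rw [funext heq]
  exact ((h.C_mul fun _ => Nat.cast_nonneg _).suffix_sums ((D.support k).image (D.desc k))).comp
    (fun i hi => Finset.mem_image_of_mem _ hi) hD.desc_mono

theorem interlacingFamily_hFamily_of_mem_sel (hD : D.Admissible) (hk : k + 1 < D.top)
    (hsel : k + 1 ∈ D.sel) (h : InterlacingFamily (D.support (k + 1)) (D.hFamily (k + 1))) :
    InterlacingFamily (D.support k) (D.hFamily k) := by
  have heq (i : ℕ) : D.hFamily k i =
      ∑ j ∈ D.support (k + 1) with D.desc k i < j,
        C (D.width (k + 1) j : ℝ) * D.hFamily (k + 1) j +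
      X * ∑ j ∈ D.support (k + 1) with j ≤ D.desc k i,
        C (D.width (k + 1) j : ℝ) * D.hFamily (k + 1) j := by
    rw [hFamily_eq hk, if_pos hsel, if_pos hsel, total_eq_sum_support, suffix_eq_sum_support,
      ← Finset.sum_filter_add_sum_filter_not (D.support (k + 1)) (D.desc k i < ·)]
    simp only [not_lt]
    ring
  rw [funext heq]
  exact ((h.C_mul fun _ => Nat.cast_nonneg _).suffix_sums_add_X_mul_prefix_sums
    ((D.support k).image (D.desc k))).comp (fun i hi => Finset.mem_image_of_mem _ hi) hD.desc_mono

theorem Admissible.interlacingFamily_hFamily (hD : D.Admissible) (hk : k < D.top) :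
    InterlacingFamily (D.support k) (D.hFamily k) := by
  obtain ⟨n, hn⟩ := Nat.exists_eq_add_of_lt hk
  induction n generalizing k with
  | zero =>
    rw [funext (hFamily_last hn.symm)]
    exact ⟨fun _ _ => Or.inr .one, fun _ _ _ _ _ => Prec.refl 1⟩
  | succ n ih =>
    have hk' : k + 1 < D.top := by omega
    have h := ih hk' (by omega)
    by_cases hsel : k + 1 ∈ D.sel
    · exact interlacingFamily_hFamily_of_mem_sel hD hk' hsel h
    · exact interlacingFamily_hFamily_of_notMem_sel hD hk' hsel h

theorem Admissible.total_hFamily_rooted (hD : D.Admissible) (hk : k < D.top) :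
    NonposRootedOrZero (D.total k (D.hFamily k)) := by
  rw [total_eq_sum_support]
  exact ((hD.interlacingFamily_hFamily hk).C_mul fun _ => Nat.cast_nonneg _).sum_rooted

end RankParams

/-! ### Rank-selected posets -/

section RankOfElements

theorem posetRank_eq_of_strictMono {Q : Type*} [PartialOrder Q] {ρ : Q → ℕ} (hρ : StrictMono ρ)
    (h : ∀ x n, ρ x = n + 1 → ∃ y < x, ρ y = n) (x : Q) : posetRank x = ρ x := by
  have hle : ∀ n x, ρ x = n → (n : ℕ∞) ≤ Order.height x := fun n => by
    induction n with
    | zero => simp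
    | succ n ih =>
      intro x hx
      obtain ⟨y, hyx, hy⟩ := h x n hx
      exact (add_le_add_left (ih y hy) 1).trans (Order.height_add_one_le hyx)
  have hge : Order.height x ≤ ρ x := by
    simpa using Order.height_le_height_apply_of_strictMono ρ hρ x
  rw [posetRank, hge.antisymm (hle _ x rfl), ENat.toNat_natCast]

variable {P : Type u} [PartialOrder P] [BoundedOrder P] [Finite P]

theorem IsGradedPoset.exists_le_posetRank_eq (hgr : IsGradedPoset P) (x : P) {m : ℕ}
    (hm : m ≤ posetRank x) : ∃ y ≤ x, posetRank y = m := by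
  induction x using WellFoundedLT.induction with
  | ind x ih =>
    rcases hm.eq_or_lt with rfl | hlt
    · exact ⟨x, le_rfl, rfl⟩
    · have hx : ⊥ < x := bot_lt_iff_ne_bot.2 fun h => by rw [h, posetRank_bot] at hlt; omega
      obtain ⟨y, -, hy⟩ := exists_le_covBy_of_lt hx
      have := hgr y x hy
      obtain ⟨z, hz, hzm⟩ := ih y hy.lt (by omega)
      exact ⟨z, hz.trans hy.le, hzm⟩

theorem IsGradedPoset.exists_ge_posetRank_eq (hgr : IsGradedPoset P) (x : P) {m : ℕ}
    (hm : posetRank x ≤ m) (hm' : m ≤ posetRank (⊤ : P)) : ∃ y, x ≤ y ∧ posetRank y = m := by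
  induction x using WellFoundedGT.induction with
  | ind x ih =>
    rcases hm.eq_or_lt with rfl | hlt
    · exact ⟨x, le_rfl, rfl⟩
    · obtain ⟨y, hy, -⟩ := exists_covBy_le_of_lt
        (lt_top_iff_ne_top.2 (posetRank_lt_top_iff.1 (hlt.trans_le hm')))
      have := hgr x y hy
      obtain ⟨z, hz, hzm⟩ := ih y hy.lt (by omega)
      exact ⟨z, hy.le.trans hz, hzm⟩

end RankOfElements

/-- The rank in a rank-selected poset of an element of rank `k`: the number of selected ranks,
among them always `0`, below `k`. -/
def selRank (S : Finset ℕ) (k : ℕ) : ℕ := Nat.count (· ∈ insert 0 S) k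

section SelRank

variable {S : Finset ℕ} {a b n : ℕ}

theorem selRank_eq_add (ha : a ∈ insert 0 S) (hab : a < b) :
    selRank S b = selRank S a + 1 + (S ∩ Finset.Ioo a b).card := by
  induction b, hab using Nat.le_induction with
  | base =>
    have hIoo : Finset.Ioo a (a + 1) = ∅ := by ext; simp
    rw [selRank, Nat.count_succ_eq_succ_count ha, hIoo, Finset.inter_empty, Finset.card_empty]
    rfl
  | succ b hab ih =>
    have hIoo : Finset.Ioo a (b + 1) = insert b (Finset.Ioo a b) := by
      ext l; simp only [Finset.mem_Ioo, Finset.mem_insert]; omega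
    have hb : b ∈ insert 0 S ↔ b ∈ S := Finset.mem_insert.trans (or_iff_right (by omega))
    rw [selRank, Nat.count_succ, ← selRank, ih, hIoo]
    by_cases hbS : b ∈ S
    · rw [if_pos (hb.2 hbS), Finset.inter_insert_of_mem hbS,
        Finset.card_insert_of_notMem (by simp), add_assoc]
    · rw [if_neg (mt hb.1 hbS), Finset.inter_insert_of_notMem hbS, add_zero]

theorem selRank_lt_selRank (ha : a ∈ insert 0 S) (hab : a < b) : selRank S a < selRank S b := by
  rw [selRank_eq_add ha hab]
  omega

theorem exists_lt_selRank_eq (h : selRank S b = n + 1) :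
    ∃ a ∈ insert 0 S, a < b ∧ selRank S a = n := by
  induction b with
  | zero => simp [selRank] at h
  | succ b ih =>
    rw [selRank, Nat.count_succ, ← selRank] at h
    split_ifs at h with hb
    · exact ⟨b, hb, b.lt_succ_self, by omega⟩
    · obtain ⟨a, ha, hab, han⟩ := ih h
      exact ⟨a, ha, hab.trans b.lt_succ_self, han⟩

theorem exists_gt_selRank_eq (ha : a ∈ insert 0 S) (hab : a < b) :
    ∃ c ∈ insert b S, a < c ∧ c ≤ b ∧ selRank S c = selRank S a + 1 := by
  induction b, hab using Nat.le_induction with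
  | base => exact ⟨a + 1, Finset.mem_insert_self _ _, a.lt_succ_self, le_rfl,
      Nat.count_succ_eq_succ_count ha⟩
  | succ b hab ih =>
    obtain ⟨c, hc, hac, hcb, hrank⟩ := ih
    by_cases hcS : c ∈ S
    · exact ⟨c, Finset.mem_insert_of_mem hcS, hac, hcb.trans b.le_succ, hrank⟩
    · obtain rfl := (Finset.mem_insert.1 hc).resolve_right hcS
      have hc₀ : c ∉ insert 0 S := by
        rw [Finset.mem_insert, not_or]
        exact ⟨by omega, hcS⟩
      exact ⟨c + 1, Finset.mem_insert_self _ _, by omega, le_rfl,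
        (Nat.count_succ_eq_count hc₀).trans hrank⟩

theorem prod_Ioo_ite_mem_eq_pow {M : Type*} [CommMonoid M] (y : M) (ha : a ∈ insert 0 S)
    (hab : a < b) : (∏ l ∈ Finset.Ioo a b, if l ∈ S then y else 1) =
      y ^ (selRank S b - selRank S a - 1) := by
  have hcard : (S ∩ Finset.Ioo a b).card = selRank S b - selRank S a - 1 := by
    rw [selRank_eq_add ha hab]
    omega
  rw [Finset.prod_ite, Finset.prod_const_one, mul_one, Finset.prod_const,
    Finset.filter_mem_eq_inter, Finset.inter_comm, hcard]

end SelRank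

namespace RankSelected

variable {P : Type u} [PartialOrder P] [BoundedOrder P] {S : Finset ℕ}

theorem val_ne_top {x : RankSelected P S} (hx : x ≠ ⊤) : x.1 ≠ ⊤ := fun h => hx (Subtype.ext h)

variable [Finite P]

theorem posetRank_val_mem {x : RankSelected P S} (hx : x ≠ ⊤) : posetRank x.1 ∈ insert 0 S := by
  have hrank := (posetRank_lt_top_iff.2 (val_ne_top hx)).ne
  have hx' := x.2
  rw [Finset.mem_insert]
  tauto

theorem posetRank_eq (hgr : IsGradedPoset P) (x : RankSelected P S) :
    posetRank x = selRank S (posetRank x.1) := by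
  refine posetRank_eq_of_strictMono (fun y z hyz => selRank_lt_selRank
    (posetRank_val_mem hyz.ne_top) (posetRank_strictMono (show y.1 < z.1 from hyz)))
    (fun x n hx => ?_) x
  obtain ⟨k, hk, hkx, hkn⟩ := exists_lt_selRank_eq hx
  obtain ⟨y, hyx, rfl⟩ := hgr.exists_le_posetRank_eq x.1 hkx.le
  refine ⟨⟨y, ?_⟩, lt_of_le_of_ne hyx fun h => ?_, hkn⟩
  · rw [Finset.mem_insert] at hk
    tauto
  · exact hkx.ne (congrArg (fun z => posetRank z.1) h)

theorem exists_gt_posetRank_eq (hgr : IsGradedPoset P) {x : RankSelected P S} (hx : x ≠ ⊤) :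
    ∃ y > x, posetRank y = posetRank x + 1 := by
  obtain ⟨k, hk, hxk, hk_top, hrank⟩ :=
    exists_gt_selRank_eq (posetRank_val_mem hx) (posetRank_lt_top_iff.2 (val_ne_top hx))
  obtain ⟨y, hxy, rfl⟩ := hgr.exists_ge_posetRank_eq x.1 hxk.le hk_top
  have hy : posetRank y ∈ S ∨ posetRank y = 0 ∨ posetRank y = posetRank (⊤ : P) := by
    rw [Finset.mem_insert] at hk
    tauto
  refine ⟨⟨y, hy⟩, lt_of_le_of_ne hxy fun h => ?_, ?_⟩
  · exact hxk.ne (congrArg (fun z => posetRank z.1) h)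
  · exact (posetRank_eq hgr _).trans (hrank.trans (by rw [posetRank_eq hgr x]))

theorem posetRank_toDual (hgr : IsGradedPoset P) (x : RankSelected P S) :
    posetRank (OrderDual.toDual x) = posetRank (⊤ : RankSelected P S) - posetRank x := by
  have : Finite (RankSelected P S) := Subtype.finite
  refine posetRank_eq_of_strictMono (Q := (RankSelected P S)ᵒᵈ)
    (ρ := fun y => posetRank (⊤ : RankSelected P S) - posetRank (OrderDual.ofDual y))
    (fun y z hyz => ?_) (fun y n hy => ?_) (OrderDual.toDual x)
  · have hlt : posetRank (OrderDual.ofDual z) < posetRank (OrderDual.ofDual y) :=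
      posetRank_strictMono hyz
    exact Nat.sub_lt_sub_left (hlt.trans_le (posetRank_le_top _)) hlt
  · have hy_top : OrderDual.ofDual y ≠ ⊤ := fun h => by simp [h] at hy
    obtain ⟨z, hyz, hz⟩ := exists_gt_posetRank_eq hgr hy_top
    refine ⟨OrderDual.toDual z, hyz, ?_⟩
    rw [OrderDual.ofDual_toDual, hz]
    omega

end RankSelected

/-! ### Chow polynomials of upper intervals -/

section ChowUpper

theorem one_sub_X_ne_zero {R : Type*} [Ring R] [Nontrivial R] : (1 - X : R[X]) ≠ 0 := by
  rw [← neg_sub, neg_ne_zero]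
  exact X_sub_C_ne_zero 1

variable {Q : Type u} [PartialOrder Q] [Fintype Q]

open Classical in
theorem sum_mobiusFun_left (a b : Q) :
    ∑ x with a ≤ x ∧ x ≤ b, mobiusFun x b = if a = b then 1 else 0 := by
  let _ : LocallyFiniteOrder Q := Fintype.toLocallyFiniteOrder
  rw [← IncidenceAlgebra.sum_Icc_mu_left (𝕜 := ℤ) a b]
  exact Finset.sum_congr (by ext; simp) fun _ _ => rfl

open Classical in
theorem sum_mobiusFun_right (a b : Q) :
    ∑ x with a ≤ x ∧ x ≤ b, mobiusFun a x = if a = b then 1 else 0 := by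
  let _ : LocallyFiniteOrder Q := Fintype.toLocallyFiniteOrder
  rw [← IncidenceAlgebra.sum_Icc_mu_right (𝕜 := ℤ) a b]
  exact Finset.sum_congr (by ext; simp) fun _ _ => rfl

open Classical in
theorem sum_ge_sum_ge_mobiusFun_smul {A : Type*} [AddCommGroup A] (f : Q → A) (a : Q) :
    ∑ s with a ≤ s, ∑ w with s ≤ w, mobiusFun s w • f w = f a := by
  rw [Finset.sum_comm' (t' := {w | a ≤ w}) (s' := fun w => {s | a ≤ s ∧ s ≤ w})]
  · simp only [← Finset.sum_smul, sum_mobiusFun_left, ite_smul, one_smul, zero_smul]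
    rw [Finset.sum_ite_eq, if_pos (by simp)]
  · intro s w
    simp only [Finset.mem_filter_univ]
    exact ⟨fun h => ⟨h, h.1.trans h.2⟩, fun h => h.1⟩

theorem mobiusFun_self (s : Q) : mobiusFun s s = 1 := by
  classical
  let _ : LocallyFiniteOrder Q := Fintype.toLocallyFiniteOrder
  exact IncidenceAlgebra.mu_self s

theorem intervalCharPoly_self (s : Q) : intervalCharPoly s s = 1 := by
  classical
  rw [intervalCharPoly, Finset.sum_eq_single_of_mem s (by simp), mobiusFun_self]
  · simp
  · intro w hw hne
    rw [Finset.mem_filter_univ] at hw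
    exact absurd (le_antisymm hw.2 hw.1) hne

theorem sub_one_mul_reducedCharPoly {s t : Q} (h : s < t) :
    (X - 1) * reducedCharPoly s t = intervalCharPoly s t := by
  classical
  have hroot : (intervalCharPoly s t).IsRoot 1 := by
    have hsum := congrArg (Int.cast : ℤ → ℝ) (sum_mobiusFun_right s t)
    simpa [IsRoot, intervalCharPoly, eval_finsetSum, h.ne] using hsum
  rw [reducedCharPoly, ← C_1]
  exact mul_divByMonic_eq_iff_isRoot.2 hroot

open Classical in
theorem sum_ge_eq_add {A : Type*} [AddCommMonoid A] (s : Q) (f : Q → A) :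
    ∑ t with s ≤ t, f t = f s + ∑ t with s < t, f t := by
  have h : Finset.univ.filter (s ≤ ·) = insert s (Finset.univ.filter (s < ·)) := by
    ext t
    simp [le_iff_eq_or_lt, eq_comm]
  rw [h, Finset.sum_insert (by simp)]

open Classical in
theorem sum_ge_intervalCharPoly_mul (K : Q → ℝ[X]) (s : Q) :
    ∑ t with s ≤ t, intervalCharPoly s t * K t =
      ∑ w with s ≤ w, mobiusFun s w • ∑ t with w ≤ t, X ^ (posetRank t - posetRank w) * K t := by
  simp only [intervalCharPoly, Finset.sum_mul, Finset.smul_sum, zsmul_eq_mul, map_intCast,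
    mul_assoc]
  refine Finset.sum_comm' fun t w => ?_
  simp only [Finset.mem_filter_univ]
  exact ⟨fun h => ⟨h.2.2, h.2.1⟩, fun h => ⟨h.2.trans h.1, h.2, h.1⟩⟩

open Classical in
theorem eq_of_sum_ge_pow_sub_X_mul_eq {f g : Q → ℝ[X]}
    (h : ∀ s, ∑ t with s ≤ t, (X ^ (posetRank t - posetRank s) - X) * f t =
      ∑ t with s ≤ t, (X ^ (posetRank t - posetRank s) - X) * g t) (s : Q) : f s = g s := by
  induction s using WellFoundedGT.induction with
  | ind s ih =>
    have hs := h s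
    rw [sum_ge_eq_add, sum_ge_eq_add, Finset.sum_congr rfl fun t ht => by
      rw [ih t (Finset.mem_filter.1 ht).2], Nat.sub_self, pow_zero] at hs
    exact mul_left_cancel₀ one_sub_X_ne_zero (add_right_cancel hs)

variable [OrderTop Q]

theorem chowUpper_top : chowUpper (⊤ : Q) = 1 := by
  rw [chowUpper, if_pos rfl]

open Classical in
theorem chowUpper_of_ne_top {s : Q} (hs : s ≠ ⊤) :
    chowUpper s = ∑ t with s < t, reducedCharPoly s t * chowUpper t := by
  rw [chowUpper, if_neg hs, Finset.sum_subtype (Finset.univ.filter (s < ·)) (p := fun t => s < t)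
    (by simp)]

open Classical in
theorem sum_ge_intervalCharPoly_mul_chowUpper (s : Q) :
    ∑ t with s ≤ t, intervalCharPoly s t * chowUpper t =
      X * chowUpper s + if s = ⊤ then 1 - X else 0 := by
  rw [sum_ge_eq_add, intervalCharPoly_self, one_mul]
  by_cases hs : s = ⊤
  · subst hs
    rw [if_pos rfl, Finset.filter_false_of_mem fun t _ => not_top_lt, Finset.sum_empty,
      chowUpper_top]
    ring
  · have h : ∑ t with s < t, intervalCharPoly s t * chowUpper t = (X - 1) * chowUpper s := by
      rw [chowUpper_of_ne_top hs, Finset.mul_sum]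
      refine Finset.sum_congr rfl fun t ht => ?_
      rw [← sub_one_mul_reducedCharPoly (Finset.mem_filter.1 ht).2, mul_assoc]
    rw [h, if_neg hs]
    ring

-- Möbius inversion removes the characteristic polynomials from the defining recursion.
open Classical in
theorem sum_ge_pow_sub_X_mul_chowUpper (s : Q) :
    ∑ t with s ≤ t, (X ^ (posetRank t - posetRank s) - X) * chowUpper t = 1 - X := by
  have h : ∑ t with s ≤ t, X ^ (posetRank t - posetRank s) * chowUpper t =
      X * ∑ t with s ≤ t, chowUpper t + (1 - X) := by
    rw [← sum_ge_sum_ge_mobiusFun_smul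
      (fun w => ∑ t with w ≤ t, X ^ (posetRank t - posetRank w) * chowUpper t)]
    simp_rw [← sum_ge_intervalCharPoly_mul, sum_ge_intervalCharPoly_mul_chowUpper]
    rw [Finset.sum_add_distrib, ← Finset.mul_sum, Finset.sum_ite_eq', if_pos (by simp)]
  simp only [sub_mul, Finset.sum_sub_distrib, ← Finset.mul_sum, h, add_sub_cancel_left]

theorem eval_zero_chowUpper (s : Q) : (chowUpper s).eval 0 = 1 := by
  classical
  have h := congrArg (eval 0) (sum_ge_pow_sub_X_mul_chowUpper s)
  rw [eval_finsetSum, Finset.sum_eq_single_of_mem s (by simp)] at h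
  · simpa using h
  · intro t ht hts
    have hlt := posetRank_strictMono (lt_of_le_of_ne (Finset.mem_filter.1 ht).2 hts.symm)
    simp [(Nat.sub_pos_of_lt hlt).ne']

end ChowUpper

section ChowPoly

variable {Q : Type u} [PartialOrder Q] [BoundedOrder Q] [Fintype Q]

theorem chowPoly_ne_zero : chowPoly Q ≠ 0 := by
  intro h
  have heval := eval_zero_chowUpper (⊥ : Q)
  rw [← chowPoly, h, eval_zero] at heval
  exact zero_ne_one heval

theorem augChowPoly_eq_sum : augChowPoly Q = ∑ t : Q, X * chowUpper t + (1 - X) := by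
  classical
  have h := sum_ge_pow_sub_X_mul_chowUpper (⊥ : Q)
  simp only [bot_le, Finset.filter_true, posetRank_bot, Nat.sub_zero, sub_mul,
    Finset.sum_sub_distrib] at h
  rw [augChowPoly, ← h, add_sub_cancel]

variable (hrank : ∀ s : Q, posetRank (OrderDual.toDual s) = posetRank (⊤ : Q) - posetRank s)

include hrank

open Classical in
theorem sum_le_pow_sub_X_mul_chowUpper_toDual (s : Q) :
    ∑ t with t ≤ s, (X ^ (posetRank s - posetRank t) - X) * chowUpper (OrderDual.toDual t) =
      1 - X := by
  rw [← sum_ge_pow_sub_X_mul_chowUpper (OrderDual.toDual s), Finset.sum_filter, Finset.sum_filter]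
  refine Fintype.sum_equiv OrderDual.toDual _ _ fun t => ?_
  rw [OrderDual.toDual_le_toDual, hrank, hrank]
  refine ite_congr rfl (fun hts => ?_) fun _ => rfl
  have ht := posetRank_strictMono.monotone hts
  have hs := posetRank_le_top s
  rw [show posetRank (⊤ : Q) - posetRank t - (posetRank (⊤ : Q) - posetRank s) =
    posetRank s - posetRank t by omega]

-- Pairing `f` with the Chow polynomials of the dual order evaluates the same double sum twice.
open Classical in
theorem chowPoly_orderDual_eq_sum {f : Q → ℝ[X]}
    (hf : ∀ s, ∑ t with s ≤ t, (X ^ (posetRank t - posetRank s) - X) * f t =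
      if s = ⊤ then 1 - X else 0) : chowPoly Qᵒᵈ = ∑ t, f t := by
  refine mul_left_cancel₀ one_sub_X_ne_zero ?_
  calc (1 - X) * chowPoly Qᵒᵈ
    _ = ∑ s : Q, chowUpper (OrderDual.toDual s) *
          ∑ t with s ≤ t, (X ^ (posetRank t - posetRank s) - X) * f t := by
      simp_rw [hf, mul_ite, mul_zero]
      rw [Finset.sum_ite_eq', if_pos (Finset.mem_univ _), mul_comm]
      rfl
    _ = ∑ t, ∑ s with s ≤ t,
          (X ^ (posetRank t - posetRank s) - X) * chowUpper (OrderDual.toDual s) * f t := by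
      simp_rw [Finset.mul_sum]
      rw [Finset.sum_comm' (t' := Finset.univ) (s' := fun t => {s | s ≤ t}) (by simp)]
      exact Finset.sum_congr rfl fun t _ => Finset.sum_congr rfl fun s _ => by ring
    _ = (1 - X) * ∑ t, f t := by
      simp_rw [← Finset.sum_mul, sum_le_pow_sub_X_mul_chowUpper_toDual hrank, Finset.mul_sum]

end ChowPoly

/-! ### Rank-selected posets and their parameters -/

/-- `D` consists of the rank, widths and descent counts of the graded poset `P`; the set of selected
ranks of `D` is arbitrary. -/
structure RankParams.Describes (D : RankParams) (P : Type u) [PartialOrder P] [BoundedOrder P]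
    [Fintype P] : Prop where
  graded : IsGradedPoset P
  top_eq : D.top = posetRank (⊤ : P)
  isRankData : IsRankData P D.bound D.width D.desc

theorem UMELShellable.exists_describes {P : Type u} [PartialOrder P] [BoundedOrder P] [Fintype P]
    (hP : UMELShellable.{u, v} P) (S : Finset ℕ) : ∃ D : RankParams, D.sel = S ∧ D.Describes P := by
  obtain ⟨N, w, d, h⟩ := hP.exists_rankData
  exact ⟨⟨posetRank (⊤ : P), N, w, d, S⟩, rfl, hP.1, rfl, h⟩

namespace RankParams.Describes

variable {P : Type u} [PartialOrder P] [BoundedOrder P] [Fintype P] {D : RankParams}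
  (hD : D.Describes P)

include hD

theorem total_pathCount_eq_one {k : ℕ} (hk : k < D.top) : D.total k (D.pathCount k) = 1 := by
  classical
  rw [hD.top_eq] at hk
  obtain ⟨s, rfl⟩ := exists_posetRank_eq hD.graded hk.le
  have hs := posetRank_lt_top_iff.1 hk
  have hsum := hD.isRankData.sum_eq (fun _ => 1) (fun l => if l = D.top then 1 else 0)
    (fun k i => (D.pathCount k i : ℝ[X]))
    (fun k hk i => by
      rw [← hD.top_eq] at hk
      rw [if_pos hk, pathCount_last hk, Nat.cast_one])
    (fun k hk i => by
      rw [← hD.top_eq] at hk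
      rw [if_neg hk.ne, zero_add, one_mul, pathCount_eq hk]
      exact map_weightedSum (Nat.castRingHom ℝ[X]) _) s hs
  rw [Finset.sum_eq_single_of_mem ⊤ (by simpa using lt_top_iff_ne_top.2 hs) fun t _ ht => by
    rw [hD.top_eq, if_neg (posetRank_lt_top_iff.2 ht).ne, mul_zero], Finset.prod_const_one,
    if_pos hD.top_eq.symm, one_mul, ← total_eq_sum] at hsum
  exact Nat.cast_injective
    ((map_weightedSum (Nat.castRingHom ℝ[X]) _).trans (hsum.symm.trans Nat.cast_one.symm))

theorem admissible : D.Admissible where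
  mono := hD.isRankData.mono
  total_pathCount_pos k hk := by rw [hD.total_pathCount_eq_one hk]; exact one_pos

variable {s : RankSelected P D.sel}

theorem posetRank_val_lt_top (hs : s ≠ ⊤) : posetRank s.1 < D.top :=
  (posetRank_lt_top_iff.2 (RankSelected.val_ne_top hs)).trans_eq hD.top_eq.symm

theorem top_pos [Nontrivial (RankSelected P D.sel)] : 0 < D.top :=
  (Nat.zero_le _).trans_lt (hD.posetRank_val_lt_top (s := ⊥) bot_ne_top)

open Classical in
theorem sum_gt_eq_total {y c : ℝ[X]} {φ : ℕ → ℝ[X]} {E : ℕ → ℕ → ℝ[X]}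
    (hE₀ : ∀ k, k + 1 = D.top → ∀ i, E k i = c)
    (hE : ∀ k, k + 1 < D.top → ∀ i, E k i = (if k + 1 ∈ D.sel then φ (k + 1) else 0) +
      (if k + 1 ∈ D.sel then y else 1) * D.suffix (k + 1) (D.desc k i) (E (k + 1)))
    (hs : s ≠ ⊤) :
    ∑ t with s < t, y ^ (posetRank t - posetRank s - 1) *
        (if t = ⊤ then c else φ (posetRank t.1)) =
      D.total (posetRank s.1) (E (posetRank s.1)) := by
  have hsum := hD.isRankData.sum_eq (fun l => if l ∈ D.sel then y else 1)
    (fun l => if l = D.top then c else if l ∈ D.sel then φ l else 0) E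
    (fun k hk i => by
      rw [← hD.top_eq] at hk
      rw [if_pos hk, hE₀ k hk])
    (fun k hk i => by
      rw [← hD.top_eq] at hk
      rw [if_neg hk.ne, hE k hk]
      rfl) s.1 (RankSelected.val_ne_top hs)
  rw [total_eq_sum, ← hsum]
  refine Finset.sum_of_injOn (fun t => t.1) (fun _ _ _ _ h => Subtype.ext h)
    (fun t ht => ?_) (fun t ht ht_sel => ?_) (fun t ht => ?_)
  · have hst : s < t := (Finset.mem_filter.1 (Finset.mem_coe.1 ht)).2
    exact Finset.mem_coe.2 ((Finset.mem_filter_univ _).2 hst)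
  · have hst : s.1 < t := (Finset.mem_filter.1 ht).2
    have hrank (h : posetRank t ∈ D.sel ∨ posetRank t = 0 ∨ posetRank t = posetRank (⊤ : P)) :
        False :=
      ht_sel ⟨⟨t, h⟩, Finset.mem_coe.2 ((Finset.mem_filter_univ _).2 hst), rfl⟩
    rw [if_neg fun h => hrank (Or.inr (Or.inr (h.trans hD.top_eq))),
      if_neg fun h => hrank (Or.inl h), mul_zero]
  · have hst : posetRank s.1 < posetRank t.1 := posetRank_strictMono (Finset.mem_filter.1 ht).2
    rw [prod_Ioo_ite_mem_eq_pow y (RankSelected.posetRank_val_mem hs) hst,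
      ← RankSelected.posetRank_eq hD.graded, ← RankSelected.posetRank_eq hD.graded]
    by_cases ht_top : t = ⊤
    · rw [if_pos ht_top, if_pos (by rw [ht_top]; exact hD.top_eq.symm)]
    · have ht_mem : posetRank t.1 ∈ D.sel :=
        Finset.mem_of_mem_insert_of_ne (RankSelected.posetRank_val_mem ht_top) (by omega)
      rw [if_neg ht_top, if_neg (hD.posetRank_val_lt_top ht_top).ne, if_pos ht_mem]

open Classical in
theorem total_lower_eq (e : ℕ) (hs : s ≠ ⊤) :
    D.total (posetRank s.1) (D.lower e (posetRank s.1)) =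
      ∑ t with s < t, if t = ⊤ then 1 else X * D.quot e (posetRank t.1) := by
  rw [← hD.sum_gt_eq_total (y := 1) (φ := fun l => X * D.quot e l)
    (fun k hk => lower_last hk) (fun k hk i => by rw [lower_eq hk, ite_self, one_mul]) hs]
  simp only [one_pow, one_mul]

open Classical in
theorem total_upper_eq (e : ℕ) (hs : s ≠ ⊤) :
    D.total (posetRank s.1) (D.upper e (posetRank s.1)) =
      ∑ t with s < t, X ^ (posetRank t - posetRank s - 1) *
        if t = ⊤ then X ^ e else X * D.quot e (posetRank t.1) :=
  (hD.sum_gt_eq_total (φ := fun l => X * D.quot e l) (fun _ => upper_last) (fun _ => upper_eq)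
    hs).symm

open Classical in
theorem total_hFamily_eq (hs : s ≠ ⊤) :
    D.total (posetRank s.1) (D.hFamily (posetRank s.1)) =
      ∑ t with s < t, (1 - X) ^ (posetRank t - posetRank s - 1) *
        if t = ⊤ then 1 else X * D.total (posetRank t.1) (D.hFamily (posetRank t.1)) :=
  (hD.sum_gt_eq_total (φ := fun l => X * D.total l (D.hFamily l)) (fun _ => hFamily_last)
    (fun _ => hFamily_eq) hs).symm

end RankParams.Describes

/-! ### Chow polynomials of rank-selected posets -/

section

variable {P : Type u} [PartialOrder P] [BoundedOrder P] {D : RankParams}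

open Classical in
/-- The solution of the triangular system of `RankParams.Describes.sum_ge_pow_sub_X_mul_selChow`
that is read off from the parameters. For `e = 1` it is `X` times the Chow polynomial of the upper
interval, for `e = 0` it sums to the Chow polynomial of the dual. -/
noncomputable def RankParams.selChow (D : RankParams) (e : ℕ) (s : RankSelected P D.sel) : ℝ[X] :=
  if s = ⊤ then X ^ e else X * D.quot e (posetRank s.1)

theorem RankParams.selChow_top (e : ℕ) : D.selChow e (⊤ : RankSelected P D.sel) = X ^ e :=
  if_pos rfl

theorem RankParams.selChow_of_ne_top (e : ℕ) {s : RankSelected P D.sel} (hs : s ≠ ⊤) :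
    D.selChow e s = X * D.quot e (posetRank s.1) :=
  if_neg hs

end

namespace RankParams.Describes

variable {P : Type u} [PartialOrder P] [BoundedOrder P] [Fintype P] {D : RankParams}
  (hD : D.Describes P) {e : ℕ} {s : RankSelected P D.sel}

include hD

open Classical in
theorem sum_gt_selChow (e : ℕ) (hs : s ≠ ⊤) :
    ∑ t with s < t, D.selChow e t =
      D.total (posetRank s.1) (D.lower e (posetRank s.1)) + (X ^ e - 1) := by
  have hsub : ∑ t with s < t, (D.selChow e t - if t = ⊤ then 1 else X * D.quot e (posetRank t.1)) =
      X ^ e - 1 := by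
    rw [Finset.sum_eq_single_of_mem ⊤ (by simpa using lt_top_iff_ne_top.2 hs) fun t _ ht => by
      rw [selChow_of_ne_top e ht, if_neg ht, sub_self], selChow_top, if_pos rfl]
  rw [hD.total_lower_eq e hs, ← hsub, Finset.sum_sub_distrib, add_sub_cancel]

open Classical in
theorem sum_gt_pow_mul_selChow (e : ℕ) (hs : s ≠ ⊤) :
    ∑ t with s < t, X ^ (posetRank t - posetRank s) * D.selChow e t =
      X * D.total (posetRank s.1) (D.upper e (posetRank s.1)) := by
  rw [hD.total_upper_eq e hs, Finset.mul_sum]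
  refine Finset.sum_congr rfl fun t ht => ?_
  have hst := Nat.sub_pos_of_lt (posetRank_strictMono (Finset.mem_filter.1 ht).2)
  rw [← mul_assoc, mul_pow_sub_one hst.ne']
  rfl

open Classical in
theorem sum_ge_pow_sub_X_mul_selChow (he : e ≤ 1) (s : RankSelected P D.sel) :
    ∑ t with s ≤ t, (X ^ (posetRank t - posetRank s) - X) * D.selChow e t =
      if s = ⊤ then (1 - X) * X ^ e else X * (1 - X ^ e) := by
  rw [sum_ge_eq_add, Nat.sub_self, pow_zero]
  split_ifs with hs
  · subst hs
    rw [Finset.filter_false_of_mem fun t _ => not_top_lt, Finset.sum_empty, selChow_top, add_zero]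
  · have hquot := hD.admissible.sub_one_mul_quot he (hD.posetRank_val_lt_top hs)
    simp only [sub_mul, Finset.sum_sub_distrib, ← Finset.mul_sum]
    rw [hD.sum_gt_pow_mul_selChow e hs, hD.sum_gt_selChow e hs, selChow_of_ne_top e hs]
    linear_combination -X * hquot

theorem X_mul_chowUpper_eq_selChow (s : RankSelected P D.sel) :
    X * chowUpper s = D.selChow 1 s := by
  classical
  refine eq_of_sum_ge_pow_sub_X_mul_eq (f := fun t => X * chowUpper t) (fun s => ?_) s
  rw [hD.sum_ge_pow_sub_X_mul_selChow le_rfl]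
  simp only [mul_left_comm _ X, ← Finset.mul_sum, sum_ge_pow_sub_X_mul_chowUpper]
  split_ifs <;> ring

variable [Nontrivial (RankSelected P D.sel)]

theorem sum_selChow (e : ℕ) : ∑ t : RankSelected P D.sel, D.selChow e t =
    X * D.quot e 0 + D.total 0 (D.lower e 0) + (X ^ e - 1) := by
  classical
  have hrank : posetRank (⊥ : RankSelected P D.sel).1 = 0 := posetRank_bot
  have hsum := sum_ge_eq_add (⊥ : RankSelected P D.sel) (D.selChow e)
  rw [Finset.filter_true_of_mem fun t _ => bot_le, hD.sum_gt_selChow e bot_ne_top,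
    selChow_of_ne_top e bot_ne_top, hrank] at hsum
  rw [hsum, add_assoc]

theorem chowPoly_eq : chowPoly (RankSelected P D.sel) = D.quot 1 0 := by
  have hrank : posetRank (⊥ : RankSelected P D.sel).1 = 0 := posetRank_bot
  have h := hD.X_mul_chowUpper_eq_selChow ⊥
  rw [selChow_of_ne_top 1 bot_ne_top, hrank] at h
  exact mul_left_cancel₀ X_ne_zero h

theorem augChowPoly_eq :
    augChowPoly (RankSelected P D.sel) = X * D.quot 1 0 + D.total 0 (D.lower 1 0) := by
  rw [augChowPoly_eq_sum, Finset.sum_congr rfl fun t _ => hD.X_mul_chowUpper_eq_selChow t,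
    hD.sum_selChow]
  ring

theorem chowPoly_orderDual_eq :
    chowPoly (RankSelected P D.sel)ᵒᵈ = X * D.quot 0 0 + D.total 0 (D.lower 0 0) := by
  classical
  rw [chowPoly_orderDual_eq_sum (RankSelected.posetRank_toDual hD.graded) fun s => by
    rw [hD.sum_ge_pow_sub_X_mul_selChow zero_le_one, pow_zero, mul_one, sub_self, mul_zero],
    hD.sum_selChow]
  ring

end RankParams.Describes

/-! ### The order complex -/

section OrderComplex

theorem hPoly_eq_sum {ι : Type u} [Fintype ι] (Δ : AbstractSimplicialComplex ι)
    [DecidablePred fun c : Finset ι => c = ∅ ∨ c ∈ Δ] :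
    hPoly Δ = ∑ c : Finset ι with c = ∅ ∨ c ∈ Δ,
      X ^ c.card * (1 - X) ^ (maxFaceCard Δ - c.card) := by
  classical
  have hcard (c : Finset ι) (hc : c ∈ Finset.univ.filter fun c => c = ∅ ∨ c ∈ Δ) :
      c.card ∈ Finset.range (maxFaceCard Δ + 1) := by
    rw [Finset.mem_range, Nat.lt_succ_iff]
    rcases (Finset.mem_filter.1 hc).2 with rfl | hΔ
    · exact Nat.zero_le _
    · exact Finset.le_sup (f := Finset.card) (by simpa using hΔ)
  rw [hPoly, ← Finset.sum_fiberwise_of_maps_to hcard]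
  refine Finset.sum_congr rfl fun i _ => ?_
  rw [Finset.sum_congr rfl (g := fun _ => X ^ i * (1 - X) ^ (maxFaceCard Δ - i)) fun c hc => by
    rw [(Finset.mem_filter.1 hc).2], Finset.sum_const, Finset.filter_filter, nsmul_eq_mul,
    faceNumber, map_natCast, mul_assoc]
  congr!

variable {Q : Type u} [PartialOrder Q]

theorem eq_empty_or_mem_orderComplex_iff {c : Finset Q} :
    c = ∅ ∨ c ∈ orderComplex Q ↔ IsChain (· ≤ ·) (c : Set Q) := by
  refine ⟨?_, fun hc => c.eq_empty_or_nonempty.imp_right fun hne => ⟨hne, hc⟩⟩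
  rintro (rfl | hc)
  · simp
  · exact hc.2

theorem posetRank_injOn_of_isChain [Finite Q] {c : Set Q} (hc : IsChain (· ≤ ·) c) :
    Set.InjOn posetRank c := by
  intro x hx y hy hxy
  by_contra hne
  rcases hc hx hy hne with h | h
  · exact (posetRank_strictMono (lt_of_le_of_ne h hne)).ne hxy
  · exact (posetRank_strictMono (lt_of_le_of_ne' h hne)).ne' hxy

variable [Fintype Q]

open Classical in
/-- The chains all of whose elements are larger than `s`. -/
noncomputable def chainsAbove (s : Q) : Finset (Finset Q) :=
  {c | IsChain (· ≤ ·) (c : Set Q) ∧ ∀ x ∈ c, s < x}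

variable {s t : Q} {c c' : Finset Q}

theorem mem_chainsAbove :
    c ∈ chainsAbove s ↔ IsChain (· ≤ ·) (c : Set Q) ∧ ∀ x ∈ c, s < x := by
  simp [chainsAbove]

theorem notMem_of_mem_chainsAbove (hc : c ∈ chainsAbove s) : s ∉ c :=
  fun h => ((mem_chainsAbove.1 hc).2 s h).false

theorem card_le_of_mem_chainsAbove [OrderTop Q] (hc : c ∈ chainsAbove s) :
    c.card ≤ posetRank (⊤ : Q) - posetRank s := by
  rw [mem_chainsAbove] at hc
  rw [← Nat.card_Ioc]
  refine Finset.card_le_card_of_injOn posetRank (fun x hx => ?_) (posetRank_injOn_of_isChain hc.1)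
  rw [Finset.coe_Ioc]
  exact ⟨posetRank_strictMono (hc.2 x hx), posetRank_le_top x⟩

variable [DecidableEq Q]

theorem isChain_insert_of_mem_chainsAbove (hc : c ∈ chainsAbove s) :
    IsChain (· ≤ ·) ((insert s c : Finset Q) : Set Q) := by
  rw [mem_chainsAbove] at hc
  rw [Finset.coe_insert]
  exact hc.1.insert fun x hx _ => Or.inl (hc.2 x hx).le

theorem injOn_insert_chainsAbove : Set.InjOn (insert s) (chainsAbove s : Set (Finset Q)) := by
  intro c hc c' hc' h
  rw [← Finset.erase_insert (notMem_of_mem_chainsAbove hc), h,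
    Finset.erase_insert (notMem_of_mem_chainsAbove hc')]

theorem le_of_insert_eq_insert (hc : c ∈ chainsAbove s) (h : insert s c = insert t c') :
    s ≤ t := by
  have ht : t ∈ insert s c := h ▸ Finset.mem_insert_self t c'
  rcases Finset.mem_insert.1 ht with rfl | ht
  · exact le_rfl
  · exact ((mem_chainsAbove.1 hc).2 t ht).le

theorem erase_mem_chainsAbove (hc : IsChain (· ≤ ·) (c : Set Q)) (hs : Minimal (· ∈ c) s) :
    c.erase s ∈ chainsAbove s := by
  rw [mem_chainsAbove]
  refine ⟨hc.mono (by simp), fun x hx => ?_⟩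
  rw [Finset.mem_erase] at hx
  refine lt_of_le_of_ne' ?_ hx.1
  rcases hc hx.2 hs.1 hx.1 with h | h
  · exact hs.2 hx.2 h
  · exact h

theorem chainsAbove_eq_insert_empty [DecidableLT Q] (s : Q) : chainsAbove s = insert ∅
    ((Finset.univ.filter (s < ·)).biUnion fun t => (chainsAbove t).image (insert t)) := by
  ext c
  simp only [Finset.mem_insert, Finset.mem_biUnion, Finset.mem_filter_univ, Finset.mem_image]
  constructor
  · intro hc
    rcases c.eq_empty_or_nonempty with rfl | hne
    · exact Or.inl rfl
    · obtain ⟨t, ht⟩ := Finset.exists_minimal hne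
      have hchain := mem_chainsAbove.1 hc
      exact Or.inr ⟨t, hchain.2 t ht.1, c.erase t, erase_mem_chainsAbove hchain.1 ht,
        Finset.insert_erase ht.1⟩
  · rintro (rfl | ⟨t, ht, c, hc, rfl⟩)
    · simp [mem_chainsAbove]
    · refine mem_chainsAbove.2 ⟨isChain_insert_of_mem_chainsAbove hc, fun x hx => ?_⟩
      rcases Finset.mem_insert.1 hx with rfl | hx
      · exact ht
      · exact ht.trans ((mem_chainsAbove.1 hc).2 x hx)

theorem sum_chainsAbove [DecidableLT Q] {A : Type*} [AddCommMonoid A] (s : Q)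
    (f : Finset Q → A) :
    ∑ c ∈ chainsAbove s, f c = f ∅ + ∑ t with s < t, ∑ c ∈ chainsAbove t, f (insert t c) := by
  rw [chainsAbove_eq_insert_empty, Finset.sum_insert (by simp), Finset.sum_biUnion]
  · simp only [Finset.sum_image injOn_insert_chainsAbove]
  · intro t _ t' _ hne
    rw [Function.onFun, Finset.disjoint_left]
    intro _ ha ha'
    obtain ⟨c, hc, rfl⟩ := Finset.mem_image.1 ha
    obtain ⟨c', hc', heq⟩ := Finset.mem_image.1 ha'
    exact hne (le_antisymm (le_of_insert_eq_insert hc heq.symm) (le_of_insert_eq_insert hc' heq))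

theorem sum_isChain_eq_sum_chainsAbove_bot [OrderBot Q] {A : Type*} [AddCommMonoid A]
    (f : Finset Q → A) [DecidablePred fun c : Finset Q => IsChain (· ≤ ·) (c : Set Q)] :
    ∑ c ∈ Finset.univ.filter fun c : Finset Q => IsChain (· ≤ ·) (c : Set Q), f c =
      ∑ c ∈ chainsAbove (⊥ : Q), (f c + f (insert ⊥ c)) := by
  have hchains : Finset.univ.filter (fun c : Finset Q => IsChain (· ≤ ·) (c : Set Q)) =
      chainsAbove ⊥ ∪ (chainsAbove ⊥).image (insert ⊥) := by
    ext c
    simp only [Finset.mem_filter_univ, Finset.mem_union, Finset.mem_image]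
    constructor
    · intro hc
      by_cases hbot : ⊥ ∈ c
      · exact Or.inr ⟨c.erase ⊥, erase_mem_chainsAbove hc ⟨hbot, fun _ _ _ => bot_le⟩,
          Finset.insert_erase hbot⟩
      · exact Or.inl (mem_chainsAbove.2 ⟨hc, fun x hx => bot_lt_iff_ne_bot.2
          (ne_of_mem_of_not_mem hx hbot)⟩)
    · rintro (hc | ⟨c, hc, rfl⟩)
      · exact (mem_chainsAbove.1 hc).1
      · exact isChain_insert_of_mem_chainsAbove hc
  rw [hchains, Finset.sum_union, Finset.sum_image injOn_insert_chainsAbove, Finset.sum_add_distrib]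
  rw [Finset.disjoint_left]
  intro _ hc hc'
  obtain ⟨c', -, rfl⟩ := Finset.mem_image.1 hc'
  exact notMem_of_mem_chainsAbove hc (Finset.mem_insert_self _ _)

end OrderComplex

section ChainPoly

variable {Q : Type u} [PartialOrder Q] [Fintype Q] [BoundedOrder Q]

/-- The generating polynomial of the chains above `s` whose value at the least element is the
`h`-polynomial of the order complex. -/
noncomputable def chainPoly (s : Q) : ℝ[X] :=
  ∑ c ∈ chainsAbove s, X ^ c.card * (1 - X) ^ (posetRank (⊤ : Q) - posetRank s - c.card)

open Classical in
theorem chainPoly_eq_add_sum (s : Q) :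
    chainPoly s = (1 - X) ^ (posetRank (⊤ : Q) - posetRank s) +
      ∑ t with s < t, X * (1 - X) ^ (posetRank t - posetRank s - 1) * chainPoly t := by
  rw [chainPoly, sum_chainsAbove]
  simp only [Finset.card_empty, pow_zero, one_mul, Nat.sub_zero]
  congr 1
  refine Finset.sum_congr rfl fun t ht => ?_
  rw [chainPoly, Finset.mul_sum]
  refine Finset.sum_congr rfl fun c hc => ?_
  have hc_card := card_le_of_mem_chainsAbove hc
  have hst := posetRank_strictMono (Finset.mem_filter.1 ht).2
  have ht_top := posetRank_le_top t
  rw [Finset.card_insert_of_notMem (notMem_of_mem_chainsAbove hc),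
    show posetRank (⊤ : Q) - posetRank s - (c.card + 1) =
      (posetRank t - posetRank s - 1) + (posetRank (⊤ : Q) - posetRank t - c.card) by omega,
    pow_add, pow_add]
  ring

theorem chainPoly_top : chainPoly (⊤ : Q) = 1 := by
  classical
  rw [chainPoly_eq_add_sum, Finset.filter_false_of_mem fun t _ => not_top_lt, Nat.sub_self,
    pow_zero, Finset.sum_empty, add_zero]

open Classical in
theorem chainPoly_of_ne_top {s : Q} (hs : s ≠ ⊤) :
    chainPoly s = ∑ t with s < t, (1 - X) ^ (posetRank t - posetRank s - 1) *
      if t = ⊤ then 1 else X * chainPoly t := by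
  have hs_top := lt_top_iff_ne_top.2 hs
  have hmem : ⊤ ∈ Finset.univ.filter (s < ·) := (Finset.mem_filter_univ _).2 hs_top
  have hrank := Nat.sub_pos_of_lt (posetRank_strictMono hs_top)
  rw [chainPoly_eq_add_sum, ← Finset.add_sum_erase _ _ hmem, ← Finset.add_sum_erase _ _ hmem,
    chainPoly_top, if_pos rfl, ← add_assoc, ← mul_pow_sub_one hrank.ne']
  congr 1
  · ring
  · refine Finset.sum_congr rfl fun t ht => ?_
    rw [if_neg (Finset.ne_of_mem_erase ht)]
    ring

theorem chainPoly_ne_zero (s : Q) : chainPoly s ≠ 0 := by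
  classical
  intro h
  have heval := congrArg (eval 0) h
  rw [chainPoly_eq_add_sum] at heval
  simp [eval_finsetSum] at heval

theorem maxFaceCard_orderComplex : maxFaceCard (orderComplex Q) = posetRank (⊤ : Q) + 1 := by
  classical
  refine le_antisymm (Finset.sup_le fun c hc => ?_) ?_
  · have hchain : IsChain (· ≤ ·) (c : Set Q) := (Finset.mem_filter.1 hc).2.2
    rw [← Finset.card_range (posetRank (⊤ : Q) + 1)]
    refine Finset.card_le_card_of_injOn posetRank (fun x _ => ?_)
      (posetRank_injOn_of_isChain hchain)
    rw [Finset.coe_range]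
    exact Nat.lt_succ_of_le (posetRank_le_top x)
  · obtain ⟨p, -, hp⟩ := Order.exists_series_of_height_eq_coe (⊤ : Q) (coe_posetRank _).symm
    have hcard : (Finset.univ.image p).card = posetRank (⊤ : Q) + 1 := by
      rw [Finset.card_image_of_injective _ p.strictMono.injective, Finset.card_univ,
        Fintype.card_fin, hp]
    rw [← hcard]
    refine Finset.le_sup (f := Finset.card) ((Finset.mem_filter_univ _).2 ⟨?_, ?_⟩)
    · exact Finset.univ_nonempty.image _
    · rw [Finset.coe_image, Finset.coe_univ, Set.image_univ]
      exact p.strictMono.monotone.isChain_range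

theorem hPoly_orderComplex : hPoly (orderComplex Q) = chainPoly (⊥ : Q) := by
  classical
  rw [hPoly_eq_sum]
  simp only [eq_empty_or_mem_orderComplex_iff]
  rw [sum_isChain_eq_sum_chainsAbove_bot, chainPoly, maxFaceCard_orderComplex]
  refine Finset.sum_congr rfl fun c hc => ?_
  have hcard := card_le_of_mem_chainsAbove hc
  rw [posetRank_bot] at hcard ⊢
  rw [Finset.card_insert_of_notMem (notMem_of_mem_chainsAbove hc), Nat.add_sub_add_right,
    Nat.sub_zero, Nat.sub_add_comm (by omega), pow_succ, pow_succ]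
  ring

theorem hPoly_orderComplex_ne_zero : hPoly (orderComplex Q) ≠ 0 :=
  hPoly_orderComplex (Q := Q) ▸ chainPoly_ne_zero ⊥

end ChainPoly

namespace RankParams.Describes

variable {P : Type u} [PartialOrder P] [BoundedOrder P] [Fintype P] {D : RankParams}

theorem chainPoly_eq (hD : D.Describes P) {s : RankSelected P D.sel} (hs : s ≠ ⊤) :
    chainPoly s = D.total (posetRank s.1) (D.hFamily (posetRank s.1)) := by
  classical
  induction s using WellFoundedGT.induction with
  | ind s ih =>
    rw [chainPoly_of_ne_top hs, hD.total_hFamily_eq hs]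
    refine Finset.sum_congr rfl fun t ht => ?_
    congr 1
    exact ite_congr rfl (fun _ => rfl) fun ht_top => by rw [ih t (Finset.mem_filter.1 ht).2 ht_top]

theorem hPoly_orderComplex_eq [Nontrivial (RankSelected P D.sel)] (hD : D.Describes P) :
    hPoly (orderComplex (RankSelected P D.sel)) = D.total 0 (D.hFamily 0) := by
  have hrank : posetRank (⊥ : RankSelected P D.sel).1 = 0 := posetRank_bot
  rw [hPoly_orderComplex, hD.chainPoly_eq bot_ne_top, hrank]

end RankParams.Describes

/-! ### Posets with one element -/

section Subsingleton

variable {Q : Type u} [PartialOrder Q] [BoundedOrder Q] [Fintype Q] [Subsingleton Q]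

theorem chowPoly_of_subsingleton : chowPoly Q = 1 := by
  rw [chowPoly, Subsingleton.elim (⊥ : Q) ⊤, chowUpper_top]

theorem augChowPoly_of_subsingleton : augChowPoly Q = 1 := by
  rw [augChowPoly_eq_sum, Fintype.sum_subsingleton _ (⊤ : Q), chowUpper_top, mul_one,
    add_sub_cancel]

theorem hPoly_orderComplex_of_subsingleton : hPoly (orderComplex Q) = 1 := by
  rw [hPoly_orderComplex, Subsingleton.elim (⊥ : Q) ⊤, chainPoly_top]

end Subsingleton

theorem mainTheorem5 (P : Type u) [PartialOrder P] [BoundedOrder P] [Fintype P]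
    (hP : UMELShellable.{u, v} P)
    (S : Finset ℕ) (hS : ∀ i ∈ S, 1 ≤ i ∧ i < posetRank (⊤ : P)) :
    (HasOnlyNonposRealRoots (chowPoly (RankSelected P S)) ∧
      HasOnlyNonposRealRoots (chowPoly (RankSelected P S)ᵒᵈ)) ∧
    HasOnlyNonposRealRoots (augChowPoly (RankSelected P S)) ∧
    RootsInterlace (chowPoly (RankSelected P S)) (augChowPoly (RankSelected P S)) ∧
    HasOnlyNonposRealRoots (hPoly (orderComplex (RankSelected P S))) := by
  rcases subsingleton_or_nontrivial (RankSelected P S) with hsub | hnontriv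
  · have hone := NonposRooted.one
    rw [chowPoly_of_subsingleton, chowPoly_of_subsingleton (Q := (RankSelected P S)ᵒᵈ),
      augChowPoly_of_subsingleton, hPoly_orderComplex_of_subsingleton]
    exact ⟨⟨hone.1, hone.1⟩, hone.1, Or.inl ((Prec.refl 1).interlaces hone hone), hone.1⟩
  · obtain ⟨D, rfl, hD⟩ := hP.exists_describes S
    have hadm := hD.admissible
    have htop : 0 < D.top := hD.top_pos
    have hquot : D.quot 1 0 ≠ 0 := hD.chowPoly_eq ▸ chowPoly_ne_zero
    have hh : D.total 0 (D.hFamily 0) ≠ 0 := hD.hPoly_orderComplex_eq ▸ hPoly_orderComplex_ne_zero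
    rw [hD.chowPoly_eq, hD.chowPoly_orderDual_eq, hD.augChowPoly_eq, hD.hPoly_orderComplex_eq]
    exact ⟨⟨(hadm.quot_nonposRooted le_rfl htop hquot).1,
        (hadm.augmented_nonposRooted zero_le_one htop).1⟩,
      (hadm.augmented_nonposRooted le_rfl htop).1,
      Or.inl (hadm.quot_interlaces le_rfl htop hquot),
      ((hadm.total_hFamily_rooted htop).resolve_left hh).1⟩
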